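/- **Theorem 2.12** (Global Cauchy–Kovalevskaya). Let $M$ be a compact real analytic manifold of dimension $n$ and let $\pi : V \to M$ be a real analytic vector bundle of rank $s$. Let $C^\infty(V)$ be the space of smooth sections of $V$ with the $C^\infty$ topology (uniform convergence of all derivatives on compact sets, in charts and local trivializations). Let $X : C^\infty(V) \to C^\infty(V)$ be a real analytic first order differential operator, i.e. every point of $M$ has an open neighbourhood $U$ which is the domain of a real analytic chart $u : U \to \mathbb{R}^n$ and over which there is a real analytic trivialization $(\pi, v) : V|_U \cong U \times \mathbb{R}^s$, together with a real analytic function $G : D \to \mathbb{R}^s$ on an open set $D \subset \mathbb{R}^n \times \mathbb{R}^s \times \mathbb{R}^{ns}$, such that for every section $c$ the point $\big(u, v\circ c, \tfrac{\partial c_i}{\partial u_j}\big)$ lies in $D$ on all of $U$ and $$v(X \circ c) = G\Big(u,\, v \circ c,\, \frac{\partial c_i}{\partial u_j}\Big) \quad \text{on } U,$$ where $c_i$ is the $i$-th component of $v \circ c$. Let $c_0 \in C^\infty(V)$ be a real analytic section. Consider the initial value problem $$\dot c(t) = X \circ c(t), \qquad c(0) = c_0, \tag{$*$}$$ where $\dot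 c$ is the derivative of a curve in $C^\infty(V)$. A real analytic solution of $(*)$ on $(-\varepsilon,\varepsilon)$ is a curve $c : (-\varepsilon,\varepsilon) \to C^\infty(V)$ satisfying $(*)$ for which $(t,p) \mapsto c(t)(p)$ is real analytic as a map $(-\varepsilon,\varepsilon) \times M \to V$. Then: 1. For some $\varepsilon > 0$ there is a real analytic solution $c$ of $(*)$ on $(-\varepsilon,\varepsilon)$ that has derivatives $c^{(k)}$ of all orders as a curve in $C^\infty(V)$ and satisfies, for all $t \in (-\varepsilon,\varepsilon)$, $$c(t) = \sum_{k=0}^{\infty} \frac{t^k}{k!}\, c^{(k)}(0),$$ where the series converges (unconditionally) in the $C^\infty$ topology. 2. For every $\delta > 0$, any two real analytic solutions of $(*)$ on $(-\delta,\delta)$ are equal. -/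

import Mathlib

open Set Filter Topology Bundle
open scoped Manifold ContDiff Nat

noncomputable section

section Sections

variable {E : Type*} [NormedAddCommGroup E] [NormedSpace ℝ E]
  {M : Type*} [TopologicalSpace M] [ChartedSpace E M]
  {F : Type*} [NormedAddCommGroup F] [NormedSpace ℝ F]
  {V : M → Type*} [TopologicalSpace (TotalSpace F V)] [∀ x, TopologicalSpace (V x)]
  [FiberBundle F V]

/-- The component functions of a section `f` in a chart `u` of the base and a trivialization `v`
of the bundle, as a function on the model space: `y ↦ v (f (u⁻¹ y))`, with values in the model
fibre. It is meaningful on `u (u.source ∩ v.baseSet)`. -/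
def localRep (u : OpenPartialHomeomorph M E) (v : Trivialization F (π F V))
    (f : ∀ x, V x) : E → F :=
  fun y => (v (TotalSpace.mk' F (u.symm y) (f (u.symm y)))).2

/-- The compact subsets of the image, in the preferred chart at `x₀`, of the set on which both this
chart and the preferred trivialization at `x₀` are defined. -/
def chartCompacts (F : Type*) [NormedAddCommGroup F] [NormedSpace ℝ F]
    (V : M → Type*) [TopologicalSpace (TotalSpace F V)] [∀ x, TopologicalSpace (V x)]
    [FiberBundle F V] (x₀ : M) : Set (Set E) :=
  {K | IsCompact K ∧
    K ⊆ chartAt E x₀ '' ((chartAt E x₀).source ∩ (trivializationAt F V x₀).baseSet)}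

/-- The `C^∞` topology on the space of smooth sections: the coarsest topology for which, in the
charts and trivializations around the points `x₀` of `M` and for each order `k`, the `k`-th
derivative of the local components depends continuously on the section, with respect to uniform
convergence on compact sets. -/
instance smoothSectionTopology : TopologicalSpace Cₛ^∞⟮𝓘(ℝ, E); F, V⟯ :=
  ⨅ (x₀ : M) (k : ℕ), TopologicalSpace.induced
    (fun f => UniformOnFun.ofFun (chartCompacts F V x₀)
      (iteratedFDeriv ℝ k (localRep (chartAt E x₀) (trivializationAt F V x₀) (fun x => f x))))
    inferInstance

/-- A real analytic local trivialization of a vector bundle: it is linear on the fibres, and it is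
real analytic together with its inverse. -/
structure IsAnalyticTrivialization [∀ x, AddCommGroup (V x)] [∀ x, Module ℝ (V x)]
    (v : Trivialization F (π F V)) : Prop where
  linear : v.IsLinear ℝ
  analytic_toFun : ContMDiffOn (𝓘(ℝ, E).prod 𝓘(ℝ, F)) (𝓘(ℝ, E).prod 𝓘(ℝ, F)) ω v v.source
  analytic_symm : ContMDiffOn (𝓘(ℝ, E).prod 𝓘(ℝ, F)) (𝓘(ℝ, E).prod 𝓘(ℝ, F)) ω
    v.toOpenPartialHomeomorph.symm v.target

/-- Real analytic first order differential operators on the smooth sections of a bundle: around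
each point there are a real analytic chart `u`, a real analytic trivialization `v` over its domain,
and a real analytic function `G` on an open set `D`, such that the components of `X c` are obtained
by inserting in `G` the coordinates of the point, the components of `c` and their first partial
derivatives. The Jacobian matrix of the components is taken as a linear map from `E` to `F`. -/
def IsAnalyticFirstOrderDiffOp [∀ x, AddCommGroup (V x)] [∀ x, Module ℝ (V x)]
    (X : Cₛ^∞⟮𝓘(ℝ, E); F, V⟯ → Cₛ^∞⟮𝓘(ℝ, E); F, V⟯) : Prop :=
  ∀ p : M, ∃ (u : OpenPartialHomeomorph M E) (v : Trivialization F (π F V))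
    (D : Set (E × F × (E →L[ℝ] F))) (G : E × F × (E →L[ℝ] F) → F),
    p ∈ u.source ∧ u ∈ IsManifold.maximalAtlas 𝓘(ℝ, E) ω M ∧
    u.source ⊆ v.baseSet ∧ IsAnalyticTrivialization (E := E) v ∧
    IsOpen D ∧ AnalyticOnNhd ℝ G D ∧
    ∀ (c : Cₛ^∞⟮𝓘(ℝ, E); F, V⟯), ∀ q ∈ u.source,
      (u q, localRep u v (fun x => c x) (u q),
        fderiv ℝ (localRep u v (fun x => c x)) (u q)) ∈ D ∧
      localRep u v (fun x => X c x) (u q) =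
        G (u q, localRep u v (fun x => c x) (u q),
          fderiv ℝ (localRep u v (fun x => c x)) (u q))

/-- A section is real analytic if it is so as a map from `M` to the total space. -/
def IsAnalyticSection (f : Cₛ^∞⟮𝓘(ℝ, E); F, V⟯) : Prop :=
  ContMDiff 𝓘(ℝ, E) (𝓘(ℝ, E).prod 𝓘(ℝ, F)) ω (fun x => TotalSpace.mk' F x (f x))

/-- The curve `c` of smooth sections has derivative `c'` at time `t`: its difference quotients
converge to `c'` in the `C^∞` topology. -/
def HasCurveDerivAt [∀ x, AddCommGroup (V x)] [∀ x, Module ℝ (V x)] [VectorBundle ℝ F V]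
    (c : ℝ → Cₛ^∞⟮𝓘(ℝ, E); F, V⟯) (c' : Cₛ^∞⟮𝓘(ℝ, E); F, V⟯) (t : ℝ) : Prop :=
  Tendsto (fun h : ℝ => h⁻¹ • (c (t + h) - c t)) (𝓝[≠] 0) (𝓝 c')

/-- The curve of smooth sections `c` is, on `(-ε, ε)`, a real analytic solution of the initial
value problem `c' = X ∘ c`, `c 0 = c₀`: real analyticity means that `(t, x) ↦ c t x` is real
analytic as a map from `(-ε, ε) × M` to the total space. -/
structure IsAnalyticSolution [∀ x, AddCommGroup (V x)] [∀ x, Module ℝ (V x)] [VectorBundle ℝ F V]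
    (X : Cₛ^∞⟮𝓘(ℝ, E); F, V⟯ → Cₛ^∞⟮𝓘(ℝ, E); F, V⟯) (c₀ : Cₛ^∞⟮𝓘(ℝ, E); F, V⟯)
    (ε : ℝ) (c : ℝ → Cₛ^∞⟮𝓘(ℝ, E); F, V⟯) : Prop where
  initial : c 0 = c₀
  deriv_eq : ∀ t ∈ Ioo (-ε) ε, HasCurveDerivAt c (X (c t)) t
  analytic : ContMDiffOn (𝓘(ℝ, ℝ).prod 𝓘(ℝ, E)) (𝓘(ℝ, E).prod 𝓘(ℝ, F)) ω
    (fun q : ℝ × M => TotalSpace.mk' F q.2 (c q.1 q.2)) (Ioo (-ε) ε ×ˢ univ)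

/-- `d k`, for `k = 0, 1, 2, …`, are the successive derivatives of the curve `c` on `(-ε, ε)`,
in the `C^∞` topology. -/
structure IsIteratedCurveDeriv [∀ x, AddCommGroup (V x)] [∀ x, Module ℝ (V x)]
    [VectorBundle ℝ F V]
    (ε : ℝ) (c : ℝ → Cₛ^∞⟮𝓘(ℝ, E); F, V⟯) (d : ℕ → ℝ → Cₛ^∞⟮𝓘(ℝ, E); F, V⟯) : Prop where
  zero : d 0 = c
  succ : ∀ k, ∀ t ∈ Ioo (-ε) ε, HasCurveDerivAt (d k) (d (k + 1) t) t

end Sections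

end

/-!
The theorem is a compact, global form of the Cauchy–Kovalevskaya theorem.

**Local existence.** Instead of majorants, the local problem is solved by a contraction in a Banach
algebra. For power series in finitely many variables, take the weighted `ℓ¹` norm
`∑ |a_β| ∏ βᵢ! / |β|!`. The inverse multinomial coefficients are submultiplicative, so this is a
Banach algebra `WSeries σ`, and its elements are analytic functions near the origin
(`WSeries.analyticAt_ev`). The point of these weights is that the primitive `∫ dt` and all
compositions `∂ᵢ ∘ ∫ dt` have norm at most one (`WSeries.derivPrimitive`): integration in time pays
for one derivative in space. After subtracting the initial values, the equation for `W = ∂ₜ w` reads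
`W = G (y, ∫ W, ∂ ∫ W)`. An analytic `G` acts analytically on the algebra
(`WSeries.exists_extension`), so after a change of scale the right-hand side is a contraction
(`exists_fixedPoint`). This gives `exists_local_solution`.

**Uniqueness.** The equation determines all time derivatives at time `0`: the Taylor polynomial
of order `k` in time, inserted into the right-hand side, gives the time derivative up to
`O(t ^ (k + 1))` (`isBigO_comp_sub_comp_timeTaylor`). Analytic continuation in time along the fibre
over a fixed point finishes the argument (`IsAnalyticSolution.eqOn`).

**Global existence.** By compactness there are local solutions around all points on a common time
interval (`LocalSolution.exists_forall_nonempty`). As `X` acts on global sections only, two local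
solutions cannot be compared directly by local uniqueness: the operator may have different
expressions in different charts, and these are only known to agree on the jets of global sections.
But by induction on `k` the time derivatives at time `0` of order at most `k` fit together to global
sections, hence so does the Taylor polynomial of order `k`, and applying `X` to it shows that the
derivatives of order `k + 1` fit together too (`LocalSolution.compatible_zero`). By analyticity in
time the local solutions themselves agree (`LocalSolution.compatible`).

**Topology.** Convergence in the `C^∞` topology can be tested in one analytic chart and
trivialization around each point (`tendsto_smoothSection_of_local`). There, difference quotients
and Taylor series in time of an analytic function converge together with all space derivatives
(`tendstoUniformlyOn_iteratedFDeriv_slope`, `tendstoUniformlyOn_iteratedFDeriv_timeTaylor`).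
-/

noncomputable section

/-! ### A Banach algebra of power series -/

section WeightedSeries

variable {σ : Type*} [Fintype σ]

/-- The weight `∏ βᵢ! / |β|!`, the inverse of a multinomial coefficient. -/
def multiWeight (β : σ →₀ ℕ) : ℝ :=
  ((∏ i, (β i)! : ℕ) : ℝ) / ((∑ i, β i)! : ℕ)

lemma multiWeight_pos (β : σ →₀ ℕ) : 0 < multiWeight β := by
  unfold multiWeight
  have h : 0 < ∏ i, (β i)! := Finset.prod_pos fun i _ => Nat.factorial_pos _
  have h' := Nat.factorial_pos (∑ i, β i)
  positivity

lemma multiWeight_zero : multiWeight (0 : σ →₀ ℕ) = 1 := by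
  simp [multiWeight]

lemma choose_mul_choose_le (a b c d : ℕ) :
    (a + b).choose a * (c + d).choose c ≤ (a + c + (b + d)).choose (a + c) := by
  have h : a + c + (b + d) = (a + b) + (c + d) := by ring
  rw [h, Nat.add_choose_eq (a + b)]
  exact Finset.single_le_sum (f := fun p : ℕ × ℕ => (a + b).choose p.1 * (c + d).choose p.2)
    (fun _ _ => Nat.zero_le _) (a := (a, c))
    (Finset.HasAntidiagonal.mem_antidiagonal.2 rfl)

omit [Fintype σ] in
lemma prod_choose_le (s : Finset σ) (β γ : σ → ℕ) :
    ∏ i ∈ s, (β i + γ i).choose (β i) ≤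
      (∑ i ∈ s, β i + ∑ i ∈ s, γ i).choose (∑ i ∈ s, β i) := by
  classical
  induction s using Finset.induction_on with
  | empty => simp
  | insert i s his ih =>
    rw [Finset.prod_insert his, Finset.sum_insert his, Finset.sum_insert his]
    exact (Nat.mul_le_mul_left _ ih).trans (choose_mul_choose_le _ _ _ _)

/-- The weights are submultiplicative, by Vandermonde's identity. -/
lemma multiWeight_add_le (β γ : σ →₀ ℕ) :
    multiWeight (β + γ) ≤ multiWeight β * multiWeight γ := by
  unfold multiWeight
  rw [div_mul_div_comm, div_le_div_iff₀ (by positivity) (by positivity)]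
  have h := prod_choose_le Finset.univ β γ
  have h1 : ∏ i, ((β + γ) i)! = (∏ i, (β i + γ i).choose (β i)) * ((∏ i, (β i)!) * ∏ i, (γ i)!) := by
    rw [← Finset.prod_mul_distrib, ← Finset.prod_mul_distrib]
    refine Finset.prod_congr rfl fun i _ => ?_
    rw [Finsupp.add_apply, ← Nat.add_choose_mul_factorial_mul_factorial, mul_assoc,
      Nat.choose_symm_add]
  have h2 : (∑ i, (β + γ) i)! = (∑ i, β i + ∑ i, γ i).choose (∑ i, β i) *
      ((∑ i, β i)! * (∑ i, γ i)!) := by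
    rw [← mul_assoc, Nat.choose_symm_add, Nat.add_choose_mul_factorial_mul_factorial]
    simp [Finset.sum_add_distrib]
  rw [h1, h2]
  norm_cast
  calc _ = (∏ i, (β i + γ i).choose (β i)) * (((∏ i, (β i)!) * ∏ i, (γ i)!) *
        ((∑ i, β i)! * (∑ i, γ i)!)) := by ring
    _ ≤ _ := Nat.mul_le_mul_right _ h
    _ = _ := by ring

lemma multiWeight_add_single (β : σ →₀ ℕ) (i : σ) :
    multiWeight (β + Finsupp.single i 1) = multiWeight β * (β i + 1) / (∑ j, β j + 1 : ℕ) := by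
  classical
  unfold multiWeight
  have h1 : ∏ j, ((β + Finsupp.single i 1 : σ →₀ ℕ) j)! = (∏ j, (β j)!) * (β i + 1) := by
    rw [← Finset.mul_prod_erase _ _ (Finset.mem_univ i),
      ← Finset.mul_prod_erase _ (fun j => (β j)!) (Finset.mem_univ i)]
    have : ∏ j ∈ Finset.univ.erase i, ((β + Finsupp.single i 1 : σ →₀ ℕ) j)! =
        ∏ j ∈ Finset.univ.erase i, (β j)! := by
      refine Finset.prod_congr rfl fun j hj => ?_
      rw [Finsupp.add_apply, Finsupp.single_eq_of_ne (Finset.ne_of_mem_erase hj), add_zero]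
    rw [this]
    simp [Nat.factorial_succ]
    ring
  have h2 : ∑ j, (β + Finsupp.single i 1 : σ →₀ ℕ) j = ∑ j, β j + 1 := by
    simp [Finset.sum_add_distrib, Finsupp.single_apply]
  rw [h1, h2, Nat.factorial_succ]
  push_cast
  have h' := Nat.factorial_pos (∑ i, β i)
  field_simp

lemma multiWeight_single (i : σ) : multiWeight (Finsupp.single i 1 : σ →₀ ℕ) = 1 := by
  have := multiWeight_add_single (0 : σ →₀ ℕ) i
  simpa [multiWeight_zero] using this

/-- A multinomial coefficient of degree `d` in `N` variables is at most `N ^ d`, so monomials are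
bounded by the weights on the cube of half side `1 / N`. -/
lemma prod_pow_le_multiWeight (β : σ →₀ ℕ) (z : σ → ℝ)
    (hz : ∀ i, |z i| * Fintype.card σ ≤ 1) : ∏ i, |z i| ^ β i ≤ multiWeight β := by
  classical
  set N := Fintype.card σ
  set d := ∑ i, β i with hd
  have h1 : Nat.multinomial Finset.univ β ≤ N ^ d := by
    have := Finset.sum_pow_eq_sum_piAntidiag (Finset.univ : Finset σ) (fun _ => (1 : ℕ)) d
    simp only [Finset.sum_const, Finset.card_univ, smul_eq_mul, mul_one, one_pow,
      Finset.prod_const_one, Nat.cast_id] at this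
    change N ^ d = _ at this
    rw [this]
    exact Finset.single_le_sum (f := fun k : σ → ℕ => Nat.multinomial Finset.univ k)
      (fun _ _ => Nat.zero_le _) (by simp [hd])
  have h2 : multiWeight β = ((Nat.multinomial Finset.univ β : ℕ) : ℝ)⁻¹ := by
    have := Nat.multinomial_spec Finset.univ β
    have h0 : (0 : ℝ) < ((∏ i, (β i)! : ℕ) : ℝ) := by
      exact_mod_cast Finset.prod_pos fun i _ => Nat.factorial_pos _
    rw [multiWeight, ← this, Nat.cast_mul]
    field_simp
  have h3 : 0 < Nat.multinomial Finset.univ β := Nat.multinomial_pos _ _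
  rw [h2, ← one_div, le_div_iff₀ (by exact_mod_cast h3)]
  calc (∏ i, |z i| ^ β i) * (Nat.multinomial Finset.univ β : ℕ)
      ≤ (∏ i, |z i| ^ β i) * (N : ℝ) ^ d := by
        gcongr
        exact_mod_cast h1
    _ = ∏ i, (|z i| * N) ^ β i := by
        rw [hd, ← Finset.prod_pow_eq_pow_sum, ← Finset.prod_mul_distrib]
        simp [mul_pow]
    _ ≤ 1 := Finset.prod_le_one (fun i _ => by positivity)
        fun i _ => pow_le_one₀ (by positivity) (hz i)

open MvPowerSeries in
lemma summable_coeff_mul {f g : MvPowerSeries σ ℝ}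
    (hf : Summable fun β => |coeff β f| * multiWeight β)
    (hg : Summable fun β => |coeff β g| * multiWeight β) :
    (Summable fun β => |coeff β (f * g)| * multiWeight β) ∧
      ∑' β, |coeff β (f * g)| * multiWeight β ≤
        (∑' β, |coeff β f| * multiWeight β) * ∑' β, |coeff β g| * multiWeight β := by
  classical
  have hw : ∀ β : σ →₀ ℕ, 0 ≤ multiWeight β := fun β => (multiWeight_pos β).le
  obtain ⟨a, ha⟩ : ∃ a : (σ →₀ ℕ) → ℝ, a = fun β => |coeff β f| * multiWeight β := ⟨_, rfl⟩
  obtain ⟨b, hb⟩ : ∃ b : (σ →₀ ℕ) → ℝ, b = fun β => |coeff β g| * multiWeight β := ⟨_, rfl⟩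
  have ha0 : 0 ≤ a := fun β => by rw [ha]; exact mul_nonneg (abs_nonneg _) (hw β)
  have hb0 : 0 ≤ b := fun β => by rw [hb]; exact mul_nonneg (abs_nonneg _) (hw β)
  rw [← ha] at hf
  rw [← hb] at hg
  have hp : Summable fun x : (σ →₀ ℕ) × (σ →₀ ℕ) => a x.1 * b x.2 :=
    hf.mul_of_nonneg hg ha0 hb0
  have hs := summable_sum_mul_antidiagonal_of_summable_mul hp
  have hle : ∀ β, |coeff β (f * g)| * multiWeight β ≤
      ∑ x ∈ Finset.HasAntidiagonal.antidiagonal β, a x.1 * b x.2 := by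
    intro β
    rw [coeff_mul]
    refine (mul_le_mul_of_nonneg_right (Finset.abs_sum_le_sum_abs _ _) (hw β)).trans ?_
    rw [Finset.sum_mul]
    refine Finset.sum_le_sum fun x hx => ?_
    rw [abs_mul, ← Finset.HasAntidiagonal.mem_antidiagonal.1 hx, ha, hb]
    calc _ ≤ |coeff x.1 f| * |coeff x.2 g| * (multiWeight x.1 * multiWeight x.2) := by
          gcongr
          exact multiWeight_add_le _ _
      _ = _ := by ring
  have h1 := Summable.of_nonneg_of_le (fun β => mul_nonneg (abs_nonneg _) (hw β)) hle hs
  refine ⟨h1, ?_⟩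
  rw [← ha, ← hb, hf.tsum_mul_tsum_eq_tsum_sum_antidiagonal hg hp]
  exact h1.tsum_le_tsum hle hs

open MvPowerSeries in
/-- The algebra of real power series `∑ a_β z^β` with `∑ |a_β| β! / |β|! < ∞`. -/
def weightedSubalgebra (σ : Type*) [Fintype σ] : Subalgebra ℝ (MvPowerSeries σ ℝ) where
  carrier := {f | Summable fun β => |coeff β f| * multiWeight β}
  mul_mem' hf hg := (summable_coeff_mul hf hg).1
  add_mem' {f g} hf hg := by
    refine Summable.of_nonneg_of_le
      (fun β => mul_nonneg (abs_nonneg _) (multiWeight_pos β).le) (fun β => ?_) (hf.add hg)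
    rw [map_add, ← add_mul]
    exact mul_le_mul_of_nonneg_right (abs_add_le _ _) (multiWeight_pos β).le
  algebraMap_mem' r := by
    classical
    refine summable_of_ne_finset_zero (s := {0}) fun β hβ => ?_
    rw [MvPowerSeries.algebraMap_apply, coeff_C, if_neg (by simpa using hβ)]
    simp

/-- The elements of `weightedSubalgebra`, as a Banach algebra. -/
abbrev WSeries (σ : Type*) [Fintype σ] : Type _ := weightedSubalgebra σ

namespace WSeries

open MvPowerSeries

/-- The coefficient of the monomial `z^β`. -/
def co (β : σ →₀ ℕ) (f : WSeries σ) : ℝ := coeff β f.1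

@[ext] lemma ext {f g : WSeries σ} (h : ∀ β, co β f = co β g) : f = g :=
  Subtype.ext (MvPowerSeries.ext h)

@[simp] lemma co_add (β : σ →₀ ℕ) (f g : WSeries σ) : co β (f + g) = co β f + co β g := by
  simp [co]
@[simp] lemma co_sub (β : σ →₀ ℕ) (f g : WSeries σ) : co β (f - g) = co β f - co β g := by
  simp [co]
@[simp] lemma co_smul (β : σ →₀ ℕ) (r : ℝ) (f : WSeries σ) : co β (r • f) = r * co β f := by
  simp [co]
@[simp] lemma co_zero (β : σ →₀ ℕ) : co β (0 : WSeries σ) = 0 := by simp [co]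
@[simp] lemma co_neg (β : σ →₀ ℕ) (f : WSeries σ) : co β (-f) = -co β f := by simp [co]

lemma summable_co (f : WSeries σ) : Summable fun β => |co β f| * multiWeight β := f.2

/-- The element with given coefficients. -/
def mk (a : (σ →₀ ℕ) → ℝ) (ha : Summable fun β => |a β| * multiWeight β) : WSeries σ :=
  ⟨(a : MvPowerSeries σ ℝ), ha⟩

@[simp] lemma co_mk (a : (σ →₀ ℕ) → ℝ) (ha) (β : σ →₀ ℕ) : co β (mk a ha) = a β := rfl

/-- The weighted `ℓ¹` norm as a ring norm. -/
def ringNorm : RingNorm (WSeries σ) where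
  toFun f := ∑' β, |co β f| * multiWeight β
  map_zero' := by simp
  add_le' f g := by
    rw [← f.summable_co.tsum_add g.summable_co]
    refine (f + g).summable_co.tsum_le_tsum (fun β => ?_) (f.summable_co.add g.summable_co)
    rw [co_add, ← add_mul]
    exact mul_le_mul_of_nonneg_right (abs_add_le _ _) (multiWeight_pos β).le
  neg' f := by simp
  mul_le' f g := (summable_coeff_mul f.2 g.2).2
  eq_zero_of_map_eq_zero' f hf := by
    ext β
    have h := f.summable_co.le_tsum β fun γ _ => mul_nonneg (abs_nonneg _) (multiWeight_pos γ).le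
    rw [hf] at h
    have := multiWeight_pos β
    have h2 : |co β f| ≤ 0 := by
      by_contra! hc
      linarith [mul_pos hc this]
    simpa using h2

instance : NormedCommRing (WSeries σ) :=
  { RingNorm.toNormedRing (ringNorm (σ := σ)) with mul_comm := mul_comm }

lemma norm_eq (f : WSeries σ) : ‖f‖ = ∑' β, |co β f| * multiWeight β := rfl

instance : NormedAlgebra ℝ (WSeries σ) where
  norm_smul_le r f := by
    rw [norm_eq, norm_eq, ← tsum_mul_left, Real.norm_eq_abs]
    simp [abs_mul, mul_assoc]

instance : NormOneClass (WSeries σ) where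
  norm_one := by
    classical
    rw [norm_eq, tsum_eq_single 0]
    · simp [co, multiWeight_zero]
    · intro β hβ
      simp [co, coeff_one, hβ]

/-- Weighting the coefficients identifies the algebra with the space `ℓ¹`. -/
def toLp : WSeries σ ≃ᵢ lp (fun _ : σ →₀ ℕ => ℝ) 1 :=
  IsometryEquiv.mk'
    (fun f => ⟨fun β => co β f * multiWeight β, by
      refine memℓp_gen ?_
      simpa [abs_mul, abs_of_pos (multiWeight_pos _)] using f.summable_co⟩)
    (fun g => mk (fun β => g β / multiWeight β) (by
      have := (memℓp_gen_iff (p := 1) (by simp)).1 g.2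
      simp only [ENNReal.toReal_one, Real.rpow_one, Real.norm_eq_abs] at this
      refine this.congr fun β => ?_
      have := multiWeight_pos β
      rw [abs_div, abs_of_pos this]
      field_simp))
    (fun g => by
      ext β
      have := multiWeight_pos β
      simp only [co_mk]
      field_simp)
    (by
      refine Isometry.of_dist_eq fun f g => ?_
      have h := norm_eq (f - g)
      rw [dist_eq_norm, dist_eq_norm, lp.norm_eq_tsum_rpow (by simp), h]
      simp only [ENNReal.toReal_one, Real.rpow_one, div_one]
      refine tsum_congr fun β => ?_
      change |co β f * multiWeight β - co β g * multiWeight β| = _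
      rw [← sub_mul, abs_mul, abs_of_pos (multiWeight_pos β), co_sub])

instance : CompleteSpace (WSeries σ) := toLp.completeSpace_iff.2 inferInstance

end WSeries
end WeightedSeries

namespace WSeries

variable {σ : Type*} [Fintype σ]

/-! ### Evaluation -/

/-- The value of a series at the point `z`. -/
def ev (z : σ → ℝ) (f : WSeries σ) : ℝ := ∑' β, co β f * ∏ i, z i ^ β i

lemma abs_term_le {z : σ → ℝ} (hz : ∀ i, |z i| * Fintype.card σ ≤ 1) (f : WSeries σ)
    (β : σ →₀ ℕ) : |co β f * ∏ i, z i ^ β i| ≤ |co β f| * multiWeight β := by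
  rw [abs_mul, Finset.abs_prod]
  simp only [abs_pow]
  exact mul_le_mul_of_nonneg_left (prod_pow_le_multiWeight β z hz) (abs_nonneg _)

lemma summable_abs_term {z : σ → ℝ} (hz : ∀ i, |z i| * Fintype.card σ ≤ 1) (f : WSeries σ) :
    Summable fun β => |co β f * ∏ i, z i ^ β i| :=
  f.summable_co.of_nonneg_of_le (fun _ => abs_nonneg _) (abs_term_le hz f)

lemma summable_term {z : σ → ℝ} (hz : ∀ i, |z i| * Fintype.card σ ≤ 1) (f : WSeries σ) :
    Summable fun β => co β f * ∏ i, z i ^ β i :=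
  (summable_abs_term hz f).of_abs

lemma abs_ev_le {z : σ → ℝ} (hz : ∀ i, |z i| * Fintype.card σ ≤ 1) (f : WSeries σ) :
    |ev z f| ≤ ‖f‖ := by
  obtain ⟨a, ha⟩ : ∃ a : (σ →₀ ℕ) → ℝ, a = fun β => co β f * ∏ i, z i ^ β i := ⟨_, rfl⟩
  have hs : Summable fun β => ‖a β‖ := by rw [ha]; exact summable_abs_term hz f
  have hle : ∀ β, ‖a β‖ ≤ |co β f| * multiWeight β := by rw [ha]; exact abs_term_le hz f
  rw [norm_eq, ev, ← ha, ← Real.norm_eq_abs]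
  exact (norm_tsum_le_tsum_norm hs).trans (hs.tsum_le_tsum hle f.summable_co)

lemma ev_mul {z : σ → ℝ} (hz : ∀ i, |z i| * Fintype.card σ ≤ 1) (f g : WSeries σ) :
    ev z (f * g) = ev z f * ev z g := by
  classical
  obtain ⟨a, ha⟩ : ∃ a : (σ →₀ ℕ) → ℝ, a = fun β => co β f * ∏ i, z i ^ β i := ⟨_, rfl⟩
  obtain ⟨b, hb⟩ : ∃ b : (σ →₀ ℕ) → ℝ, b = fun β => co β g * ∏ i, z i ^ β i := ⟨_, rfl⟩
  have hsa : Summable fun β => ‖a β‖ := by rw [ha]; exact summable_abs_term hz f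
  have hsb : Summable fun β => ‖b β‖ := by rw [hb]; exact summable_abs_term hz g
  unfold ev
  rw [← ha, ← hb, hsa.of_norm.tsum_mul_tsum_eq_tsum_sum_antidiagonal hsb.of_norm
    (summable_mul_of_summable_norm hsa hsb)]
  refine tsum_congr fun β => ?_
  have : co β (f * g) = ∑ x ∈ Finset.HasAntidiagonal.antidiagonal β, co x.1 f * co x.2 g :=
    MvPowerSeries.coeff_mul _ _ _
  rw [this, Finset.sum_mul]
  refine Finset.sum_congr rfl fun x hx => ?_
  rw [← Finset.HasAntidiagonal.mem_antidiagonal.1 hx, ha, hb]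
  simp only [Finsupp.add_apply, pow_add, Finset.prod_mul_distrib]
  ring

/-- Evaluation at a point of a small cube, as an algebra homomorphism. -/
def evHom (z : σ → ℝ) (hz : ∀ i, |z i| * Fintype.card σ ≤ 1) : WSeries σ →ₐ[ℝ] ℝ :=
  AlgHom.ofLinearMap
    { toFun := ev z
      map_add' := fun f g => by
        unfold ev
        rw [← (summable_term hz f).tsum_add (summable_term hz g)]
        simp [add_mul]
      map_smul' := fun r f => by
        simp [ev, ← tsum_mul_left, mul_assoc] }
    (by
      classical
      change ev z 1 = 1
      rw [ev, tsum_eq_single 0]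
      · simp [co]
      · intro β hβ
        simp [co, MvPowerSeries.coeff_one, hβ])
    (ev_mul hz)

@[simp] lemma evHom_apply (z : σ → ℝ) (hz : ∀ i, |z i| * Fintype.card σ ≤ 1) (f : WSeries σ) :
    evHom z hz f = ev z f := rfl

lemma continuous_evHom (z : σ → ℝ) (hz : ∀ i, |z i| * Fintype.card σ ≤ 1) :
    Continuous (evHom z hz) :=
  AddMonoidHomClass.continuous_of_bound (evHom z hz) 1 fun f => by
    simpa using abs_ev_le hz f

/-- The coordinate functions. -/
def coord (i : σ) : WSeries σ :=
  ⟨MvPowerSeries.X i, by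
    classical
    refine summable_of_ne_finset_zero (s := {Finsupp.single i 1}) fun β hβ => ?_
    rw [MvPowerSeries.coeff_X, if_neg (by simpa using hβ)]
    simp⟩

lemma co_coord [DecidableEq σ] (i : σ) (β : σ →₀ ℕ) :
    co β (coord i) = if β = Finsupp.single i 1 then 1 else 0 := by
  classical
  simp [co, coord, MvPowerSeries.coeff_X]

lemma norm_coord (i : σ) : ‖(coord i : WSeries σ)‖ = 1 := by
  classical
  rw [norm_eq, tsum_eq_single (Finsupp.single i 1)]
  · simp [co_coord, multiWeight_single]
  · intro β hβ
    simp [co_coord, hβ]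

lemma ev_coord (z : σ → ℝ) (i : σ) : ev z (coord i) = z i := by
  classical
  rw [ev, tsum_eq_single (Finsupp.single i 1)]
  · simp only [co_coord, if_true, one_mul]
    rw [Finset.prod_eq_single i]
    · simp
    · intro j _ hj
      simp [Finsupp.single_eq_of_ne hj]
    · simp
  · intro β hβ
    simp [co_coord, hβ]

/-! ### Primitives and derivatives -/

omit [Fintype σ] in
lemma injective_add_single (i : σ) :
    Function.Injective fun β : σ →₀ ℕ => β + Finsupp.single i 1 :=
  add_left_injective _

omit [Fintype σ] in
lemma exists_add_single {i : σ} {β : σ →₀ ℕ} (h : β i ≠ 0) :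
    ∃ γ : σ →₀ ℕ, γ + Finsupp.single i 1 = β :=
  ⟨β - Finsupp.single i 1, tsub_add_cancel_of_le
    (Finsupp.single_le_iff.2 (Nat.one_le_iff_ne_zero.2 h))⟩

omit [Fintype σ] in
lemma summable_and_tsum_shift {a : (σ →₀ ℕ) → ℝ} {i : σ} (h0 : ∀ β, β i = 0 → a β = 0) :
    (Summable (fun β => a (β + Finsupp.single i 1)) ↔ Summable a) ∧
      ∑' β, a (β + Finsupp.single i 1) = ∑' β, a β := by
  refine ⟨(injective_add_single i).summable_iff fun β hβ => h0 β ?_,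
    (injective_add_single i).tsum_eq fun β hβ => ?_⟩
  · by_contra hc
    exact hβ (exists_add_single hc)
  · exact exists_add_single fun hc => hβ (h0 β hc)

lemma primitive_term (τ : σ) (a : (σ →₀ ℕ) → ℝ) (β : σ →₀ ℕ) :
    |a β / ((β τ : ℝ) + 1)| * multiWeight (β + Finsupp.single τ 1) ≤ |a β| * multiWeight β := by
  have hw := multiWeight_pos β
  rw [multiWeight_add_single, abs_div, abs_of_pos (by positivity : (0 : ℝ) < β τ + 1)]
  have : |a β| / ((β τ : ℝ) + 1) * (multiWeight β * ((β τ : ℝ) + 1) / (∑ j, β j + 1 : ℕ)) =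
      |a β| * multiWeight β / (∑ j, β j + 1 : ℕ) := by
    field_simp
  rw [this]
  exact div_le_self (by positivity) (by exact_mod_cast Nat.le_add_left 1 _)

lemma primitive_aux (τ : σ) (f : WSeries σ) :
    (Summable fun β : σ →₀ ℕ => |if β τ = 0 then 0 else
      co (β - Finsupp.single τ 1) f / (β τ : ℝ)| * multiWeight β) ∧
    ∑' β : σ →₀ ℕ, |if β τ = 0 then 0 else
      co (β - Finsupp.single τ 1) f / (β τ : ℝ)| * multiWeight β ≤ ‖f‖ := by
  have h := summable_and_tsum_shift (i := τ) (a := fun β : σ →₀ ℕ => |if β τ = 0 then 0 else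
      co (β - Finsupp.single τ 1) f / (β τ : ℝ)| * multiWeight β) (fun β hβ => by simp [hβ])
  have h1 : ∀ β : σ →₀ ℕ, |if (β + Finsupp.single τ 1 : σ →₀ ℕ) τ = 0 then 0 else
      co (β + Finsupp.single τ 1 - Finsupp.single τ 1) f / ((β + Finsupp.single τ 1 : σ →₀ ℕ) τ : ℝ)| *
        multiWeight (β + Finsupp.single τ 1) ≤ |co β f| * multiWeight β := by
    intro β
    simpa using primitive_term τ (fun β => co β f) β
  have h2 := f.summable_co.of_nonneg_of_le
    (fun β => mul_nonneg (abs_nonneg _) (multiWeight_pos _).le) h1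
  refine ⟨h.1.1 h2, ?_⟩
  rw [← h.2, norm_eq]
  exact h2.tsum_le_tsum h1 f.summable_co

/-- The primitive in the variable `τ` that vanishes for `z τ = 0`. -/
def primitive (τ : σ) : WSeries σ →L[ℝ] WSeries σ :=
  LinearMap.mkContinuous
    { toFun := fun f => mk _ (primitive_aux τ f).1
      map_add' := fun f g => by
        ext β
        simp only [co_mk, co_add]
        split_ifs <;> ring
      map_smul' := fun r f => by
        ext β
        simp only [co_mk, co_smul, RingHom.id_apply]
        split_ifs <;> ring }
    1 (fun f => by rw [one_mul]; exact (primitive_aux τ f).2)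

lemma co_primitive (τ : σ) (f : WSeries σ) (β : σ →₀ ℕ) : co β (primitive τ f) =
    if β τ = 0 then 0 else co (β - Finsupp.single τ 1) f / (β τ : ℝ) := rfl

lemma co_primitive_add (τ : σ) (f : WSeries σ) (β : σ →₀ ℕ) :
    co (β + Finsupp.single τ 1) (primitive τ f) = co β f / (β τ + 1) := by
  simp [co_primitive]

lemma norm_primitive_le (τ : σ) (f : WSeries σ) : ‖primitive τ f‖ ≤ ‖f‖ :=
  (primitive_aux τ f).2

lemma derivPrimitive_aux {τ i : σ} (hi : i ≠ τ) (f : WSeries σ) :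
    (Summable fun β : σ →₀ ℕ =>
      |((β i : ℝ) + 1) * co (β + Finsupp.single i 1) (primitive τ f)| * multiWeight β) ∧
    ∑' β : σ →₀ ℕ, |((β i : ℝ) + 1) * co (β + Finsupp.single i 1) (primitive τ f)| *
      multiWeight β ≤ ‖f‖ := by
  have h := summable_and_tsum_shift (i := τ) (a := fun β : σ →₀ ℕ =>
      |((β i : ℝ) + 1) * co (β + Finsupp.single i 1) (primitive τ f)| * multiWeight β)
      (fun β hβ => by simp [co_primitive, hβ, Finsupp.single_eq_of_ne hi.symm])
  have h1 : ∀ β : σ →₀ ℕ, |(((β + Finsupp.single τ 1 : σ →₀ ℕ) i : ℕ) + 1 : ℝ) *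
      co (β + Finsupp.single τ 1 + Finsupp.single i 1) (primitive τ f)| *
        multiWeight (β + Finsupp.single τ 1) =
      |co (β + Finsupp.single i 1) f| * multiWeight (β + Finsupp.single i 1) := by
    intro β
    have hw := multiWeight_pos β
    rw [add_right_comm, co_primitive_add, multiWeight_add_single, multiWeight_add_single,
      abs_mul, abs_div]
    simp only [Finsupp.add_apply, Finsupp.single_eq_of_ne hi, Finsupp.single_eq_of_ne hi.symm,
      add_zero]
    rw [abs_of_pos (by positivity : (0 : ℝ) < β τ + 1),
      abs_of_pos (by positivity : (0 : ℝ) < β i + 1)]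
    field_simp
  have h2 : Summable fun β : σ →₀ ℕ =>
      |co (β + Finsupp.single i 1) f| * multiWeight (β + Finsupp.single i 1) :=
    f.summable_co.comp_injective (injective_add_single i)
  refine ⟨h.1.1 (h2.congr fun β => (h1 β).symm), ?_⟩
  rw [← h.2, norm_eq, tsum_congr h1]
  exact tsum_comp_le_tsum_of_inj f.summable_co
    (fun β => mul_nonneg (abs_nonneg _) (multiWeight_pos _).le) (injective_add_single i)

/-- The derivative in the variable `i ≠ τ` of the primitive in the variable `τ`. It does not
increase the norm: this is what the weights are made for. -/
def derivPrimitive (τ i : σ) (hi : i ≠ τ) : WSeries σ →L[ℝ] WSeries σ :=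
  LinearMap.mkContinuous
    { toFun := fun f => mk _ (derivPrimitive_aux hi f).1
      map_add' := fun f g => by
        ext β
        simp only [co_mk, co_add, map_add]
        ring
      map_smul' := fun r f => by
        ext β
        simp only [co_mk, co_smul, RingHom.id_apply, map_smul]
        ring }
    1 (fun f => by rw [one_mul]; exact (derivPrimitive_aux hi f).2)

lemma co_derivPrimitive {τ i : σ} (hi : i ≠ τ) (f : WSeries σ) (β : σ →₀ ℕ) :
    co β (derivPrimitive τ i hi f) =
      ((β i : ℝ) + 1) * co (β + Finsupp.single i 1) (primitive τ f) := rfl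

lemma norm_derivPrimitive_le {τ i : σ} (hi : i ≠ τ) (f : WSeries σ) :
    ‖derivPrimitive τ i hi f‖ ≤ ‖f‖ :=
  (derivPrimitive_aux hi f).2

/-- Term by term differentiation. -/
lemma hasDerivAt_ev [DecidableEq σ] {f g : WSeries σ} {i : σ}
    (hg : ∀ β : σ →₀ ℕ, co β g = ((β i : ℝ) + 1) * co (β + Finsupp.single i 1) f)
    {z : σ → ℝ} (hz : ∀ j, |z j| * Fintype.card σ < 1) :
    HasDerivAt (fun s => ev (Function.update z i s) f) (ev z g) (z i) := by
  have hN : (0 : ℝ) < Fintype.card σ := by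
    exact_mod_cast Fintype.card_pos_iff.2 ⟨i⟩
  set N : ℝ := (Fintype.card σ : ℝ)
  have hprod : ∀ (s : ℝ) (β : σ →₀ ℕ), ∏ j, (Function.update z i s) j ^ β j =
      s ^ β i * ∏ j ∈ Finset.univ.erase i, z j ^ β j := by
    intro s β
    rw [← Finset.mul_prod_erase _ _ (Finset.mem_univ i), Function.update_self]
    congr 1
    refine Finset.prod_congr rfl fun j hj => ?_
    rw [Function.update_of_ne (Finset.ne_of_mem_erase hj)]
  set P : (σ →₀ ℕ) → ℝ := fun β => ∏ j ∈ Finset.univ.erase i, z j ^ β j with hP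
  have hPs : ∀ β, P (β + Finsupp.single i 1) = P β := by
    intro β
    refine Finset.prod_congr rfl fun j hj => ?_
    rw [Finsupp.add_apply, Finsupp.single_eq_of_ne (Finset.ne_of_mem_erase hj), add_zero]
  -- the series can be differentiated along the segment in which the cube meets the `i`-th line
  have hcube : ∀ s ∈ Ioo (-(1 / N)) (1 / N), ∀ j, |Function.update z i s j| * N ≤ 1 := by
    intro s hs j
    by_cases hj : j = i
    · subst hj
      rw [Function.update_self]
      have := abs_lt.2 hs
      rw [lt_div_iff₀ hN] at this
      exact this.le
    · rw [Function.update_of_ne hj]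
      exact (hz j).le
  have hzi : z i ∈ Ioo (-(1 / N)) (1 / N) := by
    rw [mem_Ioo, ← abs_lt, lt_div_iff₀ hN]
    exact hz i
  have hterm : ∀ (β : σ →₀ ℕ) (s : ℝ),
      co (β + Finsupp.single i 1) f * (((β + Finsupp.single i 1 : σ →₀ ℕ) i : ℕ) *
        s ^ ((β + Finsupp.single i 1 : σ →₀ ℕ) i - 1)) * P (β + Finsupp.single i 1) =
        co β g * ∏ j, (Function.update z i s) j ^ β j := by
    intro β s
    rw [hprod, hPs, hg]
    simp
    ring
  let u : (σ →₀ ℕ) → ℝ := fun β => if β i = 0 then 0 else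
    |co (β - Finsupp.single i 1) g| * multiWeight (β - Finsupp.single i 1)
  have hu : Summable u := by
    refine (summable_and_tsum_shift (i := i) fun β hβ => by simp [u, hβ]).1.1 ?_
    simpa [u] using g.summable_co
  have key := hasDerivAt_tsum_of_isPreconnected (u := u) (t := Ioo (-(1 / N)) (1 / N))
    (g := fun β s => co β f * s ^ β i * P β)
    (g' := fun β s => co β f * (β i * s ^ (β i - 1)) * P β) (y₀ := z i) (y := z i)
    hu isOpen_Ioo isPreconnected_Ioo
    (fun β s _ => by
      simpa using ((hasDerivAt_pow (β i) s).const_mul (co β f)).mul_const (P β))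
    (fun β s hs => by
      by_cases hβ : β i = 0
      · simp [u, hβ]
      · obtain ⟨γ, rfl⟩ := exists_add_single hβ
        rw [hterm γ s]
        have := abs_term_le (hcube s hs) g γ
        simpa [u, Finset.abs_prod] using this)
    hzi
    (by
      have := summable_term (z := z) (fun j => (hz j).le) f
      refine this.congr fun β => ?_
      have h1 := hprod (z i) β
      rw [Function.update_eq_self] at h1
      rw [h1]
      ring)
    hzi
  have e1 : (fun s => ev (Function.update z i s) f) =
      fun s => ∑' β, co β f * s ^ β i * P β := by
    funext s
    refine tsum_congr fun β => ?_
    rw [hprod, mul_assoc]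
  have e2 : ev z g = ∑' β, co β f * (β i * z i ^ (β i - 1)) * P β := by
    rw [← (summable_and_tsum_shift (i := i) (a := fun β : σ →₀ ℕ =>
      co β f * (β i * z i ^ (β i - 1)) * P β) fun β hβ => by simp [hβ]).2]
    refine tsum_congr fun β => ?_
    rw [hterm β (z i), Function.update_eq_self]
  rw [e1, e2]
  exact key

lemma ev_primitive_of_eq_zero {τ : σ} {z : σ → ℝ} (hz : z τ = 0) (f : WSeries σ) :
    ev z (primitive τ f) = 0 := by
  rw [ev]
  refine (tsum_congr fun β => ?_).trans tsum_zero
  rw [co_primitive]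
  split_ifs with h
  · simp
  · rw [Finset.prod_eq_zero (Finset.mem_univ τ) (by rw [hz, zero_pow h]), mul_zero]

/-! ### Analyticity of the sum -/

/-- A monomial of degree `k` is the product of `k` coordinates. -/
lemma exists_word (k : ℕ) : ∀ β : σ →₀ ℕ, ∑ i, β i = k →
    ∃ j : Fin k → σ, ∀ z : σ → ℝ, ∏ l, z (j l) = ∏ i, z i ^ β i := by
  classical
  induction k with
  | zero =>
    intro β hβ
    refine ⟨Fin.elim0, fun z => ?_⟩
    have : ∀ i, β i = 0 := fun i => by
      simpa using (Finset.sum_eq_zero_iff.1 hβ) i (Finset.mem_univ i)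
    simp [this]
  | succ k ih =>
    intro β hβ
    obtain ⟨i, -, hi⟩ : ∃ i ∈ Finset.univ, β i ≠ 0 := by
      by_contra! h
      rw [Finset.sum_eq_zero h] at hβ
      omega
    obtain ⟨γ, rfl⟩ := exists_add_single hi
    have hγ : ∑ i, γ i = k := by
      simpa [Finset.sum_add_distrib, Finsupp.single_apply] using hβ
    obtain ⟨j, hj⟩ := ih γ hγ
    refine ⟨Fin.cons i j, fun z => ?_⟩
    rw [Fin.prod_univ_succ]
    simp only [Fin.cons_zero, Fin.cons_succ, hj, Finsupp.add_apply, pow_add,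
      Finset.prod_mul_distrib]
    rw [mul_comm]
    congr 1
    rw [Finset.prod_eq_single i]
    · simp
    · intro l _ hl
      simp [Finsupp.single_eq_of_ne hl]
    · simp

/-- A multilinear map whose diagonal is the monomial `z^β`, for `β` of degree `k`. -/
def monomialMap (k : ℕ) (β : σ →₀ ℕ) : (σ → ℝ) [×k]→L[ℝ] ℝ :=
  if h : ∑ i, β i = k then
    (ContinuousMultilinearMap.mkPiAlgebra ℝ (Fin k) ℝ).compContinuousLinearMap
      fun l => ContinuousLinearMap.proj ((exists_word k β h).choose l)
  else 0

lemma monomialMap_diag {k : ℕ} {β : σ →₀ ℕ} (h : ∑ i, β i = k) (z : σ → ℝ) :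
    monomialMap k β (fun _ => z) = ∏ i, z i ^ β i := by
  rw [monomialMap, dif_pos h, ← (exists_word k β h).choose_spec z]
  simp

lemma norm_monomialMap_le (k : ℕ) (β : σ →₀ ℕ) : ‖monomialMap k β‖ ≤ 1 := by
  refine ContinuousMultilinearMap.opNorm_le_bound zero_le_one fun m => ?_
  rw [one_mul]
  unfold monomialMap
  split_ifs with h
  · simp only [ContinuousMultilinearMap.compContinuousLinearMap_apply,
      ContinuousMultilinearMap.mkPiAlgebra_apply, ContinuousLinearMap.proj_apply, norm_prod]
    exact Finset.prod_le_prod (fun _ _ => norm_nonneg _) fun l _ => norm_le_pi_norm _ _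
  · simpa using Finset.prod_nonneg fun l _ => norm_nonneg (m l)

lemma analyticAt_ev [Nonempty σ] (f : WSeries σ) : AnalyticAt ℝ (fun z => ev z f) 0 := by
  classical
  have hN : (0 : ℝ) < Fintype.card σ := by exact_mod_cast Fintype.card_pos
  set N : ℝ := (Fintype.card σ : ℝ) with hNdef
  let S : ℕ → Finset (σ →₀ ℕ) := fun k => Finset.finsuppAntidiag Finset.univ k
  have hS : ∀ k β, β ∈ S k ↔ ∑ i, β i = k := by
    intro k β
    simp [S, Finset.mem_finsuppAntidiag]
  let q : FormalMultilinearSeries ℝ (σ → ℝ) ℝ := fun k => ∑ β ∈ S k, co β f • monomialMap k β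
  let r : NNReal := ⟨1 / N, by positivity⟩
  have hr : 0 < r := by
    change (0 : ℝ) < 1 / N
    positivity
  have hbound : ∀ k, ‖q k‖ * (r : ℝ) ^ k ≤ ‖f‖ := by
    intro k
    calc ‖q k‖ * (r : ℝ) ^ k ≤ (∑ β ∈ S k, |co β f|) * (r : ℝ) ^ k := by
          gcongr
          refine (norm_sum_le _ _).trans (Finset.sum_le_sum fun β _ => ?_)
          rw [norm_smul]
          exact mul_le_of_le_one_right (norm_nonneg _) (norm_monomialMap_le _ _)
      _ ≤ ∑ β ∈ S k, |co β f| * multiWeight β := by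
          rw [Finset.sum_mul]
          refine Finset.sum_le_sum fun β hβ => ?_
          refine mul_le_mul_of_nonneg_left ?_ (abs_nonneg _)
          have := prod_pow_le_multiWeight β (fun _ => 1 / N) (fun i => by
            rw [abs_of_pos (by positivity), ← hNdef]
            field_simp
            rfl)
          rw [Finset.prod_pow_eq_pow_sum, (hS k β).1 hβ, abs_of_pos (by positivity)] at this
          exact this
      _ ≤ ‖f‖ := f.summable_co.sum_le_tsum _
          fun β _ => mul_nonneg (abs_nonneg _) (multiWeight_pos β).le
  refine ⟨q, r, q.le_radius_of_bound _ hbound, by exact_mod_cast hr, fun {y} hy => ?_⟩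
  have hy' : ∀ i, |y i| * N ≤ 1 := by
    intro i
    have h1 : ‖y‖ < (r : ℝ) := by simpa using hy
    change ‖y‖ < 1 / N at h1
    have h2 := (norm_le_pi_norm y i).trans_lt h1
    rw [lt_div_iff₀ hN] at h2
    exact h2.le
  have h1 : HasSum (fun β => co β f * ∏ i, y i ^ β i) (ev y f) := (summable_term hy' f).hasSum
  have h2 := ((Equiv.sigmaFiberEquiv fun β : σ →₀ ℕ => ∑ i, β i).hasSum_iff).2 h1
  rw [zero_add]
  refine h2.sigma fun k => ?_
  have e : q k (fun _ => y) = ∑ β ∈ S k, co β f * ∏ i, y i ^ β i := by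
    simp only [q, _root_.sum_apply, _root_.smul_apply,
      smul_eq_mul]
    exact Finset.sum_congr rfl fun β hβ => by rw [monomialMap_diag ((hS k β).1 hβ)]
  rw [e]
  have : Fintype {β : σ →₀ ℕ // ∑ i, β i = k} := Fintype.subtype (S k) (hS k)
  rw [Finset.sum_subtype (S k) (hS k)]
  exact hasSum_fintype _

end WSeries

namespace WSeries

variable {σ κ : Type*} [Fintype σ] [Fintype κ]

/-! ### Analytic functional calculus -/

open Classical in
/-- The extension of scalars of a power series on `ℝ^κ` to the algebra `WSeries σ`. -/
def extend (p : FormalMultilinearSeries ℝ (κ → ℝ) ℝ) :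
    FormalMultilinearSeries ℝ (κ → WSeries σ) (WSeries σ) := fun k =>
  ∑ j : Fin k → κ, p k (fun l => Pi.single (j l) 1) •
    (ContinuousMultilinearMap.mkPiAlgebra ℝ (Fin k) (WSeries σ)).compContinuousLinearMap
      fun l => ContinuousLinearMap.proj (j l)

lemma norm_extend_le (p : FormalMultilinearSeries ℝ (κ → ℝ) ℝ) (k : ℕ) :
    ‖(extend p k : (κ → WSeries σ) [×k]→L[ℝ] WSeries σ)‖ ≤ (Fintype.card κ : ℝ) ^ k * ‖p k‖ := by
  classical
  unfold extend
  refine (norm_sum_le _ _).trans ?_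
  have : ∀ j : Fin k → κ, ‖p k (fun l => Pi.single (j l) 1) •
      (ContinuousMultilinearMap.mkPiAlgebra ℝ (Fin k) (WSeries σ)).compContinuousLinearMap
      (fun l => (ContinuousLinearMap.proj (j l) : (κ → WSeries σ) →L[ℝ] WSeries σ))‖ ≤
        ‖p k‖ := by
    intro j
    rw [norm_smul]
    refine (mul_le_of_le_one_right (norm_nonneg _) ?_).trans ?_
    · refine ContinuousMultilinearMap.opNorm_le_bound zero_le_one fun m => ?_
      rw [one_mul]
      rw [ContinuousMultilinearMap.compContinuousLinearMap_apply]
      refine (ContinuousMultilinearMap.le_opNorm _ _).trans ?_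
      rw [ContinuousMultilinearMap.norm_mkPiAlgebra, one_mul]
      exact Finset.prod_le_prod (fun _ _ => norm_nonneg _) fun l _ => norm_le_pi_norm (m l) (j l)
    · refine (ContinuousMultilinearMap.le_opNorm _ _).trans ?_
      refine mul_le_of_le_one_right (norm_nonneg _)
        (Finset.prod_le_one (fun _ _ => norm_nonneg _) fun l _ => ?_)
      rw [Pi.norm_single]
      simp
  refine (Finset.sum_le_sum fun j _ => this j).trans ?_
  simp

lemma ev_extend {z : σ → ℝ} (hz : ∀ i, |z i| * Fintype.card σ ≤ 1)
    (p : FormalMultilinearSeries ℝ (κ → ℝ) ℝ) (k : ℕ) (ζ : κ → WSeries σ) :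
    ev z (extend p k fun _ => ζ) = p k fun _ i => ev z (ζ i) := by
  classical
  have h1 : (fun _ : Fin k => fun i => ev z (ζ i)) =
      fun _ => ∑ i, ev z (ζ i) • (Pi.single i 1 : κ → ℝ) := by
    funext l
    exact pi_eq_sum_univ' _
  rw [h1, ContinuousMultilinearMap.map_sum, ← evHom_apply z hz, extend, _root_.sum_apply, map_sum]
  refine Finset.sum_congr rfl fun j _ => ?_
  rw [ContinuousMultilinearMap.map_smul_univ]
  simp [mul_comm]

lemma radius_extend_pos {p : FormalMultilinearSeries ℝ (κ → ℝ) ℝ} (hp : 0 < p.radius) :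
    0 < (extend p : FormalMultilinearSeries ℝ (κ → WSeries σ) (WSeries σ)).radius := by
  obtain ⟨r, hr0, hr⟩ := ENNReal.lt_iff_exists_nnreal_btwn.1 hp
  have hr0' : 0 < r := by exact_mod_cast hr0
  obtain ⟨C, hC, h⟩ := p.norm_mul_pow_le_of_lt_radius hr
  set N : NNReal := Fintype.card κ + 1
  have hN : 0 < N := by positivity
  have : ((r / N : NNReal) : ENNReal) ≤
      (extend p : FormalMultilinearSeries ℝ (κ → WSeries σ) (WSeries σ)).radius := by
    refine FormalMultilinearSeries.le_radius_of_bound _ C fun k => ?_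
    refine le_trans ?_ (h k)
    have h1 : (Fintype.card κ : ℝ) ≤ N := by simp [N]
    have hN' : (0 : ℝ) < N := hN
    calc _ ≤ ((N : ℝ) ^ k * ‖p k‖) * ((r / N : NNReal) : ℝ) ^ k := by
          gcongr
          refine (norm_extend_le p k).trans ?_
          gcongr
      _ = ‖p k‖ * (r : ℝ) ^ k := by
          rw [NNReal.coe_div, div_pow]
          field_simp
  exact lt_of_lt_of_le (by exact_mod_cast div_pos hr0' hN) this

/-- An analytic function acts on small elements of the algebra, compatibly with evaluations. -/
lemma exists_extension {g : (κ → ℝ) → ℝ} (hg : AnalyticAt ℝ g 0) :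
    ∃ N : (κ → WSeries σ) → WSeries σ, AnalyticAt ℝ N 0 ∧
      ∃ δ > 0, ∀ ζ : κ → WSeries σ, ‖ζ‖ < δ → ∀ z : σ → ℝ, (∀ i, |z i| * Fintype.card σ ≤ 1) →
        ev z (N ζ) = g fun i => ev z (ζ i) := by
  obtain ⟨p, r, hp⟩ := hg
  have hpos : 0 < p.radius := hp.r_pos.trans_le hp.r_le
  set q : FormalMultilinearSeries ℝ (κ → WSeries σ) (WSeries σ) := extend p
  have hq : 0 < q.radius := radius_extend_pos hpos
  have hsum := q.hasFPowerSeriesOnBall hq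
  refine ⟨q.sum, hsum.analyticAt, ?_⟩
  obtain ⟨δ, hδ0, hδ⟩ := ENNReal.lt_iff_exists_nnreal_btwn.1 (lt_min hq hp.r_pos)
  refine ⟨δ, by exact_mod_cast hδ0, fun ζ hζ z hz => ?_⟩
  have hζ' : (‖ζ‖₊ : ENNReal) < min q.radius r := lt_trans (by exact_mod_cast hζ) hδ
  have h1 := hsum.hasSum (y := ζ) (by
    simpa [Metric.mem_eball, edist_zero_right, enorm] using hζ'.trans_le (min_le_left _ _))
  rw [zero_add] at h1
  have h2 := h1.map (evHom z hz) (continuous_evHom z hz)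
  have h3 := hp.hasSum (y := fun i => ev z (ζ i)) (by
    have : ‖fun i => ev z (ζ i)‖ ≤ ‖ζ‖ := by
      refine (pi_norm_le_iff_of_nonneg (norm_nonneg _)).2 fun i => ?_
      exact (abs_ev_le hz (ζ i)).trans (norm_le_pi_norm ζ i)
    have h4 : ‖fun i => ev z (ζ i)‖₊ ≤ ‖ζ‖₊ := this
    simpa [Metric.mem_eball, edist_zero_right, enorm] using
      lt_of_le_of_lt (ENNReal.coe_le_coe.2 h4) (hζ'.trans_le (min_le_right _ _)))
  rw [zero_add] at h3
  have e : (evHom z hz ∘ fun k => q k fun _ => ζ) = fun k => p k fun _ i => ev z (ζ i) :=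
    funext fun k => ev_extend hz p k ζ
  rw [e] at h2
  exact h2.unique h3

end WSeries

/-! ### The local existence theorem in coordinates -/

section LocalExistence

open WSeries

variable {ι ν : Type*} [Fintype ι] [Fintype ν]

/-- The arguments of the right-hand side, as elements of the Banach algebra: the (rescaled)
coordinates, the unknown functions, and their (rescaled) partial derivatives, when the unknown
functions have the time derivative `W` and vanish for `t = 0`. -/
def jetArg (r : ℝ) (W : ν → WSeries (Option ι)) : ι ⊕ (ν ⊕ ι × ν) → WSeries (Option ι) :=
  Sum.elim (fun i => r • coord (some i)) (Sum.elim (fun b => primitive none (W b))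
    fun p => r⁻¹ • derivPrimitive none (some p.1) (Option.some_ne_none _) (W p.2))

lemma norm_jetArg_le {r δ : ℝ} (hr0 : 0 < r) (hr1 : r ≤ 1) (hrδ : r ≤ δ)
    {W : ν → WSeries (Option ι)} (hW : ‖W‖ ≤ r * δ) : ‖jetArg r W‖ ≤ δ := by
  have hδ : 0 < δ := hr0.trans_le hrδ
  have hWb : ∀ b, ‖W b‖ ≤ r * δ := fun b => (norm_le_pi_norm W b).trans hW
  refine (pi_norm_le_iff_of_nonneg hδ.le).2 ?_
  rintro (i | b | p)
  · change ‖r • (coord (some i) : WSeries (Option ι))‖ ≤ δ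
    rw [norm_smul, norm_coord, mul_one, Real.norm_of_nonneg hr0.le]
    exact hrδ
  · refine (norm_primitive_le _ _).trans ((hWb b).trans ?_)
    exact mul_le_of_le_one_left hδ.le hr1
  · change ‖r⁻¹ • derivPrimitive none (some p.1) _ (W p.2)‖ ≤ δ
    rw [norm_smul, norm_inv, Real.norm_of_nonneg hr0.le, inv_mul_le_iff₀ hr0]
    exact (norm_derivPrimitive_le _ _).trans (hWb _)

lemma norm_jetArg_sub_le {r : ℝ} (hr0 : 0 < r) (hr1 : r ≤ 1)
    (W W' : ν → WSeries (Option ι)) : ‖jetArg r W - jetArg r W'‖ ≤ r⁻¹ * ‖W - W'‖ := by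
  have h1 : 1 ≤ r⁻¹ := (one_le_inv₀ hr0).2 hr1
  have hb : ∀ b, ‖W b - W' b‖ ≤ ‖W - W'‖ := fun b => norm_le_pi_norm (W - W') b
  refine (pi_norm_le_iff_of_nonneg (by positivity)).2 ?_
  rintro (i | b | p)
  · simp only [jetArg, Pi.sub_apply, Sum.elim_inl, sub_self, norm_zero]
    positivity
  · simp only [jetArg, Pi.sub_apply, Sum.elim_inl, Sum.elim_inr, ← map_sub]
    refine (norm_primitive_le _ _).trans ((hb b).trans ?_)
    exact le_mul_of_one_le_left (norm_nonneg _) h1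
  · simp only [jetArg, Pi.sub_apply, Sum.elim_inr, ← map_sub, ← smul_sub]
    rw [norm_smul, norm_inv, Real.norm_of_nonneg hr0.le]
    gcongr
    exact (norm_derivPrimitive_le _ _).trans (hb _)

/-- The fixed point equation for the time derivative `W` of the unknown functions, when space is
rescaled by `r` and time by `ρ`. The scale `r` makes the coordinates small, and `ρ` is then chosen
small enough to compensate for the factor `r⁻¹` of the space derivatives. -/
lemma exists_fixedPoint {N : (ι ⊕ (ν ⊕ ι × ν) → WSeries (Option ι)) → ν → WSeries (Option ι)}
    (hN : AnalyticAt ℝ N 0) {δ₀ : ℝ} (hδ₀ : 0 < δ₀) :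
    ∃ r > 0, ∃ ρ > 0, ∃ W : ν → WSeries (Option ι),
      ‖jetArg r W‖ < δ₀ ∧ W = (ρ : ℝ) • N (jetArg r W) := by
  obtain ⟨K, t, ht, hK⟩ := (hN.contDiffAt (n := 1)).exists_lipschitzOnWith
  obtain ⟨δ₁, hδ₁, hball⟩ := Metric.nhds_basis_closedBall.mem_iff.1 ht
  set δ := min δ₁ (δ₀ / 2) with hδdef
  have hδ : 0 < δ := lt_min hδ₁ (half_pos hδ₀)
  have hδt : Metric.closedBall 0 δ ⊆ t :=
    (Metric.closedBall_subset_closedBall (min_le_left _ _)).trans hball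
  set r := min δ 1
  have hr0 : 0 < r := lt_min hδ one_pos
  have hr1 : r ≤ 1 := min_le_right _ _
  have hrδ : r ≤ δ := min_le_left _ _
  set C := ‖N 0‖ + K * δ with hC
  have hC0 : 0 ≤ C := by positivity
  -- the first bound on `ρ` keeps the ball of radius `r * δ` invariant, the second one makes the
  -- map a contraction
  set ρ := min (r * δ / (C + 1)) (r / (2 * (K + 1)))
  have hρ0 : 0 < ρ := lt_min (by positivity) (by positivity)
  have hρ1 : ρ * C ≤ r * δ := by
    calc ρ * C ≤ r * δ / (C + 1) * (C + 1) := by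
          gcongr
          · exact min_le_left _ _
          · linarith
      _ = r * δ := by field_simp
  have hρ2 : ρ * (K * r⁻¹) ≤ 1 / 2 := by
    calc ρ * (K * r⁻¹) ≤ r / (2 * (K + 1)) * ((K + 1) * r⁻¹) := by
          gcongr
          · exact min_le_right _ _
          · linarith
      _ = 1 / 2 := by field_simp
  set s := Metric.closedBall (0 : ν → WSeries (Option ι)) (r * δ)
  have hjet : ∀ W ∈ s, jetArg r W ∈ Metric.closedBall 0 δ := fun W hW =>
    mem_closedBall_zero_iff.2 (norm_jetArg_le hr0 hr1 hrδ (mem_closedBall_zero_iff.1 hW))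
  set Φ : (ν → WSeries (Option ι)) → ν → WSeries (Option ι) := fun W => ρ • N (jetArg r W)
  have hmaps : MapsTo Φ s s := by
    intro W hW
    have h1 := hK.dist_le_mul _ (hδt (hjet W hW)) _ (hδt (Metric.mem_closedBall_self hδ.le))
    have h2 := hjet W hW
    rw [mem_closedBall_zero_iff] at h2
    rw [dist_eq_norm, dist_eq_norm, sub_zero] at h1
    have h3 : ‖N (jetArg r W)‖ ≤ C := by
      have := norm_sub_norm_le (N (jetArg r W)) (N 0)
      have h4 : K * ‖jetArg r W‖ ≤ K * δ := by gcongr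
      rw [hC]
      linarith
    rw [mem_closedBall_zero_iff, norm_smul, Real.norm_of_nonneg hρ0.le]
    exact (mul_le_mul_of_nonneg_left h3 hρ0.le).trans hρ1
  have hlip : LipschitzOnWith (1 / 2) Φ s := by
    refine LipschitzOnWith.of_dist_le_mul fun W hW W' hW' => ?_
    have h1 := hK.dist_le_mul _ (hδt (hjet W hW)) _ (hδt (hjet W' hW'))
    rw [dist_eq_norm, dist_eq_norm] at h1 ⊢
    rw [← smul_sub, norm_smul, Real.norm_of_nonneg hρ0.le]
    calc ρ * ‖N (jetArg r W) - N (jetArg r W')‖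
        ≤ ρ * (K * (r⁻¹ * ‖W - W'‖)) := by
          gcongr
          exact h1.trans (by gcongr; exact norm_jetArg_sub_le hr0 hr1 W W')
      _ = ρ * (K * r⁻¹) * ‖W - W'‖ := by ring
      _ ≤ 1 / 2 * ‖W - W'‖ := by gcongr
      _ = _ := by simp
  have hcontr : ContractingWith (1 / 2) (hmaps.restrict Φ s s) :=
    ⟨by rw [← NNReal.coe_lt_coe]; norm_num, fun x y => hlip x.2 y.2⟩
  obtain ⟨W, hWs, hW, -⟩ := hcontr.exists_fixedPoint' Metric.isClosed_closedBall.isComplete hmaps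
    (x := 0) (Metric.mem_closedBall_self (by positivity)) (edist_ne_top _ _)
  refine ⟨r, hr0, ρ, hρ0, W, ?_, hW.symm⟩
  refine (mem_closedBall_zero_iff.1 (hjet W hWs)).trans_lt ?_
  exact (min_le_right _ _).trans_lt (half_lt_self hδ₀)

/-- The partial derivatives, in the variable `none` for the time and `some i` for the `i`-th
coordinate, satisfy `∂ₜ w = g (y, w, ∂ w)`, with vanishing initial values. -/
lemma exists_solution_coord [DecidableEq ι] {g : ν → (ι ⊕ (ν ⊕ ι × ν) → ℝ) → ℝ}
    (hg : ∀ b, AnalyticAt ℝ (g b) 0) :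
    ∃ w : ν → (Option ι → ℝ) → ℝ, (∀ b, AnalyticAt ℝ (w b) 0) ∧
      (∀ b z, z none = 0 → w b z = 0) ∧
      ∀ᶠ z in 𝓝 0, ∀ b, fderiv ℝ (w b) z (Pi.single none 1) =
        g b (Sum.elim (fun i => z (some i)) (Sum.elim (fun b => w b z)
          fun p => fderiv ℝ (w p.2) z (Pi.single (some p.1) 1))) := by
  choose N hN δ hδ hev using fun b => exists_extension (σ := Option ι) (hg b)
  obtain ⟨δ₀, hδ₀, hδ₀'⟩ : ∃ δ₀ > 0, ∀ b, δ₀ ≤ δ b := by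
    have : ∀ᶠ x in 𝓝[>] (0 : ℝ), ∀ b, x ≤ δ b := eventually_all.2 fun b =>
      mem_nhdsWithin_of_mem_nhds (Iic_mem_nhds (hδ b))
    obtain ⟨x, hx, hx0⟩ := (this.and self_mem_nhdsWithin).exists
    exact ⟨x, hx0, hx⟩
  obtain ⟨r, hr, ρ, hρ, W, hWδ, hW⟩ := exists_fixedPoint (N := fun ζ b => N b ζ)
    (analyticAt_pi_iff.2 hN) hδ₀
  -- the change of scale
  let a : Option ι → ℝ := fun o => o.elim ρ⁻¹ fun _ => r⁻¹
  let D : (Option ι → ℝ) →L[ℝ] Option ι → ℝ :=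
    ContinuousLinearMap.pi fun o => a o • ContinuousLinearMap.proj o
  have hD : ∀ z o, D z o = a o * z o := fun z o => rfl
  have hDs : ∀ o, D (Pi.single o 1) = a o • Pi.single o 1 := by
    intro o
    funext o'
    rw [hD]
    by_cases h : o' = o
    · subst h; simp
    · simp [h]
  let v : ν → (Option ι → ℝ) → ℝ := fun b z => ev z (primitive none (W b))
  have hv : ∀ b, AnalyticAt ℝ (v b) 0 := fun b => analyticAt_ev _
  have hD0 : Tendsto D (𝓝 0) (𝓝 0) := by simpa using D.continuous.tendsto 0
  refine ⟨fun b z => v b (D z), fun b => ?_, fun b z hz => ?_, ?_⟩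
  · exact (show AnalyticAt ℝ (v b) (D 0) by simpa using hv b).comp (D.analyticAt 0)
  · exact ev_primitive_of_eq_zero (by simp [hD, hz]) _
  have hsmall : ∀ᶠ z in 𝓝 (0 : Option ι → ℝ), ∀ o : Option ι,
      |z o| * (Fintype.card (Option ι) : ℝ) < 1 := by
    refine eventually_all.2 fun o => ?_
    have : Continuous (fun z : Option ι → ℝ => |z o| * (Fintype.card (Option ι) : ℝ)) :=
      (continuous_apply o).abs.mul continuous_const
    exact this.continuousAt.eventually_lt_const (by simp)
  have han : ∀ᶠ z in 𝓝 (0 : Option ι → ℝ), ∀ b, AnalyticAt ℝ (v b) z :=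
    eventually_all.2 fun b => (hv b).eventually_analyticAt
  -- partial derivatives of the rescaled solution
  have hpart : ∀ z : Option ι → ℝ, (∀ o, |z o| * Fintype.card (Option ι) < 1) →
      (∀ b, AnalyticAt ℝ (v b) z) → ∀ b o (h : WSeries (Option ι)),
      (∀ β : Option ι →₀ ℕ, co β h = ((β o : ℝ) + 1) *
        co (β + Finsupp.single o 1) (primitive none (W b))) →
      fderiv ℝ (v b) z (Pi.single o 1) = ev z h := by
    intro z hz hva b o h hh
    have h1 := hasDerivAt_ev hh hz
    have h2 : HasFDerivAt (v b) (fderiv ℝ (v b) z) (Function.update z o (z o)) := by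
      rw [Function.update_eq_self]
      exact (hva b).differentiableAt.hasFDerivAt
    exact (h2.comp_hasDerivAt (z o) (hasDerivAt_update z o (z o))).unique h1
  have hchain : ∀ z, (∀ b, AnalyticAt ℝ (v b) (D z)) → ∀ b o,
      fderiv ℝ (fun z => v b (D z)) z (Pi.single o 1) =
        a o * fderiv ℝ (v b) (D z) (Pi.single o 1) := by
    intro z hz b o
    have h1 : HasFDerivAt (fun z => v b (D z)) ((fderiv ℝ (v b) (D z)).comp D) z :=
      (hz b).differentiableAt.hasFDerivAt.comp z D.hasFDerivAt
    rw [h1.fderiv, ContinuousLinearMap.comp_apply, hDs, map_smul, smul_eq_mul]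
  filter_upwards [hD0.eventually hsmall, hD0.eventually han] with z hz1 hz2 b
  have hz1' := fun o => (hz1 o).le
  have ht := hpart (D z) hz1 hz2 b none (W b) (fun β => by
    rw [co_primitive_add]
    field_simp)
  rw [hchain z hz2, ht]
  have e1 : ev (D z) (W b) = ρ * ev (D z) (N b (jetArg r W)) := by
    have : W b = ρ • N b (jetArg r W) := congrFun hW b
    conv_lhs => rw [this]
    rw [← evHom_apply _ hz1', map_smul, smul_eq_mul, evHom_apply]
  have e2 : a none * (ρ * ev (D z) (N b (jetArg r W))) = ev (D z) (N b (jetArg r W)) := by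
    change ρ⁻¹ * (ρ * _) = _
    field_simp
  rw [e1, e2, hev b _ (hWδ.trans_le (hδ₀' b)) _ hz1']
  congr 1
  funext o
  rcases o with i | b' | p
  · change ev (D z) (r • coord (some i)) = z (some i)
    rw [← evHom_apply _ hz1', map_smul, evHom_apply, ev_coord, hD, smul_eq_mul]
    change r * (r⁻¹ * _) = _
    field_simp
  · rfl
  · change ev (D z) (r⁻¹ • derivPrimitive none (some p.1) _ (W p.2)) =
      fderiv ℝ (fun z => v p.2 (D z)) z (Pi.single (some p.1) 1)
    rw [hchain z hz2, hpart (D z) hz1 hz2 p.2 (some p.1) _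
      (fun β => co_derivPrimitive (Option.some_ne_none p.1) (W p.2) β),
      ← evHom_apply _ hz1', map_smul, evHom_apply, smul_eq_mul]
    rfl

end LocalExistence

/-! ### The local Cauchy–Kovalevskaya theorem -/

section LocalExistence

variable {E : Type*} [NormedAddCommGroup E] [NormedSpace ℝ E]
  {F : Type*} [NormedAddCommGroup F] [NormedSpace ℝ F]

/-- The derivative of a function on space-time `ℝ × E` in the time direction. -/
def dt (f : ℝ × E → F) : ℝ × E → F := fun z => fderiv ℝ f z (1, 0)

/-- The derivative of a function on space-time `ℝ × E` in the space directions. -/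
def dy (f : ℝ × E → F) : ℝ × E → E →L[ℝ] F := fun z =>
  (fderiv ℝ f z).comp (ContinuousLinearMap.inr ℝ ℝ E)

/-- The local Cauchy–Kovalevskaya theorem, in finite dimensional spaces without preferred
coordinates. -/
theorem exists_local_solution [FiniteDimensional ℝ E] [FiniteDimensional ℝ F]
    {G : E × F × (E →L[ℝ] F) → F} {f : E → F} {y₀ : E} (hf : AnalyticAt ℝ f y₀)
    (hG : AnalyticAt ℝ G (y₀, f y₀, fderiv ℝ f y₀)) :
    ∃ w : ℝ × E → F, AnalyticAt ℝ w (0, y₀) ∧ (∀ y, w (0, y) = f y) ∧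
      ∀ᶠ z in 𝓝 ((0 : ℝ), y₀), dt w z = G (z.2, w z, dy w z) := by
  classical
  let ι := Fin (Module.finrank ℝ E)
  let ν := Fin (Module.finrank ℝ F)
  let eE : E ≃L[ℝ] (ι → ℝ) := (Module.finBasis ℝ E).equivFunL
  let eF : F ≃L[ℝ] (ν → ℝ) := (Module.finBasis ℝ F).equivFunL
  -- reconstruction of the arguments of `G` from their coordinates
  let Λ₁ : (ι ⊕ (ν ⊕ ι × ν) → ℝ) →L[ℝ] E :=
    (eE.symm : (ι → ℝ) →L[ℝ] E).comp (.pi fun i => .proj (Sum.inl i))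
  let Λ₂ : (ι ⊕ (ν ⊕ ι × ν) → ℝ) →L[ℝ] F :=
    (eF.symm : (ν → ℝ) →L[ℝ] F).comp (.pi fun b => .proj (Sum.inr (Sum.inl b)))
  let Λ₃ : (ι ⊕ (ν ⊕ ι × ν) → ℝ) →L[ℝ] (E →L[ℝ] F) :=
    ∑ i, (ContinuousLinearMap.smulRightL ℝ E F
      ((ContinuousLinearMap.proj i).comp (eE : E →L[ℝ] (ι → ℝ)))).comp
        ((eF.symm : (ν → ℝ) →L[ℝ] F).comp (.pi fun b => .proj (Sum.inr (Sum.inr (i, b)))))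
  have hΛ₃ : ∀ ζ y, Λ₃ ζ y = ∑ i, eE y i • eF.symm fun b => ζ (Sum.inr (Sum.inr (i, b))) := by
    intro ζ y
    simp only [Λ₃, _root_.sum_apply]
    rfl
  let J : (ι ⊕ (ν ⊕ ι × ν) → ℝ) → E × F × (E →L[ℝ] F) := fun ζ =>
    (y₀ + Λ₁ ζ, f (y₀ + Λ₁ ζ) + Λ₂ ζ, fderiv ℝ f (y₀ + Λ₁ ζ) + Λ₃ ζ)
  have hJ0 : J 0 = (y₀, f y₀, fderiv ℝ f y₀) := by simp [J]
  have hJ : AnalyticAt ℝ J 0 := by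
    have h1 : AnalyticAt ℝ (fun ζ => y₀ + Λ₁ ζ) 0 := analyticAt_const.add (Λ₁.analyticAt 0)
    have h2 : AnalyticAt ℝ (fun ζ => f (y₀ + Λ₁ ζ)) 0 :=
      AnalyticAt.fun_comp (g := f) (by simpa using hf) h1
    have h3 : AnalyticAt ℝ (fun ζ => fderiv ℝ f (y₀ + Λ₁ ζ)) 0 :=
      AnalyticAt.fun_comp (g := fderiv ℝ f) (by simpa using hf.fderiv) h1
    exact h1.prod ((h2.add (Λ₂.analyticAt 0)).prod (h3.add (Λ₃.analyticAt 0)))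
  have hGJ : AnalyticAt ℝ (fun ζ => G (J ζ)) 0 :=
    AnalyticAt.fun_comp (g := G) (by rw [hJ0]; exact hG) hJ
  have hg : ∀ b, AnalyticAt ℝ (fun ζ => eF (G (J ζ)) b) 0 := fun b =>
    (((ContinuousLinearMap.proj b : (ν → ℝ) →L[ℝ] ℝ).comp (eF : F →L[ℝ] ν → ℝ)).analyticAt
      _).fun_comp hGJ
  obtain ⟨w, hw, hw0, hweq⟩ := exists_solution_coord hg
  -- coordinates on space-time, centred at `(0, y₀)`
  let Z : ℝ × E →L[ℝ] (Option ι → ℝ) := .pi fun o => o.elim (.fst ℝ ℝ E) fun i =>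
    ((ContinuousLinearMap.proj i).comp (eE : E →L[ℝ] (ι → ℝ))).comp (.snd ℝ ℝ E)
  have hZ1 : Z (1, 0) = Pi.single none 1 := by
    funext o
    rcases o with _ | i <;> simp [Z]
  have hZ2 : ∀ y, Z (0, y) = ∑ i, eE y i • Pi.single (some i) 1 := by
    intro y
    funext o
    rcases o with _ | i
    · simp [Z]
    · simp [Z, Pi.single_apply]
      exact (Fintype.sum_ite_eq i (eE y)).symm
  let c : ℝ × E → Option ι → ℝ := fun z => Z (z - (0, y₀))
  have hc : ∀ z, HasFDerivAt c Z z := fun z =>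
    Z.hasFDerivAt.comp z ((hasFDerivAt_id z).sub_const _)
  have hc0 : Tendsto c (𝓝 (0, y₀)) (𝓝 0) := by
    simpa [c] using (hc (0, y₀)).continuousAt.tendsto
  have hca : AnalyticAt ℝ c (0, y₀) :=
    (Z.analyticAt _).fun_comp (analyticAt_id.sub analyticAt_const)
  -- the solution is `f + v`, where `v` has vanishing initial values
  let v : ℝ × E → F := fun z => eF.symm fun b => w b (c z)
  have hva : AnalyticAt ℝ v (0, y₀) := by
    refine ((eF.symm : (ν → ℝ) →L[ℝ] F).analyticAt _).fun_comp (analyticAt_pi_iff.2 fun b => ?_)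
    exact AnalyticAt.fun_comp (g := w b) (by simpa [c] using hw b) hca
  have hv : ∀ z, (∀ b, AnalyticAt ℝ (w b) (c z)) → HasFDerivAt v
      ((eF.symm : (ν → ℝ) →L[ℝ] F).comp (.pi fun b => (fderiv ℝ (w b) (c z)).comp Z)) z := by
    intro z hz
    refine (eF.symm : (ν → ℝ) →L[ℝ] F).hasFDerivAt.comp z (hasFDerivAt_pi.2 fun b => ?_)
    exact (hz b).differentiableAt.hasFDerivAt.comp z (hc z)
  have hwan : ∀ᶠ z in 𝓝 (0 : Option ι → ℝ), ∀ b, AnalyticAt ℝ (w b) z :=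
    eventually_all.2 fun b => (hw b).eventually_analyticAt
  have hf2 : AnalyticAt ℝ (fun z : ℝ × E => f z.2) (0, y₀) :=
    AnalyticAt.fun_comp (g := f) hf analyticAt_snd
  refine ⟨fun z => f z.2 + v z, hf2.add hva, fun y => ?_, ?_⟩
  · have : v (0, y) = 0 := by
      have : (fun b => w b (c (0, y))) = 0 := by
        funext b
        exact hw0 b _ (by simp [c, Z])
      simp only [v, this, map_zero]
    simp [this]
  have hfan : ∀ᶠ z in 𝓝 ((0 : ℝ), y₀), AnalyticAt ℝ f z.2 :=
    continuous_snd.continuousAt.eventually hf.eventually_analyticAt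
  filter_upwards [hc0.eventually hweq, hc0.eventually hwan, hfan] with z h1 h2 h3
  have hd : HasFDerivAt (fun z : ℝ × E => f z.2 + v z)
      ((fderiv ℝ f z.2).comp (.snd ℝ ℝ E) + (eF.symm : (ν → ℝ) →L[ℝ] F).comp
        (.pi fun b => (fderiv ℝ (w b) (c z)).comp Z)) z :=
    (h3.differentiableAt.hasFDerivAt.comp z hasFDerivAt_snd).add (hv z h2)
  set ζ : ι ⊕ (ν ⊕ ι × ν) → ℝ := Sum.elim (fun i => c z (some i)) (Sum.elim (fun b => w b (c z))
          fun p => fderiv ℝ (w p.2) (c z) (Pi.single (some p.1) 1)) with hζ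
  have e1 : y₀ + Λ₁ ζ = z.2 := by
    have : (fun i => ζ (Sum.inl i)) = eE (z.2 - y₀) := by
      funext i
      simp [ζ, c, Z]
    change y₀ + eE.symm (fun i => ζ (Sum.inl i)) = z.2
    rw [this]
    simp
  have e2 : Λ₂ ζ = v z := rfl
  have e3 : dy (fun z : ℝ × E => f z.2 + v z) z = fderiv ℝ f z.2 + Λ₃ ζ := by
    ext y
    rw [dy, hd.fderiv, _root_.add_apply, hΛ₃]
    simp only [ContinuousLinearMap.comp_apply, _root_.add_apply, ContinuousLinearMap.inr_apply,
      ContinuousLinearMap.coe_snd', add_right_inj]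
    have : (ContinuousLinearMap.pi fun b => (fderiv ℝ (w b) (c z)).comp Z) (0, y) =
        ∑ i, eE y i • fun b => ζ (Sum.inr (Sum.inr (i, b))) := by
      funext b
      simp [ζ, hZ2]
    rw [this, ContinuousLinearEquiv.coe_coe, map_sum]
    simp only [map_smul]
  have e4 : dt (fun z : ℝ × E => f z.2 + v z) z = G (J ζ) := by
    rw [dt, hd.fderiv, _root_.add_apply]
    simp only [ContinuousLinearMap.comp_apply, ContinuousLinearMap.coe_snd', map_zero, zero_add]
    have : (ContinuousLinearMap.pi fun b => (fderiv ℝ (w b) (c z)).comp Z) (1, 0) =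
        eF (G (J ζ)) := by
      funext b
      simpa [hZ1] using h1 b
    rw [this]
    simp
  rw [e4, e3]
  simp only [J, e1, e2]

end LocalExistence

section SpaceTime

universe u

variable {E F : Type u} [NormedAddCommGroup E] [NormedSpace ℝ E]
  [NormedAddCommGroup F] [NormedSpace ℝ F]

/-! ### Time and space derivatives -/

lemma hasDerivAt_dt {f : ℝ × E → F} {t : ℝ} {y : E} (hf : DifferentiableAt ℝ f (t, y)) :
    HasDerivAt (fun s => f (s, y)) (dt f (t, y)) t :=
  hf.hasFDerivAt.comp_hasDerivAt t ((hasDerivAt_id t).prodMk (hasDerivAt_const t y))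

lemma hasFDerivAt_dy {f : ℝ × E → F} {t : ℝ} {y : E} (hf : DifferentiableAt ℝ f (t, y)) :
    HasFDerivAt (fun y => f (t, y)) (dy f (t, y)) y :=
  hf.hasFDerivAt.comp y (hasFDerivAt_prodMk_right t y)

lemma dt_congr {f g : ℝ × E → F} {z : ℝ × E} (h : f =ᶠ[𝓝 z] g) : dt f =ᶠ[𝓝 z] dt g :=
  (h.fderiv (𝕜 := ℝ)).mono fun x hx => by simp only [dt, hx]

lemma dt_iterate_congr {f g : ℝ × E → F} {z : ℝ × E} (h : f =ᶠ[𝓝 z] g) (k : ℕ) :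
    dt^[k] f =ᶠ[𝓝 z] dt^[k] g := by
  induction k generalizing f g with
  | zero => exact h
  | succ k ih => exact ih (dt_congr h)

variable [CompleteSpace F]

lemma AnalyticAt.dt {f : ℝ × E → F} {z : ℝ × E} (hf : AnalyticAt ℝ f z) :
    AnalyticAt ℝ (dt f) z :=
  ((ContinuousLinearMap.apply ℝ F ((1, 0) : ℝ × E)).analyticAt _).fun_comp hf.fderiv

lemma AnalyticAt.dt_iterate {f : ℝ × E → F} {z : ℝ × E} (hf : AnalyticAt ℝ f z) (k : ℕ) :
    AnalyticAt ℝ (_root_.dt^[k] f) z := by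
  induction k generalizing f with
  | zero => exact hf
  | succ k ih => exact ih hf.dt

lemma AnalyticAt.dy {f : ℝ × E → F} {z : ℝ × E} (hf : AnalyticAt ℝ f z) :
    AnalyticAt ℝ (dy f) z :=
  (((ContinuousLinearMap.compL ℝ E (ℝ × E) F).flip
    (ContinuousLinearMap.inr ℝ ℝ E)).analyticAt _).fun_comp hf.fderiv

/-- Time and space derivatives commute. -/
lemma dt_dy {f : ℝ × E → F} {z : ℝ × E} (hf : AnalyticAt ℝ f z) : dt (dy f) z = dy (dt f) z := by
  have hs : IsSymmSndFDerivAt ℝ f z := hf.contDiffAt.isSymmSndFDerivAt_of_omega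
  have hd : DifferentiableAt ℝ (fderiv ℝ f) z := hf.fderiv.differentiableAt
  ext v
  have h1 : HasFDerivAt (dy f) (((ContinuousLinearMap.compL ℝ E (ℝ × E) F).flip
      (ContinuousLinearMap.inr ℝ ℝ E)).comp (fderiv ℝ (fderiv ℝ f) z)) z :=
    ((ContinuousLinearMap.compL ℝ E (ℝ × E) F).flip
      (ContinuousLinearMap.inr ℝ ℝ E)).hasFDerivAt.comp z hd.hasFDerivAt
  have h2 : HasFDerivAt (dt f) ((ContinuousLinearMap.apply ℝ F ((1, 0) : ℝ × E)).comp
      (fderiv ℝ (fderiv ℝ f) z)) z :=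
    (ContinuousLinearMap.apply ℝ F ((1, 0) : ℝ × E)).hasFDerivAt.comp z hd.hasFDerivAt
  rw [dt, h1.fderiv, dy, h2.fderiv]
  exact hs.eq (1, 0) (0, v)

lemma dt_iterate_dy {f : ℝ × E → F} {z : ℝ × E} (hf : AnalyticAt ℝ f z) (k : ℕ) :
    dt^[k] (dy f) z = dy (dt^[k] f) z := by
  induction k generalizing f with
  | zero => rfl
  | succ k ih =>
    rw [Function.iterate_succ_apply, Function.iterate_succ_apply, ← ih hf.dt]
    exact (dt_iterate_congr (hf.eventually_analyticAt.mono fun x hx => dt_dy hx) k).self_of_nhds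

lemma iteratedDeriv_eq_dt_iterate {f : ℝ × E → F} {t : ℝ} {y : E} (hf : AnalyticAt ℝ f (t, y))
    (k : ℕ) : iteratedDeriv k (fun s => f (s, y)) t = dt^[k] f (t, y) := by
  induction k generalizing t with
  | zero => rfl
  | succ k ih =>
    rw [iteratedDeriv_succ, Function.iterate_succ_apply']
    have h : ∀ᶠ s in 𝓝 t, AnalyticAt ℝ f (s, y) :=
      (Continuous.prodMk_left y).continuousAt.eventually hf.eventually_analyticAt
    have h' : iteratedDeriv k (fun s => f (s, y)) =ᶠ[𝓝 t] fun s => dt^[k] f (s, y) :=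
      h.mono fun s hs => ih hs
    rw [h'.deriv_eq]
    exact (hasDerivAt_dt (hf.dt_iterate k).differentiableAt).deriv

lemma iteratedFDeriv_time {f : ℝ × E → F} {z : ℝ × E} (hf : AnalyticAt ℝ f z) (k : ℕ) (t : ℝ) :
    iteratedFDeriv ℝ k f z (fun _ => (t, 0)) = t ^ k • dt^[k] f z := by
  have key : ∀ k z, AnalyticAt ℝ f z →
      iteratedFDeriv ℝ k f z (fun _ => ((1, 0) : ℝ × E)) = dt^[k] f z := by
    intro k
    induction k with
    | zero => intro z _; simp
    | succ k ih =>
      intro z hz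
      rw [Function.iterate_succ_apply', iteratedFDeriv_succ_apply_left]
      have h1 : dt^[k] f =ᶠ[𝓝 z] fun z => iteratedFDeriv ℝ k f z (fun _ => ((1, 0) : ℝ × E)) :=
        hz.eventually_analyticAt.mono fun x hx => (ih x hx).symm
      have h2 : DifferentiableAt ℝ (iteratedFDeriv ℝ k f) z :=
        let ⟨r, hr, hrz⟩ := hz.exists_ball_analyticOnNhd
        (hrz.iteratedFDeriv k z (Metric.mem_ball_self hr)).differentiableAt
      have h3 : HasFDerivAt (fun z => iteratedFDeriv ℝ k f z (fun _ => ((1, 0) : ℝ × E)))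
          ((ContinuousMultilinearMap.apply ℝ (fun _ : Fin k => ℝ × E) F (fun _ => (1, 0))).comp
            (fderiv ℝ (iteratedFDeriv ℝ k f) z)) z :=
        (ContinuousMultilinearMap.apply ℝ (fun _ : Fin k => ℝ × E) F
          (fun _ => (1, 0))).hasFDerivAt.comp z h2.hasFDerivAt
      rw [dt, h1.fderiv_eq, h3.fderiv]
      rfl
  have : (fun _ : Fin k => ((t, 0) : ℝ × E)) = fun _ => t • ((1, 0) : ℝ × E) := by
    funext i
    simp
  rw [this, ContinuousMultilinearMap.map_smul_univ, key k z hf]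
  simp

/-! ### Taylor expansion in time -/

/-- The Taylor polynomial of `f` in time at time `0`, as a function of `y` for given `t`. The
exponents range over an arbitrary finite set `S`, so that unconditional convergence of the Taylor
series is convergence along `atTop`. -/
def timeTaylor (f : ℝ × E → F) (S : Finset ℕ) (t : ℝ) (y : E) : F :=
  ∑ k ∈ S, (t ^ k / (k ! : ℝ)) • dt^[k] f (0, y)

lemma HasFPowerSeriesOnBall.apply_time {f : ℝ × E → F}
    {p : FormalMultilinearSeries ℝ (ℝ × E) F} {z : ℝ × E} {R : ENNReal}
    (h : HasFPowerSeriesOnBall f p z R) (k : ℕ) (t : ℝ) :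
    p k (fun _ => (t, 0)) = (t ^ k / (k ! : ℝ)) • dt^[k] f z := by
  have h1 := h.factorial_smul ((t, 0) : ℝ × E) k
  rw [iteratedFDeriv_time h.analyticAt, ← Nat.cast_smul_eq_nsmul ℝ] at h1
  have h0 : (k ! : ℝ) ≠ 0 := by exact_mod_cast Nat.factorial_ne_zero k
  rw [div_eq_inv_mul, mul_smul, ← h1, smul_smul, inv_mul_cancel₀ h0, one_smul]

lemma isBigO_sub_timeTaylor {f : ℝ × E → F} {y : E} (hf : AnalyticAt ℝ f (0, y)) (k : ℕ) :
    (fun t => f (t, y) - timeTaylor f (Finset.range k) t y) =O[𝓝 0] fun t : ℝ => t ^ k := by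
  obtain ⟨p, R, hp⟩ := hf
  have h1 := HasFPowerSeriesAt.isBigO_sub_partialSum_pow ⟨R, hp⟩ k
  have h2 : Tendsto (fun t : ℝ => ((t, 0) : ℝ × E)) (𝓝 0) (𝓝 0) :=
    (Continuous.prodMk_left (0 : E)).tendsto' 0 0 rfl
  have h3 := h1.comp_tendsto h2
  refine (h3.congr_left fun t => ?_).trans (Asymptotics.isBigO_of_le _ fun t => ?_)
  · simp only [Function.comp_apply, Prod.mk_add_mk, zero_add, add_zero,
      FormalMultilinearSeries.partialSum, timeTaylor]
    congr 1
    exact Finset.sum_congr rfl fun j _ => hp.apply_time j t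
  · simp

lemma dy_timeTaylor {f : ℝ × E → F} {y : E} (hf : AnalyticAt ℝ f (0, y)) (S : Finset ℕ) (t : ℝ) :
    HasFDerivAt (timeTaylor f S t) (timeTaylor (dy f) S t y) y := by
  refine HasFDerivAt.fun_sum fun k _ => ?_
  rw [dt_iterate_dy hf]
  exact (hasFDerivAt_dy (hf.dt_iterate k).differentiableAt).const_smul _

/-- An analytic function of one variable that is `O(t^{k+1})` has vanishing `k`-th derivative. -/
lemma iteratedDeriv_eq_zero_of_isBigO {f : ℝ → F} (hf : AnalyticAt ℝ f 0) {k : ℕ}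
    (h : f =O[𝓝 0] fun t : ℝ => t ^ (k + 1)) : iteratedDeriv k f 0 = 0 := by
  suffices hle : ((k + 1 : ℕ) : ℕ∞) ≤ analyticOrderAt f 0 from
    (natCast_le_analyticOrderAt_iff_iteratedDeriv_eq_zero hf).1 hle k (Nat.lt_succ_self k)
  by_contra! hlt
  obtain ⟨m, hm⟩ := ENat.ne_top_iff_exists.1 hlt.ne_top
  rw [← hm] at hlt
  have hmk : m < k + 1 := by exact_mod_cast hlt
  obtain ⟨g, hg, hg0, hfg⟩ := (hf.analyticOrderAt_eq_natCast).1 hm.symm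
  have h1 : (fun t : ℝ => t ^ m • g t) =O[𝓝 0] fun t : ℝ => t ^ (m + 1) := by
    refine (h.congr' (hfg.mono fun t ht => by simpa using ht) EventuallyEq.rfl).trans ?_
    refine Asymptotics.IsBigO.of_bound 1 ?_
    filter_upwards [Metric.ball_mem_nhds (0 : ℝ) one_pos] with t ht
    rw [one_mul, norm_pow, norm_pow]
    exact pow_le_pow_of_le_one (norm_nonneg _) (by simpa using (mem_ball_zero_iff.1 ht).le) hmk
  obtain ⟨C, hC⟩ := h1.bound
  have h2 : ∀ᶠ t in 𝓝[≠] (0 : ℝ), ‖g t‖ ≤ C * ‖t‖ := by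
    filter_upwards [mem_nhdsWithin_of_mem_nhds hC, self_mem_nhdsWithin] with t ht ht0
    have ht0' : 0 < ‖t‖ := norm_pos_iff.2 ht0
    change ‖t ^ m • g t‖ ≤ C * ‖t ^ (m + 1)‖ at ht
    rw [norm_smul, norm_pow, norm_pow, pow_succ, ← mul_assoc, mul_comm C, mul_assoc] at ht
    exact le_of_mul_le_mul_left ht (by positivity)
  have h3 : Tendsto (fun t => ‖g t‖) (𝓝[≠] 0) (𝓝 ‖g 0‖) :=
    hg.continuousAt.norm.mono_left nhdsWithin_le_nhds
  have h4 : Tendsto (fun t : ℝ => C * ‖t‖) (𝓝[≠] 0) (𝓝 0) := by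
    have : ContinuousAt (fun t : ℝ => C * ‖t‖) 0 := by fun_prop
    simpa using this.tendsto.mono_left nhdsWithin_le_nhds
  have := le_of_tendsto_of_tendsto h3 h4 h2
  exact hg0 (norm_le_zero_iff.1 this)

/-- Analytic functions of one variable with the same derivatives at `0` agree on any interval
around `0`. -/
lemma eqOn_of_iteratedDeriv_eq {f g : ℝ → F} {ε : ℝ} (hf : AnalyticOnNhd ℝ f (Ioo (-ε) ε))
    (hg : AnalyticOnNhd ℝ g (Ioo (-ε) ε)) (h : ∀ k, iteratedDeriv k f 0 = iteratedDeriv k g 0) :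
    EqOn f g (Ioo (-ε) ε) := by
  intro t ht
  have h0 : (0 : ℝ) ∈ Ioo (-ε) ε := by
    have : -ε < ε := ht.1.trans ht.2
    constructor <;> linarith
  have hsub : AnalyticAt ℝ (f - g) 0 := (hf 0 h0).sub (hg 0 h0)
  have htop : analyticOrderAt (f - g) 0 = ⊤ := by
    refine ENat.eq_top_iff_forall_ge.2 fun n => ?_
    refine (natCast_le_analyticOrderAt_iff_iteratedDeriv_eq_zero hsub).2 fun i _ => ?_
    rw [iteratedDeriv_sub (hf 0 h0).contDiffAt (hg 0 h0).contDiffAt, h, sub_self]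
  have hev : f =ᶠ[𝓝 0] g := (analyticOrderAt_eq_top.1 htop).mono fun s hs => sub_eq_zero.1 hs
  exact hf.eqOn_of_preconnected_of_eventuallyEq hg isPreconnected_Ioo h0 hev ht

/-! ### Uniform convergence of all space derivatives -/

omit [CompleteSpace F] in
lemma tendstoUniformlyOn_iteratedFDeriv_succ {ι : Type*} {l : Filter ι} {A : ι → E → F}
    {B : E → F} {A' : ι → E → E →L[ℝ] F} {B' : E → E →L[ℝ] F} {O K : Set E} (hO : IsOpen O)
    (hK : K ⊆ O) (hA : ∀ᶠ i in l, ∀ y ∈ O, fderiv ℝ (A i) y = A' i y)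
    (hB : ∀ y ∈ O, fderiv ℝ B y = B' y) {m : ℕ}
    (h : TendstoUniformlyOn (fun i => iteratedFDeriv ℝ m (A' i)) (iteratedFDeriv ℝ m B') l K) :
    TendstoUniformlyOn (fun i => iteratedFDeriv ℝ (m + 1) (A i)) (iteratedFDeriv ℝ (m + 1) B)
      l K := by
  rw [Metric.tendstoUniformlyOn_iff] at h ⊢
  intro ε hε
  filter_upwards [h ε hε, hA] with i hi hAi y hy
  have hyO : O ∈ 𝓝 y := hO.mem_nhds (hK hy)
  have e1 : fderiv ℝ (A i) =ᶠ[𝓝 y] A' i := by filter_upwards [hyO] with x hx using hAi x hx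
  have e2 : fderiv ℝ B =ᶠ[𝓝 y] B' := by filter_upwards [hyO] with x hx using hB x hx
  rw [iteratedFDeriv_succ_eq_comp_right, iteratedFDeriv_succ_eq_comp_right, Function.comp_apply,
    Function.comp_apply, LinearIsometryEquiv.dist_map, (e1.iteratedFDeriv ℝ m).self_of_nhds,
    (e2.iteratedFDeriv ℝ m).self_of_nhds]
  exact hi y hy

/-- Expanding the power series at `(0, y)` instead of `(0, y₀)` bounds its terms uniformly in
`y`, by the terms of a convergent series that does not depend on `y`. -/
lemma tendstoUniformlyOn_timeTaylor {f : ℝ × E → F} {p : FormalMultilinearSeries ℝ (ℝ × E) F}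
    {y₀ : E} {R : ENNReal} (h : HasFPowerSeriesOnBall f p (0, y₀) R) {r : NNReal}
    (hr : (r + r : ENNReal) < R) {t : ℝ} (ht : |t| ≤ r) :
    TendstoUniformlyOn (fun S y => timeTaylor f S t y) (fun y => f (t, y)) atTop
      (Metric.ball y₀ r) := by
  have hrp : (r + r : ENNReal) < p.radius := hr.trans_le h.r_le
  have hrp' : (r : ENNReal) < p.radius := (le_add_right le_rfl).trans_lt hrp
  let u : ℕ → NNReal := fun k =>
    ∑' s : Σ l : ℕ, {s : Finset (Fin (k + l)) // s.card = l}, ‖p (k + s.1)‖₊ * r ^ s.1 * r ^ k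
  have hu : Summable u := (NNReal.summable_sigma.1 (p.changeOriginSeries_summable_aux₁ hrp)).2
  have hu' : Summable fun k => (u k : ℝ) := NNReal.summable_coe.2 hu
  have hball : ∀ y ∈ Metric.ball y₀ r, ‖((0, y - y₀) : ℝ × E)‖₊ < r := by
    intro y hy
    rw [← NNReal.coe_lt_coe, coe_nnnorm, Prod.norm_def]
    have := mem_ball_iff_norm.1 hy
    simpa using this
  have hps : ∀ y ∈ Metric.ball y₀ r, HasFPowerSeriesOnBall f (p.changeOrigin (0, y - y₀)) (0, y)
      (R - ‖((0, y - y₀) : ℝ × E)‖₊) := by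
    intro y hy
    have h1 : (‖((0, y - y₀) : ℝ × E)‖₊ : ENNReal) < R :=
      (ENNReal.coe_lt_coe.2 (hball y hy)).trans ((le_add_right le_rfl).trans_lt hr)
    simpa using h.changeOrigin h1
  have hbound : ∀ k, ∀ y ∈ Metric.ball y₀ r,
      ‖(t ^ k / (k ! : ℝ)) • dt^[k] f (0, y)‖ ≤ u k := by
    intro k y hy
    rw [← (hps y hy).apply_time k t]
    have hx := hball y hy
    refine (ContinuousMultilinearMap.le_opNorm _ _).trans ?_
    have h1 : ‖p.changeOrigin ((0, y - y₀) : ℝ × E) k‖₊ ≤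
        ∑' s : Σ l : ℕ, {s : Finset (Fin (k + l)) // s.card = l}, ‖p (k + s.1)‖₊ * r ^ s.1 := by
      refine (p.nnnorm_changeOrigin_le k ((ENNReal.coe_lt_coe.2 hx).trans hrp')).trans ?_
      refine Summable.tsum_le_tsum (fun s => by gcongr) ?_
        (p.changeOriginSeries_summable_aux₂ hrp' k)
      exact NNReal.summable_of_le (fun s => by gcongr)
        (p.changeOriginSeries_summable_aux₂ hrp' k)
    have h2 : ∏ _i : Fin k, ‖((t, 0) : ℝ × E)‖ ≤ (r : ℝ) ^ k := by
      simp only [Finset.prod_const, Finset.card_univ, Fintype.card_fin]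
      gcongr
      simpa [Prod.norm_def] using ht
    have hu : (u k : ℝ) = (∑' s : Σ l : ℕ, {s : Finset (Fin (k + l)) // s.card = l},
        ‖p (k + s.1)‖₊ * r ^ s.1 : NNReal) * (r : ℝ) ^ k := by
      simp only [u, NNReal.tsum_mul_right]
      rw [NNReal.coe_mul, NNReal.coe_pow]
    rw [hu]
    exact mul_le_mul (NNReal.coe_le_coe.2 h1) h2
      (Finset.prod_nonneg fun _ _ => norm_nonneg _) (NNReal.coe_nonneg _)
  refine (tendstoUniformlyOn_tsum hu' hbound).congr_right fun y hy => ?_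
  have h1 := (hps y hy).hasSum (y := ((t, 0) : ℝ × E)) (by
    have h2 : ‖((t, 0) : ℝ × E)‖₊ ≤ r := by
      rw [← NNReal.coe_le_coe, coe_nnnorm, Prod.norm_def]
      simpa using ht
    rw [Metric.mem_eball, edist_zero_right, enorm_eq_nnnorm, lt_tsub_iff_left]
    refine lt_of_le_of_lt ?_ hr
    gcongr
    exact (hball y hy).le)
  simp only [Prod.mk_add_mk, zero_add, add_zero] at h1
  rw [← h1.tsum_eq]
  exact tsum_congr fun k => ((hps y hy).apply_time k t).symm

omit [CompleteSpace F] in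
lemma tendstoUniformlyOn_iteratedFDeriv_zero_iff {ι : Type*} {l : Filter ι} {A : ι → E → F}
    {B : E → F} {K : Set E} :
    TendstoUniformlyOn (fun i => iteratedFDeriv ℝ 0 (A i)) (iteratedFDeriv ℝ 0 B) l K ↔
      TendstoUniformlyOn A B l K := by
  simp only [Metric.tendstoUniformlyOn_iff, iteratedFDeriv_zero_eq_comp, Function.comp_apply,
    LinearIsometryEquiv.dist_map]

omit [CompleteSpace F] in
/-- All space derivatives of the Taylor series in time converge on the same time interval: the
derivative `dy f` has a power series on the same ball as `f`. -/
lemma tendstoUniformlyOn_iteratedFDeriv_timeTaylor {y₀ : E} {R : ENNReal} {r : NNReal}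
    (hr : (r + r : ENNReal) < R) {t : ℝ} (ht : |t| ≤ r) (m : ℕ) [CompleteSpace F]
    {f : ℝ × E → F} {p : FormalMultilinearSeries ℝ (ℝ × E) F}
    (h : HasFPowerSeriesOnBall f p (0, y₀) R) :
    TendstoUniformlyOn (fun S => iteratedFDeriv ℝ m (timeTaylor f S t))
      (iteratedFDeriv ℝ m fun y => f (t, y)) atTop (Metric.ball y₀ r) := by
  induction m generalizing F with
  | zero =>
    exact tendstoUniformlyOn_iteratedFDeriv_zero_iff.2 (tendstoUniformlyOn_timeTaylor h hr ht)
  | succ m ih =>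
    have hmem : ∀ s : ℝ, |s| ≤ r → ∀ y ∈ Metric.ball y₀ r, AnalyticAt ℝ f (s, y) := by
      intro s hs y hy
      refine h.analyticAt_of_mem ?_
      have h1 : edist ((s, y) : ℝ × E) (0, y₀) ≤ r := by
        rw [edist_dist]
        refine ENNReal.ofReal_le_of_le_toReal ?_
        rw [Prod.dist_eq]
        simpa using ⟨hs, (Metric.mem_ball.1 hy).le⟩
      exact Metric.mem_eball.2 (h1.trans_lt ((le_add_right le_rfl).trans_lt hr))
    have hdy := ((ContinuousLinearMap.compL ℝ E (ℝ × E) F).flip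
      (ContinuousLinearMap.inr ℝ ℝ E)).comp_hasFPowerSeriesOnBall h.fderiv
    exact tendstoUniformlyOn_iteratedFDeriv_succ Metric.isOpen_ball subset_rfl
      (Eventually.of_forall fun S y hy =>
        (dy_timeTaylor (hmem 0 (by simp) y hy) S t).fderiv)
      (fun y hy => (hasFDerivAt_dy (hmem t ht y hy).differentiableAt).fderiv) (ih hdy)

omit [CompleteSpace F] in
/-- The difference quotients in time converge to the time derivative, uniformly on compact sets
with all space derivatives. -/
lemma tendstoUniformlyOn_iteratedFDeriv_slope {I : Set ℝ} {O K : Set E} (hI : IsOpen I)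
    (hO : IsOpen O) (hK : IsCompact K) (hKO : K ⊆ O) {t : ℝ} (ht : t ∈ I) (m : ℕ)
    [CompleteSpace F] {f : ℝ × E → F} (hf : AnalyticOnNhd ℝ f (I ×ˢ O)) :
    TendstoUniformlyOn
      (fun h : ℝ => iteratedFDeriv ℝ m fun y => h⁻¹ • (f (t + h, y) - f (t, y)))
      (iteratedFDeriv ℝ m fun y => dt f (t, y)) (𝓝[≠] 0) K := by
  have hshift : ∀ᶠ h in 𝓝[≠] (0 : ℝ), t + h ∈ I := by
    have : Tendsto (fun h : ℝ => t + h) (𝓝[≠] 0) (𝓝 t) := by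
      refine Tendsto.mono_left ?_ nhdsWithin_le_nhds
      exact (continuous_const.add continuous_id).tendsto' _ _ (by simp)
    exact this.eventually (hI.mem_nhds ht)
  induction m generalizing F with
  | zero =>
    rw [tendstoUniformlyOn_iteratedFDeriv_zero_iff, Metric.tendstoUniformlyOn_iff]
    intro ε hε
    obtain ⟨η, hη, hηI⟩ := Metric.nhds_basis_closedBall.mem_iff.1 (hI.mem_nhds ht)
    have hcomp : IsCompact (Metric.closedBall t η ×ˢ K) := (isCompact_closedBall t η).prod hK
    have hsub : Metric.closedBall t η ×ˢ K ⊆ I ×ˢ O := prod_mono hηI hKO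
    have huc : UniformContinuousOn (dt f) (Metric.closedBall t η ×ˢ K) :=
      hcomp.uniformContinuousOn_of_continuous fun z hz =>
        (hf z (hsub hz)).dt.continuousAt.continuousWithinAt
    obtain ⟨δ, hδ, hδ'⟩ := Metric.uniformContinuousOn_iff.1 huc (ε / 2) (half_pos hε)
    have hsmall : ∀ᶠ h in 𝓝[≠] (0 : ℝ), |h| < min δ η := by
      refine mem_nhdsWithin_of_mem_nhds ?_
      filter_upwards [Metric.ball_mem_nhds (0 : ℝ) (lt_min hδ hη)] with h hh
      simpa using hh
    filter_upwards [hsmall, self_mem_nhdsWithin] with h hh h0 y hy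
    have h0' : h ≠ 0 := h0
    have hball : Convex ℝ (Metric.closedBall t |h|) := convex_closedBall t _
    have hin : ∀ s ∈ Metric.closedBall t |h|, s ∈ Metric.closedBall t η := fun s hs =>
      Metric.closedBall_subset_closedBall (hh.le.trans (min_le_right _ _)) hs
    have hderiv : ∀ s ∈ Metric.closedBall t |h|,
        HasDerivWithinAt (fun s => f (s, y) - s • dt f (t, y)) (dt f (s, y) - dt f (t, y))
          (Metric.closedBall t |h|) s := by
      intro s hs
      have h1 := hasDerivAt_dt (hf (s, y) (hsub ⟨hin s hs, hy⟩)).differentiableAt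
      have h2 := (hasDerivAt_id s).smul_const (dt f (t, y))
      rw [one_smul] at h2
      exact (h1.sub h2).hasDerivWithinAt
    have hbd : ∀ s ∈ Metric.closedBall t |h|, ‖dt f (s, y) - dt f (t, y)‖ ≤ ε / 2 := by
      intro s hs
      rw [← dist_eq_norm]
      refine (hδ' (s, y) ⟨hin s hs, hy⟩ (t, y) ⟨Metric.mem_closedBall_self hη.le, hy⟩ ?_).le
      rw [Prod.dist_eq, dist_self, max_eq_left dist_nonneg]
      exact (Metric.mem_closedBall.1 hs).trans_lt (hh.trans_le (min_le_left _ _))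
    have hmv := hball.norm_image_sub_le_of_norm_hasDerivWithin_le hderiv hbd
      (Metric.mem_closedBall_self (abs_nonneg h)) (y := t + h) (by simp)
    have e1 : dt f (t, y) - h⁻¹ • (f (t + h, y) - f (t, y)) =
        -(h⁻¹ • (f (t + h, y) - (t + h) • dt f (t, y) - (f (t, y) - t • dt f (t, y)))) := by
      have : f (t + h, y) - (t + h) • dt f (t, y) - (f (t, y) - t • dt f (t, y)) =
          (f (t + h, y) - f (t, y)) - h • dt f (t, y) := by
        rw [add_smul]; abel
      rw [this, smul_sub _ _ (h • dt f (t, y)), smul_smul, inv_mul_cancel₀ h0', one_smul]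
      abel
    rw [dist_eq_norm, e1, norm_neg, norm_smul, norm_inv]
    rw [add_sub_cancel_left] at hmv
    have hpos : 0 < ‖h‖ := norm_pos_iff.2 h0'
    calc ‖h‖⁻¹ * _ ≤ ‖h‖⁻¹ * (ε / 2 * ‖h‖) := by gcongr
      _ = ε / 2 := by field_simp
      _ < ε := half_lt_self hε
  | succ m ih =>
    refine tendstoUniformlyOn_iteratedFDeriv_succ (A' := fun h y =>
      h⁻¹ • (dy f (t + h, y) - dy f (t, y))) (B' := fun y => dt (dy f) (t, y)) hO hKO ?_ ?_
      (ih fun z hz => (hf z hz).dy)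
    · filter_upwards [hshift] with h hh y hy
      exact (((hasFDerivAt_dy (hf (t + h, y) ⟨hh, hy⟩).differentiableAt).sub
        (hasFDerivAt_dy (hf (t, y) ⟨ht, hy⟩).differentiableAt)).const_smul h⁻¹).fderiv
    · intro y hy
      rw [dt_dy (hf (t, y) ⟨ht, hy⟩)]
      exact (hasFDerivAt_dy (hf (t, y) ⟨ht, hy⟩).dt.differentiableAt).fderiv

end SpaceTime

section ChangeOfCoordinates

variable {E E' F F' : Type*} [NormedAddCommGroup E] [NormedSpace ℝ E]
  [NormedAddCommGroup E'] [NormedSpace ℝ E']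
  [NormedAddCommGroup F] [NormedSpace ℝ F] [NormedAddCommGroup F'] [NormedSpace ℝ F']

lemma exists_bound_iteratedFDeriv {f : E → F} {Q K : Set E} (hQ : IsOpen Q)
    (hf : ContDiffOn ℝ ∞ f Q) (hK : IsCompact K) (hKQ : K ⊆ Q) (m : ℕ) :
    ∃ B ≥ 1, ∀ i ≤ m, ∀ y ∈ K, ‖iteratedFDerivWithin ℝ i f Q y‖ ≤ B := by
  have h1 : ∀ i : ℕ, ∃ B, ∀ y ∈ K, ‖iteratedFDerivWithin ℝ i f Q y‖ ≤ B := fun i =>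
    hK.exists_bound_of_continuousOn
      ((hf.continuousOn_iteratedFDerivWithin (by exact_mod_cast le_top)
        hQ.uniqueDiffOn).mono hKQ)
  choose B hB using h1
  refine ⟨1 + ∑ i ∈ Finset.range (m + 1), |B i|, ?_, fun i hi y hy => (hB i y hy).trans ?_⟩
  · have : 0 ≤ ∑ i ∈ Finset.range (m + 1), |B i| := Finset.sum_nonneg fun _ _ => abs_nonneg _
    linarith
  · have := Finset.single_le_sum (f := fun i => |B i|) (fun _ _ => abs_nonneg _)
      (Finset.mem_range_succ_iff.2 hi)
    have h2 := le_abs_self (B i)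
    linarith

/-- Smooth coordinate changes preserve uniform convergence to zero of all derivatives. -/
lemma eventually_norm_iteratedFDeriv_lt {ι : Type*} {l : Filter ι} {g : ι → E' → F}
    {Q K : Set E} {O : Set E'} (hQ : IsOpen Q) (hO : IsOpen O) (hK : IsCompact K) (hKQ : K ⊆ Q)
    {θ : E → E'} (hθ : ContDiffOn ℝ ∞ θ Q) (hθO : MapsTo θ Q O)
    {L : E → F →L[ℝ] F'} (hL : ContDiffOn ℝ ∞ L Q)
    (hg : ∀ᶠ i in l, ContDiffOn ℝ ∞ (g i) O)
    (h : ∀ m : ℕ, ∀ δ > 0, ∀ᶠ i in l, ∀ y ∈ O, ‖iteratedFDeriv ℝ m (g i) y‖ < δ)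
    (m : ℕ) {ε : ℝ} (hε : 0 < ε) :
    ∀ᶠ i in l, ∀ y ∈ K, ‖iteratedFDeriv ℝ m (fun y => L y (g i (θ y))) y‖ < ε := by
  obtain ⟨D, hD1, hD⟩ := exists_bound_iteratedFDeriv hQ hθ hK hKQ m
  obtain ⟨B, hB1, hB⟩ := exists_bound_iteratedFDeriv hQ hL hK hKQ m
  set C : ℝ := (∑ i ∈ Finset.range (m + 1), (m.choose i : ℝ)) * B * (m ! * D ^ m) with hC
  have hC0 : 0 ≤ C := by positivity
  set δ := ε / (C + 1) with hδdef
  have hδ : 0 < δ := by positivity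
  have hall : ∀ᶠ i in l, ∀ j ∈ Finset.range (m + 1), ∀ y ∈ O,
      ‖iteratedFDeriv ℝ j (g i) y‖ < δ :=
    (Filter.eventually_all_finset _).2 fun j _ => h j δ hδ
  filter_upwards [hall, hg] with i hi hgi y hy
  have hyQ := hKQ hy
  have hcomp : ∀ j ≤ m, ‖iteratedFDerivWithin ℝ j (g i ∘ θ) Q y‖ ≤ m ! * δ * D ^ m := by
    intro j hj
    refine (norm_iteratedFDerivWithin_comp_le (C := δ) (D := D) hgi hθ
      (by exact_mod_cast le_top) hO.uniqueDiffOn hQ.uniqueDiffOn hθO hyQ ?_ ?_).trans ?_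
    · intro k hk
      rw [iteratedFDerivWithin_of_isOpen k hO (hθO hyQ)]
      exact (hi k (Finset.mem_range_succ_iff.2 (hk.trans hj)) _ (hθO hyQ)).le
    · intro k hk1 hk
      exact (hD k (hk.trans hj) y hy).trans (le_self_pow₀ hD1 (by omega))
    · have h1 : (j ! : ℝ) ≤ m ! := by exact_mod_cast Nat.factorial_le hj
      gcongr
  rw [← iteratedFDerivWithin_of_isOpen m hQ hyQ]
  refine (norm_iteratedFDerivWithin_clm_apply (g := g i ∘ θ) hL (hgi.comp hθ hθO)
    hQ.uniqueDiffOn hyQ (by exact_mod_cast le_top)).trans_lt ?_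
  calc _ ≤ ∑ j ∈ Finset.range (m + 1), (m.choose j : ℝ) * B * (m ! * δ * D ^ m) := by
        refine Finset.sum_le_sum fun j hj => ?_
        have h1 := hB j (Finset.mem_range_succ_iff.1 hj) y hy
        have h2 := hcomp (m - j) (Nat.sub_le _ _)
        gcongr
    _ = C * δ := by
        rw [← Finset.sum_mul, ← Finset.sum_mul, hC]
        ring
    _ < ε := by
        rw [hδdef, mul_div_assoc', div_lt_iff₀ (by positivity)]
        nlinarith

end ChangeOfCoordinates

/-! ### Smooth sections in analytic charts and trivializations -/

set_option linter.unusedSectionVars false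

section Sections

universe u

variable {E F : Type u} [NormedAddCommGroup E] [NormedSpace ℝ E]
  [NormedAddCommGroup F] [NormedSpace ℝ F]
  {M : Type*} [TopologicalSpace M] [ChartedSpace E M]
  {V : M → Type*} [TopologicalSpace (TotalSpace F V)] [∀ x, TopologicalSpace (V x)]
  [FiberBundle F V]

lemma tendsto_smoothSection_iff {ι : Type*} {l : Filter ι} {f : ι → Cₛ^∞⟮𝓘(ℝ, E); F, V⟯}
    {f₀ : Cₛ^∞⟮𝓘(ℝ, E); F, V⟯} :
    Tendsto f l (𝓝 f₀) ↔ ∀ (x₀ : M) (k : ℕ), ∀ K ∈ chartCompacts (E := E) F V x₀,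
      TendstoUniformlyOn (fun i => iteratedFDeriv ℝ k
        (localRep (chartAt E x₀) (trivializationAt F V x₀) (fun x => f i x)))
        (iteratedFDeriv ℝ k
          (localRep (chartAt E x₀) (trivializationAt F V x₀) (fun x => f₀ x))) l K := by
  simp only [nhds_iInf, tendsto_iInf, nhds_induced, tendsto_comap_iff]
  refine forall_congr' fun x₀ => forall_congr' fun k => ?_
  rw [UniformOnFun.tendsto_iff_tendstoUniformlyOn]
  rfl

omit [ChartedSpace E M] in
lemma localRep_apply (u : OpenPartialHomeomorph M E) (v : Trivialization F (π F V))
    (f : ∀ x, V x) {x : M} (hx : x ∈ u.source) :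
    localRep u v f (u x) = (v (TotalSpace.mk' F x (f x))).2 :=
  congrArg (fun x => (v (TotalSpace.mk' F x (f x))).2) (u.left_inv hx)

variable [∀ x, AddCommGroup (V x)] [∀ x, Module ℝ (V x)]

omit [ChartedSpace E M] in
lemma localRep_linear (u : OpenPartialHomeomorph M E) (v : Trivialization F (π F V))
    [v.IsLinear ℝ] {y : E} (hy : u.symm y ∈ v.baseSet) (f g : ∀ x, V x) (a b : ℝ) :
    localRep u v (a • f + b • g) y = a • localRep u v f y + b • localRep u v g y := by
  have h := v.linear ℝ hy
  unfold localRep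
  rw [← h.map_smul, ← h.map_smul, ← h.map_add]
  rfl

omit [ChartedSpace E M] in
lemma localRep_sub (u : OpenPartialHomeomorph M E) (v : Trivialization F (π F V))
    [v.IsLinear ℝ] {y : E} (hy : u.symm y ∈ v.baseSet) (f g : ∀ x, V x) :
    localRep u v (f - g) y = localRep u v f y - localRep u v g y := by
  have := localRep_linear u v hy f g 1 (-1)
  simpa [sub_eq_add_neg] using this

omit [ChartedSpace E M] in
lemma localRep_smul (u : OpenPartialHomeomorph M E) (v : Trivialization F (π F V))
    [v.IsLinear ℝ] {y : E} (hy : u.symm y ∈ v.baseSet) (a : ℝ) (f : ∀ x, V x) :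
    localRep u v (a • f) y = a • localRep u v f y := by
  have := localRep_linear u v hy f f a 0
  simpa using this

omit [ChartedSpace E M] in
lemma localRep_sum (u : OpenPartialHomeomorph M E) (v : Trivialization F (π F V))
    [v.IsLinear ℝ] {y : E} (hy : u.symm y ∈ v.baseSet) {ι : Type*} (S : Finset ι)
    (f : ι → ∀ x, V x) :
    localRep u v (∑ i ∈ S, f i) y = ∑ i ∈ S, localRep u v (f i) y := by
  classical
  induction S using Finset.induction_on with
  | empty => simpa using localRep_smul u v hy 0 (0 : ∀ x, V x)
  | insert i S hi ih =>
    rw [Finset.sum_insert hi, Finset.sum_insert hi, ← ih]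
    simpa using localRep_linear u v hy (f i) (∑ i ∈ S, f i) 1 1

variable [VectorBundle ℝ F V]

lemma isAnalyticTrivialization_trivializationAt [ContMDiffVectorBundle ω F V 𝓘(ℝ, E)] (x₀ : M) :
    IsAnalyticTrivialization (E := E) (trivializationAt F V x₀) where
  linear := inferInstance
  analytic_toFun := Trivialization.contMDiffOn _
  analytic_symm := Trivialization.contMDiffOn_symm _

section

omit [VectorBundle ℝ F V]

variable {v : Trivialization F (π F V)}

/-- A map into the bundle is of class `C^k` if its base point and its fibre component in an
analytic trivialization are. -/
lemma IsAnalyticTrivialization.contMDiffAt_mk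
    (hv : IsAnalyticTrivialization (E := E) v) {k : ℕ∞ω}
    {EN HN N : Type*} [NormedAddCommGroup EN] [NormedSpace ℝ EN] [TopologicalSpace HN]
    {IN : ModelWithCorners ℝ EN HN} [TopologicalSpace N] [ChartedSpace HN N]
    {b : N → M} {f : ∀ q, V (b q)} {q : N} (hb : ContMDiffAt IN 𝓘(ℝ, E) k b q)
    (hq : b q ∈ v.baseSet)
    (hf : ContMDiffAt IN 𝓘(ℝ, F) k (fun q => (v (TotalSpace.mk' F (b q) (f q))).2) q) :
    ContMDiffAt IN (𝓘(ℝ, E).prod 𝓘(ℝ, F)) k (fun q => TotalSpace.mk' F (b q) (f q)) q := by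
  have hmem : (b q, (v (TotalSpace.mk' F (b q) (f q))).2) ∈ v.target := by
    rw [v.mem_target]
    exact hq
  have h1 := ((hv.analytic_symm.of_le (le_top : k ≤ ω)) _ hmem).contMDiffAt
    (v.open_target.mem_nhds hmem)
  have h2 := h1.comp q (hb.prodMk hf)
  refine h2.congr_of_eventuallyEq ?_
  filter_upwards [hb.continuousAt.eventually (v.open_baseSet.mem_nhds hq)] with q' hq'
  have hs : TotalSpace.mk' F (b q') (f q') ∈ v.source := v.mem_source.2 hq'
  exact (v.symm_apply_mk_proj hs).symm

/-- The fibre component, in an analytic trivialization, of a map into the bundle of class `C^k` is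
of class `C^k`. -/
lemma IsAnalyticTrivialization.contMDiffAt_snd
    (hv : IsAnalyticTrivialization (E := E) v) {k : ℕ∞ω}
    {EN HN N : Type*} [NormedAddCommGroup EN] [NormedSpace ℝ EN] [TopologicalSpace HN]
    {IN : ModelWithCorners ℝ EN HN} [TopologicalSpace N] [ChartedSpace HN N]
    {f : N → TotalSpace F V} {q : N} (hq : (f q).proj ∈ v.baseSet)
    (hf : ContMDiffAt IN (𝓘(ℝ, E).prod 𝓘(ℝ, F)) k f q) :
    ContMDiffAt IN 𝓘(ℝ, F) k (fun q => (v (f q)).2) q := by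
  have hs : f q ∈ v.source := v.mem_source.2 hq
  have h1 := ((hv.analytic_toFun.of_le (le_top : k ≤ ω)) _ hs).contMDiffAt
    (v.open_source.mem_nhds hs)
  exact (_root_.contMDiffAt_snd.comp _ h1).comp q hf

variable {u : OpenPartialHomeomorph M E}

lemma contDiffAt_localRep (hu : u ∈ IsManifold.maximalAtlas 𝓘(ℝ, E) ω M)
    (hv : IsAnalyticTrivialization (E := E) v) {k : ℕ∞ω} {f : ∀ x, V x} {y : E}
    (hy : y ∈ u.target) (hyv : u.symm y ∈ v.baseSet)
    (hf : ContMDiffAt 𝓘(ℝ, E) (𝓘(ℝ, E).prod 𝓘(ℝ, F)) k (fun x => TotalSpace.mk' F x (f x))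
      (u.symm y)) :
    ContDiffAt ℝ k (localRep u v f) y := by
  rw [← contMDiffAt_iff_contDiffAt]
  have h1 : ContMDiffAt 𝓘(ℝ, E) 𝓘(ℝ, E) k u.symm y :=
    ((contMDiffOn_symm_of_mem_maximalAtlas hu).of_le (le_top : k ≤ ω)).contMDiffAt
      (u.open_target.mem_nhds hy)
  exact hv.contMDiffAt_snd (f := fun y => TotalSpace.mk' F (u.symm y) (f (u.symm y))) hyv
    (hf.comp y h1)

lemma contMDiffAt_of_localRep (hu : u ∈ IsManifold.maximalAtlas 𝓘(ℝ, E) ω M)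
    (hv : IsAnalyticTrivialization (E := E) v) {k : ℕ∞ω} {f : ∀ x, V x} {x : M}
    (hx : x ∈ u.source) (hxv : x ∈ v.baseSet) (hf : ContDiffAt ℝ k (localRep u v f) (u x)) :
    ContMDiffAt 𝓘(ℝ, E) (𝓘(ℝ, E).prod 𝓘(ℝ, F)) k (fun x => TotalSpace.mk' F x (f x)) x := by
  refine hv.contMDiffAt_mk (b := fun x => x) contMDiffAt_id hxv ?_
  have h1 : ContMDiffAt 𝓘(ℝ, E) 𝓘(ℝ, E) k u x :=
    ((contMDiffOn_of_mem_maximalAtlas hu).of_le (le_top : k ≤ ω)).contMDiffAt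
      (u.open_source.mem_nhds hx)
  have h2 := (contMDiffAt_iff_contDiffAt.2 hf).comp x h1
  refine h2.congr_of_eventuallyEq ?_
  filter_upwards [u.open_source.mem_nhds hx] with x' hx'
  exact (localRep_apply u v f hx').symm

end

omit [ChartedSpace E M] [VectorBundle ℝ F V] in
/-- The change of trivialization on local components. -/
lemma localRep_eq_coordChangeL {u u' : OpenPartialHomeomorph M E}
    {v v' : Trivialization F (π F V)} [v.IsLinear ℝ] [v'.IsLinear ℝ] {y : E}
    (hy : u'.symm y ∈ u.source) (hv : u'.symm y ∈ v.baseSet) (hv' : u'.symm y ∈ v'.baseSet)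
    (f : ∀ x, V x) :
    localRep u' v' f y =
      v.coordChangeL ℝ v' (u'.symm y) (localRep u v f (u (u'.symm y))) := by
  rw [v.coordChangeL_apply v' ⟨hv, hv'⟩]
  rw [localRep_apply u v f hy, v.symm_apply_apply_mk hv]
  rfl

omit [VectorBundle ℝ F V] in
lemma contDiffOn_coordChangeL [FiniteDimensional ℝ F] {u' : OpenPartialHomeomorph M E}
    {v v' : Trivialization F (π F V)} [v.IsLinear ℝ] [v'.IsLinear ℝ]
    (hu' : u' ∈ IsManifold.maximalAtlas 𝓘(ℝ, E) ω M)
    (hv : IsAnalyticTrivialization (E := E) v) (hv' : IsAnalyticTrivialization (E := E) v') :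
    ContDiffOn ℝ ω (fun y => (v.coordChangeL ℝ v' (u'.symm y) : F →L[ℝ] F))
      (u'.target ∩ u'.symm ⁻¹' (v.baseSet ∩ v'.baseSet)) := by
  rw [contDiffOn_clm_apply]
  intro a y ⟨hy, hyv, hyv'⟩
  refine ContDiffAt.contDiffWithinAt ?_
  rw [← contMDiffAt_iff_contDiffAt]
  have h1 : ContMDiffAt 𝓘(ℝ, E) 𝓘(ℝ, E) ω u'.symm y :=
    (contMDiffOn_symm_of_mem_maximalAtlas hu').contMDiffAt (u'.open_target.mem_nhds hy)
  have hmem : (u'.symm y, a) ∈ v.target := v.mem_target.2 hyv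
  have h2 := (hv.analytic_symm _ hmem).contMDiffAt (v.open_target.mem_nhds hmem)
  have h3 := h2.comp y (h1.prodMk contMDiffAt_const)
  have h4 := hv'.contMDiffAt_snd (by
    simp only [Function.comp_apply]
    rw [v.proj_symm_apply hmem]
    exact hyv') h3
  refine h4.congr_of_eventuallyEq ?_
  filter_upwards [h1.continuousAt.eventually
    ((v.open_baseSet.inter v'.open_baseSet).mem_nhds ⟨hyv, hyv'⟩)] with y' hy'
  exact v.coordChangeL_apply' v' hy' a

/-- Convergence of smooth sections can be tested with the help of one chart and one trivialization
around each point. -/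
theorem tendsto_smoothSection_of_local [FiniteDimensional ℝ E] [FiniteDimensional ℝ F]
    [IsManifold 𝓘(ℝ, E) ω M] [ContMDiffVectorBundle ω F V 𝓘(ℝ, E)]
    {ι : Type*} {l : Filter ι} {f : ι → Cₛ^∞⟮𝓘(ℝ, E); F, V⟯} {f₀ : Cₛ^∞⟮𝓘(ℝ, E); F, V⟯}
    (h : ∀ p : M, ∃ (u : OpenPartialHomeomorph M E) (v : Trivialization F (π F V)) (O : Set E),
      u ∈ IsManifold.maximalAtlas 𝓘(ℝ, E) ω M ∧ IsAnalyticTrivialization (E := E) v ∧ IsOpen O ∧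
      p ∈ u.source ∧ u p ∈ O ∧ O ⊆ u.target ∧ MapsTo u.symm O v.baseSet ∧
      ∀ m : ℕ, TendstoUniformlyOn (fun i => iteratedFDeriv ℝ m (localRep u v fun x => f i x))
        (iteratedFDeriv ℝ m (localRep u v fun x => f₀ x)) l O) :
    Tendsto f l (𝓝 f₀) := by
  rw [tendsto_smoothSection_iff]
  intro x₀ m K ⟨hK, hKsub⟩
  set u' := chartAt E x₀
  set v' := trivializationAt F V x₀
  have hu' : u' ∈ IsManifold.maximalAtlas 𝓘(ℝ, E) ω M := IsManifold.chart_mem_maximalAtlas x₀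
  have hv' : IsAnalyticTrivialization (E := E) v' := isAnalyticTrivialization_trivializationAt x₀
  rw [← tendstoLocallyUniformlyOn_iff_tendstoUniformlyOn_of_compact hK,
    tendstoLocallyUniformlyOn_iff_forall_tendsto]
  intro y hy
  obtain ⟨x, ⟨hxu', hxv'⟩, rfl⟩ := hKsub hy
  obtain ⟨u, v, O, hu, hv, hO, hxu, hxO, hOu, hOv, hlim⟩ := h x
  have hlin := hv.linear
  have hlin' := hv'.linear
  have hleft : u'.symm (u' x) = x := u'.left_inv hxu'
  have hleft2 : u.symm (u x) = x := u.left_inv hxu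
  have hxv : x ∈ v.baseSet := by
    have := hOv hxO
    rwa [hleft2] at this
  -- an open set on which both sets of coordinates are available
  set θ : E → E := fun y => u (u'.symm y) with hθdef
  have hθat : ∀ y ∈ u'.target, u'.symm y ∈ u.source → ContDiffAt ℝ ω θ y := by
    intro y hy hyu
    rw [← contMDiffAt_iff_contDiffAt]
    have h1 : ContMDiffAt 𝓘(ℝ, E) 𝓘(ℝ, E) ω u'.symm y :=
      (contMDiffOn_symm_of_mem_maximalAtlas hu').contMDiffAt (u'.open_target.mem_nhds hy)
    have h2 : ContMDiffAt 𝓘(ℝ, E) 𝓘(ℝ, E) ω u (u'.symm y) :=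
      (contMDiffOn_of_mem_maximalAtlas hu).contMDiffAt (u.open_source.mem_nhds hyu)
    exact h2.comp y h1
  set S : Set M := (u.source ∩ u ⁻¹' O) ∩ v'.baseSet with hSdef
  have hS : IsOpen S := (u.isOpen_inter_preimage hO).inter v'.open_baseSet
  set Q : Set E := u'.target ∩ u'.symm ⁻¹' S with hQdef
  have hQ : IsOpen Q := u'.isOpen_inter_preimage_symm hS
  have hyQ : u' x ∈ Q := ⟨u'.map_source hxu', by rw [mem_preimage, hleft]; exact ⟨⟨hxu, hxO⟩, hxv'⟩⟩
  have hQv : ∀ y ∈ Q, u'.symm y ∈ v.baseSet := by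
    intro y hy
    have := hOv hy.2.1.2
    rwa [u.left_inv hy.2.1.1] at this
  obtain ⟨r, hr, hrQ⟩ := Metric.nhds_basis_closedBall.mem_iff.1 (hQ.mem_nhds hyQ)
  have hcomp : IsCompact (Metric.closedBall (u' x) r) := isCompact_closedBall _ _
  have hsec : ∀ g : Cₛ^∞⟮𝓘(ℝ, E); F, V⟯, ContDiffOn ℝ ∞ (localRep u v fun x => g x) O :=
    fun g y hy => (contDiffAt_localRep hu hv (hOu hy) (hOv hy)
      g.contMDiff.contMDiffAt).contDiffWithinAt
  have hsec' : ∀ g : Cₛ^∞⟮𝓘(ℝ, E); F, V⟯, ∀ y ∈ Q,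
      ContDiffAt ℝ ∞ (localRep u' v' fun x => g x) y :=
    fun g y hy => contDiffAt_localRep hu' hv' hy.1 hy.2.2 g.contMDiff.contMDiffAt
  have key := fun (ε : ℝ) (hε : 0 < ε) => eventually_norm_iteratedFDeriv_lt (l := l) (θ := θ)
    (L := fun y => (v.coordChangeL ℝ v' (u'.symm y) : F →L[ℝ] F))
    (g := fun i y => localRep u v (fun x => f i x) y - localRep u v (fun x => f₀ x) y)
    hQ hO hcomp hrQ
    (fun y hy => ((hθat y hy.1 hy.2.1.1).of_le le_top).contDiffWithinAt)
    (fun y hy => hy.2.1.2)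
    (((contDiffOn_coordChangeL hu' hv hv').of_le le_top).mono
      fun y hy => ⟨hy.1, hQv y hy, hy.2.2⟩)
    (Eventually.of_forall fun i => (hsec (f i)).sub (hsec f₀))
    (fun k δ hδ => by
      filter_upwards [Metric.tendstoUniformlyOn_iff.1 (hlim k) δ hδ] with i hi y hy
      have h1 := hi y hy
      rw [dist_comm, dist_eq_norm] at h1
      have hc1 : ContDiffAt ℝ k (localRep u v fun x => f i x) y :=
        ((hsec (f i)).contDiffAt (hO.mem_nhds hy)).of_le (by exact_mod_cast le_top)
      have hc2 : ContDiffAt ℝ k (localRep u v fun x => f₀ x) y :=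
        ((hsec f₀).contDiffAt (hO.mem_nhds hy)).of_le (by exact_mod_cast le_top)
      have h2 := iteratedFDeriv_sub_apply hc1 hc2
      change ‖iteratedFDeriv ℝ k ((localRep u v fun x => f i x) - localRep u v fun x => f₀ x) y‖ < δ
      rw [h2]
      exact h1)
    m hε
  have hunif : TendstoUniformlyOn (fun i => iteratedFDeriv ℝ m (localRep u' v' fun x => f i x))
      (iteratedFDeriv ℝ m (localRep u' v' fun x => f₀ x)) l (Metric.closedBall (u' x) r) := by
    rw [Metric.tendstoUniformlyOn_iff]
    intro ε hε
    filter_upwards [key ε hε] with i hi y hy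
    have hyQ := hrQ hy
    have hc1 : ContDiffAt ℝ m (localRep u' v' fun x => f i x) y :=
      (hsec' (f i) y hyQ).of_le (by exact_mod_cast le_top)
    have hc2 : ContDiffAt ℝ m (localRep u' v' fun x => f₀ x) y :=
      (hsec' f₀ y hyQ).of_le (by exact_mod_cast le_top)
    rw [dist_comm, dist_eq_norm, ← iteratedFDeriv_sub_apply hc1 hc2]
    have heq : ((localRep u' v' fun x => f i x) - localRep u' v' fun x => f₀ x) =ᶠ[𝓝 y]
        fun y => (v.coordChangeL ℝ v' (u'.symm y) : F →L[ℝ] F)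
          (localRep u v (fun x => f i x) (θ y) - localRep u v (fun x => f₀ x) (θ y)) := by
      filter_upwards [hQ.mem_nhds hyQ] with y' hy'
      rw [Pi.sub_apply, localRep_eq_coordChangeL hy'.2.1.1 (hQv y' hy') hy'.2.2,
        localRep_eq_coordChangeL hy'.2.1.1 (hQv y' hy') hy'.2.2, map_sub]
      rfl
    rw [(heq.iteratedFDeriv ℝ m).self_of_nhds]
    exact hi y hy
  have hpt := tendstoUniformlyOn_iff_tendsto.1 hunif
  refine hpt.mono_left (prod_mono_right _ ?_)
  rw [le_principal_iff]
  exact mem_nhdsWithin_of_mem_nhds (Metric.closedBall_mem_nhds _ hr)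

/-- Convergence of smooth sections implies pointwise convergence. -/
lemma tendsto_apply_of_tendsto_smoothSection {ι : Type*} {l : Filter ι}
    {f : ι → Cₛ^∞⟮𝓘(ℝ, E); F, V⟯} {f₀ : Cₛ^∞⟮𝓘(ℝ, E); F, V⟯} (h : Tendsto f l (𝓝 f₀))
    {v : Trivialization F (π F V)} [v.IsLinear ℝ] {x : M} (hx : x ∈ v.baseSet) :
    Tendsto (fun i => (v (TotalSpace.mk' F x (f i x))).2) l
      (𝓝 (v (TotalSpace.mk' F x (f₀ x))).2) := by
  set v' := trivializationAt F V x
  have hxv' : x ∈ v'.baseSet := FiberBundle.mem_baseSet_trivializationAt' x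
  have h1 := tendsto_smoothSection_iff.1 h x 0 {chartAt E x x} ⟨isCompact_singleton, by
    simpa using ⟨x, ⟨mem_chart_source E x, hxv'⟩, rfl⟩⟩
  rw [tendstoUniformlyOn_iteratedFDeriv_zero_iff] at h1
  have h2 := h1.tendsto_at (mem_singleton _)
  simp only [localRep_apply _ _ _ (mem_chart_source E x)] at h2
  have h3 := ((v'.coordChangeL ℝ v x : F →L[ℝ] F).continuous.tendsto _).comp h2
  have h4 : ∀ a : V x, (v'.coordChangeL ℝ v x : F →L[ℝ] F)
      (v' (TotalSpace.mk' F x a)).2 = (v (TotalSpace.mk' F x a)).2 := by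
    intro a
    change v'.coordChangeL ℝ v x (v' (TotalSpace.mk' F x a)).2 = _
    rw [v'.coordChangeL_apply v ⟨hxv', hx⟩]
    rw [v'.symm_apply_apply_mk hxv']
  rw [h4] at h3
  exact h3.congr fun i => h4 _

end Sections

/-! ### Uniqueness -/

section Comparison

universe u

variable {E F : Type u} [NormedAddCommGroup E] [NormedSpace ℝ E]
  [NormedAddCommGroup F] [NormedSpace ℝ F] [CompleteSpace F]

/-- Replacing a function by its Taylor polynomial in time changes the right-hand side of the
equation by a term of the order of the remainder. -/
lemma isBigO_comp_sub_comp_timeTaylor {W : ℝ × E → F} {y : E} (hW : AnalyticAt ℝ W (0, y))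
    {G : E × F × (E →L[ℝ] F) → F} (hG : AnalyticAt ℝ G (y, W (0, y), dy W (0, y)))
    {k : ℕ} (hk : k ≠ 0) :
    (fun t => G (y, W (t, y), dy W (t, y)) - G (y, timeTaylor W (Finset.range k) t y,
      fderiv ℝ (timeTaylor W (Finset.range k) t) y)) =O[𝓝 0] fun t : ℝ => t ^ k := by
  have hcont : ∀ {H : Type u} [NormedAddCommGroup H] [NormedSpace ℝ H] [CompleteSpace H]
      {f : ℝ × E → H}, AnalyticAt ℝ f (0, y) → Tendsto (fun t => f (t, y)) (𝓝 0) (𝓝 (f (0, y))) ∧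
      Tendsto (fun t => timeTaylor f (Finset.range k) t y) (𝓝 0) (𝓝 (f (0, y))) := by
    intro H _ _ _ f hf
    have h1 : Tendsto (fun t => f (t, y)) (𝓝 0) (𝓝 (f (0, y))) :=
      hf.continuousAt.tendsto.comp
        ((Continuous.prodMk_left y).tendsto (0 : ℝ))
    refine ⟨h1, ?_⟩
    have h2 : Tendsto (fun t : ℝ => t ^ k) (𝓝 0) (𝓝 0) :=
      (continuous_pow k).tendsto' _ _ (zero_pow hk)
    have h3 := (isBigO_sub_timeTaylor hf k).trans_tendsto h2
    simpa using h1.sub h3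
  obtain ⟨h1, h2⟩ := hcont hW
  obtain ⟨h3, h4⟩ := hcont hW.dy
  have h5 := hG.hasStrictFDerivAt.isBigO_sub.comp_tendsto
    ((tendsto_const_nhds.prodMk_nhds (h1.prodMk_nhds h3)).prodMk_nhds
      (tendsto_const_nhds.prodMk_nhds (h2.prodMk_nhds h4)))
  have h6 : (fun t => fderiv ℝ (timeTaylor W (Finset.range k) t) y) =
      fun t => timeTaylor (dy W) (Finset.range k) t y :=
    funext fun t => (dy_timeTaylor hW _ t).fderiv
  have h7 : ∀ t, fderiv ℝ (timeTaylor W (Finset.range k) t) y =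
      timeTaylor (dy W) (Finset.range k) t y := fun t => congrFun h6 t
  simp only [h7]
  refine h5.trans ?_
  refine Asymptotics.IsBigO.prod_left ?_ (Asymptotics.IsBigO.prod_left ?_ ?_)
  · simpa [Function.comp_def] using Asymptotics.isBigO_zero _ _
  · exact isBigO_sub_timeTaylor hW k
  · exact isBigO_sub_timeTaylor hW.dy k

/-- The derivatives in time at time `0` of an analytic solution of a first order equation are
determined by its initial values. -/
lemma dt_iterate_eq_of_eq {W₁ W₂ : ℝ × E → F} {U : Set E} (hU : IsOpen U)
    (h₁ : ∀ y ∈ U, AnalyticAt ℝ W₁ (0, y)) (h₂ : ∀ y ∈ U, AnalyticAt ℝ W₂ (0, y))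
    {G : E × F × (E →L[ℝ] F) → F}
    (hG : ∀ y ∈ U, AnalyticAt ℝ G (y, W₁ (0, y), dy W₁ (0, y)))
    (he₁ : ∀ y ∈ U, ∀ᶠ t in 𝓝 (0 : ℝ), dt W₁ (t, y) = G (y, W₁ (t, y), dy W₁ (t, y)))
    (he₂ : ∀ y ∈ U, ∀ᶠ t in 𝓝 (0 : ℝ), dt W₂ (t, y) = G (y, W₂ (t, y), dy W₂ (t, y)))
    (h0 : ∀ y ∈ U, W₁ (0, y) = W₂ (0, y)) (k : ℕ) :
    ∀ y ∈ U, dt^[k] W₁ (0, y) = dt^[k] W₂ (0, y) := by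
  induction k using Nat.strong_induction_on with
  | _ k ih =>
  rcases k with _ | k
  · exact h0
  intro y hy
  have hT : ∀ t, timeTaylor W₁ (Finset.range (k + 1)) t =ᶠ[𝓝 y]
      timeTaylor W₂ (Finset.range (k + 1)) t := by
    intro t
    filter_upwards [hU.mem_nhds hy] with x hx
    refine Finset.sum_congr rfl fun j hj => ?_
    rw [ih j (Finset.mem_range.1 hj) x hx]
  have hdy : dy W₁ (0, y) = dy W₂ (0, y) := by
    rw [← (hasFDerivAt_dy (h₁ y hy).differentiableAt).fderiv,
      ← (hasFDerivAt_dy (h₂ y hy).differentiableAt).fderiv]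
    refine Filter.EventuallyEq.fderiv_eq ?_
    filter_upwards [hU.mem_nhds hy] with x hx using h0 x hx
  have e1 := isBigO_comp_sub_comp_timeTaylor (h₁ y hy) (hG y hy) k.succ_ne_zero
  have e2 := isBigO_comp_sub_comp_timeTaylor (h₂ y hy)
    (by rw [← hdy, ← h0 y hy]; exact hG y hy) k.succ_ne_zero
  have e3 : (fun t => dt W₁ (t, y) - dt W₂ (t, y)) =O[𝓝 0] fun t : ℝ => t ^ (k + 1) := by
    refine (e1.sub e2).congr' ?_ EventuallyEq.rfl
    filter_upwards [he₁ y hy, he₂ y hy] with t ht₁ ht₂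
    rw [(hT t).fderiv_eq, (hT t).self_of_nhds, ht₁, ht₂]
    abel
  have ha : ∀ {W : ℝ × E → F}, AnalyticAt ℝ W (0, y) → AnalyticAt ℝ (fun t => W (t, y)) 0 :=
    fun hW => AnalyticAt.fun_comp (g := _) (f := fun t : ℝ => (t, y)) hW
      (analyticAt_id.prod analyticAt_const)
  have e4 := iteratedDeriv_eq_zero_of_isBigO ((ha (h₁ y hy).dt).sub (ha (h₂ y hy).dt)) e3
  rw [iteratedDeriv_sub (ha (h₁ y hy).dt).contDiffAt (ha (h₂ y hy).dt).contDiffAt,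
    iteratedDeriv_eq_dt_iterate (h₁ y hy).dt, iteratedDeriv_eq_dt_iterate (h₂ y hy).dt] at e4
  exact sub_eq_zero.1 e4

end Comparison

section Uniqueness

universe u

variable {E F : Type u} [NormedAddCommGroup E] [NormedSpace ℝ E]
  [NormedAddCommGroup F] [NormedSpace ℝ F]
  {M : Type*} [TopologicalSpace M] [ChartedSpace E M]
  {V : M → Type*} [TopologicalSpace (TotalSpace F V)] [∀ x, TopologicalSpace (V x)]
  [FiberBundle F V] [∀ x, AddCommGroup (V x)] [∀ x, Module ℝ (V x)] [VectorBundle ℝ F V]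

/-- A derivative in the `C^∞` topology is a derivative at each point. -/
lemma HasCurveDerivAt.hasDerivAt {c : ℝ → Cₛ^∞⟮𝓘(ℝ, E); F, V⟯} {c' : Cₛ^∞⟮𝓘(ℝ, E); F, V⟯}
    {t : ℝ} (h : HasCurveDerivAt c c' t) {v : Trivialization F (π F V)} [v.IsLinear ℝ] {x : M}
    (hx : x ∈ v.baseSet) :
    HasDerivAt (fun s => (v (TotalSpace.mk' F x (c s x))).2) (v (TotalSpace.mk' F x (c' x))).2
      t := by
  rw [hasDerivAt_iff_tendsto_slope_zero]
  refine (tendsto_apply_of_tendsto_smoothSection h hx).congr fun s => ?_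
  have hl := v.linear ℝ hx
  rw [← hl.map_sub, ← hl.map_smul]
  rfl

variable [FiniteDimensional ℝ F]

lemma IsAnalyticSolution.analyticAt_localRep
    {X : Cₛ^∞⟮𝓘(ℝ, E); F, V⟯ → Cₛ^∞⟮𝓘(ℝ, E); F, V⟯} {c₀ : Cₛ^∞⟮𝓘(ℝ, E); F, V⟯} {δ : ℝ}
    {c : ℝ → Cₛ^∞⟮𝓘(ℝ, E); F, V⟯} (hc : IsAnalyticSolution X c₀ δ c)
    {u : OpenPartialHomeomorph M E} {v : Trivialization F (π F V)}
    (hu : u ∈ IsManifold.maximalAtlas 𝓘(ℝ, E) ω M) (hv : IsAnalyticTrivialization (E := E) v)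
    {t : ℝ} (ht : t ∈ Ioo (-δ) δ) {y : E} (hy : y ∈ u.target) (hyv : u.symm y ∈ v.baseSet) :
    AnalyticAt ℝ (fun z : ℝ × E => localRep u v (fun x => c z.1 x) z.2) (t, y) := by
  have := FiniteDimensional.complete ℝ F
  rw [← analyticWithinAt_univ, ← contDiffWithinAt_omega_iff_analyticWithinAt, contDiffWithinAt_univ,
    ← contMDiffAt_iff_contDiffAt,
    modelWithCornersSelf_prod, ← chartedSpaceSelf_prod]
  have h1 : ContMDiffAt (𝓘(ℝ, ℝ).prod 𝓘(ℝ, E)) (𝓘(ℝ, ℝ).prod 𝓘(ℝ, E)) ω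
      (fun z : ℝ × E => (z.1, u.symm z.2)) (t, y) := by
    refine contMDiffAt_fst.prodMk ?_
    have h2 : ContMDiffAt 𝓘(ℝ, E) 𝓘(ℝ, E) ω u.symm y :=
      (contMDiffOn_symm_of_mem_maximalAtlas hu).contMDiffAt (u.open_target.mem_nhds hy)
    exact ContMDiffAt.comp (t, y) h2 contMDiffAt_snd
  have h3 := (hc.analytic (t, u.symm y) ⟨ht, mem_univ _⟩).contMDiffAt
    ((isOpen_Ioo.prod isOpen_univ).mem_nhds ⟨ht, mem_univ _⟩)
  have h4 := ContMDiffAt.comp (t, y) h3 h1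
  exact hv.contMDiffAt_snd (HN := ModelProd ℝ E) hyv h4

/-- Two real analytic solutions of the initial value problem on the same interval agree. -/
theorem IsAnalyticSolution.eqOn
    {X : Cₛ^∞⟮𝓘(ℝ, E); F, V⟯ → Cₛ^∞⟮𝓘(ℝ, E); F, V⟯} (hX : IsAnalyticFirstOrderDiffOp X)
    {c₀ : Cₛ^∞⟮𝓘(ℝ, E); F, V⟯} {δ : ℝ} {c₁ c₂ : ℝ → Cₛ^∞⟮𝓘(ℝ, E); F, V⟯}
    (h₁ : IsAnalyticSolution X c₀ δ c₁) (h₂ : IsAnalyticSolution X c₀ δ c₂) :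
    EqOn c₁ c₂ (Ioo (-δ) δ) := by
  have := FiniteDimensional.complete ℝ F
  intro t ht
  have h0 : (0 : ℝ) ∈ Ioo (-δ) δ := by
    have : -δ < δ := ht.1.trans ht.2
    constructor <;> linarith
  refine ContMDiffSection.ext fun x => ?_
  obtain ⟨u, v, D, G, hxu, hu, huv, hv, hD, hG, hXG⟩ := hX x
  have := hv.linear
  have hbase : ∀ y ∈ u.target, u.symm y ∈ v.baseSet := fun y hy => huv (u.map_target hy)
  have hsrc : ∀ y ∈ u.target, u.symm y ∈ u.source := fun y hy => u.map_target hy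
  set rep : (ℝ → Cₛ^∞⟮𝓘(ℝ, E); F, V⟯) → ℝ × E → F :=
    fun c z => localRep u v (fun x => c z.1 x) z.2 with hrep
  have han : ∀ {c}, IsAnalyticSolution X c₀ δ c → ∀ s ∈ Ioo (-δ) δ, ∀ y ∈ u.target,
      AnalyticAt ℝ (rep c) (s, y) := fun hc s hs y hy =>
    hc.analyticAt_localRep hu hv hs hy (hbase y hy)
  have hdy : ∀ {c}, IsAnalyticSolution X c₀ δ c → ∀ s ∈ Ioo (-δ) δ, ∀ y ∈ u.target,
      fderiv ℝ (localRep u v fun x => c s x) y = dy (rep c) (s, y) := fun hc s hs y hy =>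
    (hasFDerivAt_dy (han hc s hs y hy).differentiableAt).fderiv
  have hD' : ∀ {c}, IsAnalyticSolution X c₀ δ c → ∀ s ∈ Ioo (-δ) δ, ∀ y ∈ u.target,
      (y, rep c (s, y), dy (rep c) (s, y)) ∈ D := by
    intro c hc s hs y hy
    have := (hXG (c s) _ (hsrc y hy)).1
    rw [u.right_inv hy, hdy hc s hs y hy] at this
    exact this
  have heq : ∀ {c}, IsAnalyticSolution X c₀ δ c → ∀ s ∈ Ioo (-δ) δ, ∀ y ∈ u.target,
      dt (rep c) (s, y) = G (y, rep c (s, y), dy (rep c) (s, y)) := by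
    intro c hc s hs y hy
    have e1 := (hXG (c s) _ (hsrc y hy)).2
    rw [u.right_inv hy, hdy hc s hs y hy] at e1
    have e2 := (hc.deriv_eq s hs).hasDerivAt (hbase y hy)
    have e3 := hasDerivAt_dt (han hc s hs y hy).differentiableAt
    rw [e3.unique e2]
    exact e1
  have hev : ∀ᶠ s in 𝓝 (0 : ℝ), s ∈ Ioo (-δ) δ := isOpen_Ioo.mem_nhds h0
  have hcoef := dt_iterate_eq_of_eq u.open_target (han h₁ 0 h0) (han h₂ 0 h0)
    (fun y hy => hG _ (hD' h₁ 0 h0 y hy))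
    (fun y hy => hev.mono fun s hs => heq h₁ s hs y hy)
    (fun y hy => hev.mono fun s hs => heq h₂ s hs y hy)
    (fun y hy => by simp only [hrep, h₁.initial, h₂.initial])
  have hux : u x ∈ u.target := u.map_source hxu
  have hline : ∀ {c}, IsAnalyticSolution X c₀ δ c →
      AnalyticOnNhd ℝ (fun s => rep c (s, u x)) (Ioo (-δ) δ) := fun hc s hs =>
    AnalyticAt.fun_comp (f := fun s : ℝ => (s, u x)) (han hc s hs _ hux)
      (analyticAt_id.prod analyticAt_const)
  have key := eqOn_of_iteratedDeriv_eq (hline h₁) (hline h₂) (fun k => by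
    rw [iteratedDeriv_eq_dt_iterate (han h₁ 0 h0 _ hux),
      iteratedDeriv_eq_dt_iterate (han h₂ 0 h0 _ hux)]
    exact hcoef k _ hux) ht
  simp only [hrep, localRep_apply u v _ hxu] at key
  rw [← v.symm_apply_apply_mk (huv hxu) (c₁ t x), key, v.symm_apply_apply_mk (huv hxu)]

end Uniqueness

/-! ### Local solutions on a common time interval -/

section LocalSolutions

universe u

lemma dt_iterate_clm_comp {E F F' : Type u} [NormedAddCommGroup E] [NormedSpace ℝ E]
    [NormedAddCommGroup F] [NormedSpace ℝ F] [CompleteSpace F]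
    [NormedAddCommGroup F'] [NormedSpace ℝ F'] (L : F →L[ℝ] F')
    {f : ℝ × E → F} {z : ℝ × E} (hf : AnalyticAt ℝ f z) (k : ℕ) :
    dt^[k] (fun z => L (f z)) z = L (dt^[k] f z) := by
  induction k generalizing f with
  | zero => rfl
  | succ k ih =>
    rw [Function.iterate_succ_apply, Function.iterate_succ_apply, ← ih hf.dt]
    refine (dt_iterate_congr ?_ k).self_of_nhds
    filter_upwards [hf.eventually_analyticAt] with z hz
    have h := (L.hasFDerivAt (x := f z)).comp z hz.differentiableAt.hasFDerivAt
    simp only [dt]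
    rw [show (fun z => L (f z)) = L ∘ f from rfl, h.fderiv]
    rfl

variable {E F : Type u} [NormedAddCommGroup E] [NormedSpace ℝ E]
  [NormedAddCommGroup F] [NormedSpace ℝ F]
  {M : Type*} [TopologicalSpace M] [ChartedSpace E M]
  {V : M → Type*} [TopologicalSpace (TotalSpace F V)] [∀ x, TopologicalSpace (V x)]
  [FiberBundle F V] [∀ x, AddCommGroup (V x)] [∀ x, Module ℝ (V x)]

/-- A real analytic solution `w` of the initial value problem near the point `x` and on the time
interval `(-ε, ε)`, in a chart `u` and a trivialization `v`. The set `O` is the region of space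
covered by it, in the coordinates `u`; the Taylor series of `w` in time converges there uniformly,
together with all space derivatives. -/
structure LocalSolution (X : Cₛ^∞⟮𝓘(ℝ, E); F, V⟯ → Cₛ^∞⟮𝓘(ℝ, E); F, V⟯)
    (c₀ : Cₛ^∞⟮𝓘(ℝ, E); F, V⟯) (ε : ℝ) (x : M) where
  u : OpenPartialHomeomorph M E
  v : Trivialization F (π F V)
  D : Set (E × F × (E →L[ℝ] F))
  G : E × F × (E →L[ℝ] F) → F
  O : Set E
  w : ℝ × E → F
  mem_atlas : u ∈ IsManifold.maximalAtlas 𝓘(ℝ, E) ω M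
  source_subset : u.source ⊆ v.baseSet
  isAnalytic : IsAnalyticTrivialization (E := E) v
  analyticOnNhd_G : AnalyticOnNhd ℝ G D
  operator_eq : ∀ (c : Cₛ^∞⟮𝓘(ℝ, E); F, V⟯), ∀ q ∈ u.source,
    localRep u v (fun x => X c x) (u q) =
      G (u q, localRep u v (fun x => c x) (u q), fderiv ℝ (localRep u v (fun x => c x)) (u q))
  isOpen_O : IsOpen O
  subset_target : O ⊆ u.target
  mem_source : x ∈ u.source
  mem_O : u x ∈ O
  analyticOnNhd_w : AnalyticOnNhd ℝ w (Ioo (-ε) ε ×ˢ O)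
  initial : ∀ y ∈ O, w (0, y) = localRep u v (fun x => c₀ x) y
  jet_mem : ∀ z ∈ Ioo (-ε) ε ×ˢ O, (z.2, w z, dy w z) ∈ D
  dt_eq : ∀ z ∈ Ioo (-ε) ε ×ˢ O, dt w z = G (z.2, w z, dy w z)
  tendsto_timeTaylor : ∀ t ∈ Ioo (-ε) ε, ∀ m : ℕ,
    TendstoUniformlyOn (fun S => iteratedFDeriv ℝ m (timeTaylor w S t))
      (iteratedFDeriv ℝ m fun y => w (t, y)) atTop O

namespace LocalSolution

variable {X : Cₛ^∞⟮𝓘(ℝ, E); F, V⟯ → Cₛ^∞⟮𝓘(ℝ, E); F, V⟯} {c₀ : Cₛ^∞⟮𝓘(ℝ, E); F, V⟯} {ε : ℝ} {x : M}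

/-- The same local solution, on a shorter time interval and around another point. -/
def restrict (s : LocalSolution X c₀ ε x) {δ : ℝ} (hδ : δ ≤ ε) {x' : M} (hx' : x' ∈ s.u.source)
    (hx'O : s.u x' ∈ s.O) : LocalSolution X c₀ δ x' where
  __ := s
  mem_source := hx'
  mem_O := hx'O
  analyticOnNhd_w := s.analyticOnNhd_w.mono
    (prod_mono (Ioo_subset_Ioo (neg_le_neg hδ) hδ) Subset.rfl)
  jet_mem := fun z hz => s.jet_mem z (prod_mono (Ioo_subset_Ioo (neg_le_neg hδ) hδ) Subset.rfl hz)
  dt_eq := fun z hz => s.dt_eq z (prod_mono (Ioo_subset_Ioo (neg_le_neg hδ) hδ) Subset.rfl hz)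
  tendsto_timeTaylor := fun t ht => s.tendsto_timeTaylor t (Ioo_subset_Ioo (neg_le_neg hδ) hδ ht)

variable [FiniteDimensional ℝ E] [FiniteDimensional ℝ F]

/-- The local solution around one point. The radius of the region is chosen less than half the
radius of convergence, so that the Taylor series can be expanded at each point of the region. -/
lemma exists_of_isAnalyticFirstOrderDiffOp (hX : IsAnalyticFirstOrderDiffOp X)
    (hc₀ : IsAnalyticSection c₀) (x : M) : ∃ ε > 0, Nonempty (LocalSolution X c₀ ε x) := by
  have := FiniteDimensional.complete ℝ F
  obtain ⟨u, v, D, G, hxu, hu, huv, hv, hD, hG, hXG⟩ := hX x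
  have hbase : ∀ y ∈ u.target, u.symm y ∈ v.baseSet := fun y hy => huv (u.map_target hy)
  have hux := u.map_source hxu
  set f := localRep u v fun x => c₀ x with hf
  have hfa : AnalyticAt ℝ f (u x) := by
    rw [← analyticWithinAt_univ, ← contDiffWithinAt_omega_iff_analyticWithinAt,
      contDiffWithinAt_univ]
    exact contDiffAt_localRep hu hv hux (hbase _ hux) hc₀.contMDiffAt
  have hfD : (u x, f (u x), fderiv ℝ f (u x)) ∈ D := (hXG c₀ x hxu).1
  obtain ⟨w, hw, hw0, hwG⟩ := exists_local_solution hfa (hG _ hfD)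
  have hdy : dy w (0, u x) = fderiv ℝ f (u x) := by
    rw [← (hasFDerivAt_dy hw.differentiableAt).fderiv]
    exact congrArg (fun g => fderiv ℝ g (u x)) (funext hw0)
  have hcont : ContinuousAt (fun z : ℝ × E => (z.2, w z, dy w z)) (0, u x) :=
    continuousAt_snd.prodMk (hw.continuousAt.prodMk hw.dy.continuousAt)
  have hjet : ∀ᶠ z in 𝓝 ((0 : ℝ), u x), (z.2, w z, dy w z) ∈ D :=
    hcont.eventually (hD.mem_nhds (by simpa only [hw0, hdy] using hfD))
  have htgt : ∀ᶠ z in 𝓝 ((0 : ℝ), u x), z.2 ∈ u.target :=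
    continuousAt_snd.eventually (u.open_target.mem_nhds hux)
  obtain ⟨ρ, hρ, hball⟩ := Metric.eventually_nhds_iff_ball.1
    ((hw.eventually_analyticAt.and hwG).and (hjet.and htgt))
  obtain ⟨p, R, hp⟩ := hw
  obtain ⟨r, hr0, hr⟩ : ∃ r : NNReal, 0 < r ∧ (r + r : ENNReal) < min R (ENNReal.ofReal ρ) := by
    have hpos : 0 < min R (ENNReal.ofReal ρ) := lt_min hp.r_pos (by simpa using hρ)
    obtain ⟨q, hq0, hq⟩ := ENNReal.lt_iff_exists_nnreal_btwn.1 hpos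
    refine ⟨q / 2, by simpa using hq0, ?_⟩
    rw [← ENNReal.coe_add, add_halves]
    exact hq
  have hrρ : (r : ℝ) < ρ := by
    have h1 : (r : ENNReal) < ENNReal.ofReal ρ :=
      (le_add_right le_rfl).trans_lt (hr.trans_le (min_le_right _ _))
    rw [← ENNReal.ofReal_coe_nnreal] at h1
    exact (ENNReal.ofReal_lt_ofReal_iff hρ).1 h1
  have hsub : ∀ z ∈ Ioo (-(r : ℝ)) r ×ˢ Metric.ball (u x) r, z ∈ Metric.ball ((0 : ℝ), u x) ρ := by
    rintro ⟨t, y⟩ ⟨ht, hy⟩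
    rw [← ball_prod_same]
    refine ⟨?_, Metric.ball_subset_ball hrρ.le hy⟩
    rw [Metric.mem_ball, Real.dist_eq, sub_zero, abs_lt]
    exact ⟨by linarith [ht.1], ht.2.trans hrρ⟩
  have h0r : (0 : ℝ) ∈ Ioo (-(r : ℝ)) r := ⟨by simpa using hr0, by exact_mod_cast hr0⟩
  exact ⟨r, by exact_mod_cast hr0, ⟨{
    u := u
    v := v
    D := D
    G := G
    O := Metric.ball (u x) r
    w := w
    mem_atlas := hu
    source_subset := huv
    isAnalytic := hv
    analyticOnNhd_G := hG
    operator_eq := fun c q hq => (hXG c q hq).2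
    isOpen_O := Metric.isOpen_ball
    subset_target := fun y hy => (hball _ (hsub (0, y) ⟨h0r, hy⟩)).2.2
    mem_source := hxu
    mem_O := Metric.mem_ball_self (by exact_mod_cast hr0)
    analyticOnNhd_w := fun z hz => (hball z (hsub z hz)).1.1
    initial := fun y _ => hw0 y
    jet_mem := fun z hz => (hball z (hsub z hz)).2.1
    dt_eq := fun z hz => (hball z (hsub z hz)).1.2
    tendsto_timeTaylor := fun t ht m => tendstoUniformlyOn_iteratedFDeriv_timeTaylor
      (hr.trans_le (min_le_left _ _)) (abs_le.2 ⟨ht.1.le, ht.2.le⟩) m hp }⟩⟩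

/-- By compactness, there are local solutions around all points on a common time interval. -/
lemma exists_forall_nonempty [CompactSpace M] (hX : IsAnalyticFirstOrderDiffOp X)
    (hc₀ : IsAnalyticSection c₀) : ∃ ε > 0, ∀ x, Nonempty (LocalSolution X c₀ ε x) := by
  suffices h : ∃ ε > 0, ∀ x ∈ (univ : Set M), Nonempty (LocalSolution X c₀ ε x) by simpa using h
  refine isCompact_univ.induction_on (p := fun S : Set M =>
    ∃ ε > 0, ∀ x ∈ S, Nonempty (LocalSolution X c₀ ε x)) ⟨1, one_pos, by simp⟩ ?_ ?_ ?_
  · rintro S T hST ⟨ε, hε, h⟩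
    exact ⟨ε, hε, fun x hx => h x (hST hx)⟩
  · rintro S T ⟨ε₁, hε₁, h₁⟩ ⟨ε₂, hε₂, h₂⟩
    refine ⟨min ε₁ ε₂, lt_min hε₁ hε₂, fun x hx => ?_⟩
    rcases hx with hx | hx
    · obtain ⟨s⟩ := h₁ x hx
      exact ⟨s.restrict (min_le_left _ _) s.mem_source s.mem_O⟩
    · obtain ⟨s⟩ := h₂ x hx
      exact ⟨s.restrict (min_le_right _ _) s.mem_source s.mem_O⟩
  · intro x _
    obtain ⟨ε, hε, ⟨s⟩⟩ := exists_of_isAnalyticFirstOrderDiffOp hX hc₀ x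
    refine ⟨s.u.source ∩ s.u ⁻¹' s.O, mem_nhdsWithin_of_mem_nhds
      ((s.u.isOpen_inter_preimage s.isOpen_O).mem_nhds ⟨s.mem_source, s.mem_O⟩), ε, hε, ?_⟩
    exact fun x' hx' => ⟨s.restrict le_rfl hx'.1 hx'.2⟩

end LocalSolution

end LocalSolutions

/-! ### The global solution -/

section GlobalSolution

universe u

variable {E F : Type u} [NormedAddCommGroup E] [NormedSpace ℝ E]
  [NormedAddCommGroup F] [NormedSpace ℝ F]
  {M : Type*} [TopologicalSpace M] [ChartedSpace E M]
  {V : M → Type*} [TopologicalSpace (TotalSpace F V)] [∀ x, TopologicalSpace (V x)]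
  [FiberBundle F V] [∀ x, AddCommGroup (V x)] [∀ x, Module ℝ (V x)]
  {X : Cₛ^∞⟮𝓘(ℝ, E); F, V⟯ → Cₛ^∞⟮𝓘(ℝ, E); F, V⟯} {c₀ : Cₛ^∞⟮𝓘(ℝ, E); F, V⟯} {ε : ℝ}

namespace LocalSolution

/-- The `k`-th time derivatives at time `t` of a family of local solutions, each evaluated at the
point around which it is defined: a set-theoretic section, which does not involve any gluing. -/
def value (s : ∀ x, LocalSolution X c₀ ε x) (k : ℕ) (t : ℝ) (x : M) : V x :=
  (s x).v.symm x (dt^[k] (s x).w (t, (s x).u x))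

/-- The `k`-th time derivatives of the local solutions agree at time `t` on the common parts of
their domains. -/
def Compatible (s : ∀ x, LocalSolution X c₀ ε x) (k : ℕ) (t : ℝ) : Prop :=
  ∀ p x, x ∈ (s p).u.source → (s p).u x ∈ (s p).O →
    ((s p).v (TotalSpace.mk' F x (value s k t x))).2 = dt^[k] (s p).w (t, (s p).u x)

variable {s : ∀ x, LocalSolution X c₀ ε x}

lemma symm_mem_source (p : M) {y : E} (hy : y ∈ (s p).O) : (s p).u.symm y ∈ (s p).u.source :=
  (s p).u.map_target ((s p).subset_target hy)

lemma symm_mem_baseSet (p : M) {y : E} (hy : y ∈ (s p).O) : (s p).u.symm y ∈ (s p).v.baseSet :=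
  (s p).source_subset (symm_mem_source p hy)

lemma Compatible.localRep_value {k : ℕ} {t : ℝ} (h : Compatible s k t) (p : M) {y : E}
    (hy : y ∈ (s p).O) :
    localRep (s p).u (s p).v (value s k t) y = dt^[k] (s p).w (t, y) := by
  have hr := (s p).u.right_inv ((s p).subset_target hy)
  have := h p _ (symm_mem_source p hy) (by rwa [hr])
  rwa [hr] at this

lemma Compatible.contMDiff_value [CompleteSpace F] {k : ℕ} {t : ℝ} (h : Compatible s k t)
    (ht : t ∈ Ioo (-ε) ε) :
    ContMDiff 𝓘(ℝ, E) (𝓘(ℝ, E).prod 𝓘(ℝ, F)) ∞ (fun x => TotalSpace.mk' F x (value s k t x)) := by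
  intro x
  refine contMDiffAt_of_localRep (s x).mem_atlas (s x).isAnalytic (s x).mem_source
    ((s x).source_subset (s x).mem_source) ?_
  have ha : AnalyticAt ℝ (fun y => dt^[k] (s x).w (t, y)) ((s x).u x) :=
    AnalyticAt.fun_comp (f := fun y : E => (t, y))
      (((s x).analyticOnNhd_w _ ⟨ht, (s x).mem_O⟩).dt_iterate k)
      (analyticAt_const.prod analyticAt_id)
  refine ha.contDiffAt.congr_of_eventuallyEq ?_
  filter_upwards [(s x).isOpen_O.mem_nhds (s x).mem_O] with y hy using h.localRep_value x hy

variable (s) in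
open Classical in
/-- The section formed by the `k`-th time derivatives at time `t` of the local solutions, if they
are compatible, and otherwise the section `c₀`, which plays no role. -/
def globalSection (k : ℕ) (t : ℝ) : Cₛ^∞⟮𝓘(ℝ, E); F, V⟯ :=
  if h : ContMDiff 𝓘(ℝ, E) (𝓘(ℝ, E).prod 𝓘(ℝ, F)) ∞
    (fun x => TotalSpace.mk' F x (value s k t x)) then ⟨value s k t, h⟩ else c₀

lemma Compatible.localRep_globalSection [CompleteSpace F] {k : ℕ} {t : ℝ} (h : Compatible s k t)
    (ht : t ∈ Ioo (-ε) ε) (p : M) {y : E} (hy : y ∈ (s p).O) :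
    localRep (s p).u (s p).v (fun x => globalSection s k t x) y = dt^[k] (s p).w (t, y) := by
  rw [globalSection, dif_pos (h.contMDiff_value ht)]
  exact h.localRep_value p hy

variable [VectorBundle ℝ F V]

/-- The Taylor polynomials of the local solutions fit together to a smooth section, as far as their
coefficients do. -/
lemma localRep_taylor [CompleteSpace F] (h0 : (0 : ℝ) ∈ Ioo (-ε) ε) (S : Finset ℕ)
    (h : ∀ k ∈ S, Compatible s k 0) (t : ℝ) (p : M) {y : E} (hy : y ∈ (s p).O) :
    localRep (s p).u (s p).v
      (fun x => (∑ k ∈ S, (t ^ k / (k ! : ℝ)) • globalSection s k 0) x) y =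
      timeTaylor (s p).w S t y := by
  have := (s p).isAnalytic.linear
  have hco : (fun x => (∑ k ∈ S, (t ^ k / (k ! : ℝ)) • globalSection s k 0) x) =
      ∑ k ∈ S, (t ^ k / (k ! : ℝ)) • fun x => globalSection s k 0 x :=
    map_sum (ContMDiffSection.coeAddHom 𝓘(ℝ, E) F ∞ V) _ S
  rw [hco, localRep_sum _ _ (symm_mem_baseSet p hy)]
  refine Finset.sum_congr rfl fun k hk => ?_
  rw [localRep_smul _ _ (symm_mem_baseSet p hy), (h k hk).localRep_globalSection h0 p hy]

variable [FiniteDimensional ℝ E] [FiniteDimensional ℝ F]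

/-- Compatibility in terms of the coordinate change between the trivializations. -/
lemma coordChangeL_dt_iterate {k : ℕ} {t : ℝ} {p x : M}
    (hx : x ∈ (s p).u.source)
    [(s x).v.IsLinear ℝ] [(s p).v.IsLinear ℝ] :
    ((s x).v.coordChangeL ℝ (s p).v x : F →L[ℝ] F) (dt^[k] (s x).w (t, (s x).u x)) =
      ((s p).v (TotalSpace.mk' F x (value s k t x))).2 :=
  (s x).v.coordChangeL_apply (s p).v
    ⟨(s x).source_subset (s x).mem_source, (s p).source_subset hx⟩ _

/-- The time derivatives at time `0` of the local solutions are compatible. By induction, those of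
order up to `k` are the values of global sections, hence so is the Taylor polynomial of order `k`
of the solution. The operator `X` is defined on global sections, and applied to this polynomial it
gives the time derivative of each local solution up to terms of order `t ^ (k + 1)`. -/
theorem compatible_zero (s : ∀ x, LocalSolution X c₀ ε x) (h0 : (0 : ℝ) ∈ Ioo (-ε) ε) (k : ℕ) :
    Compatible s k 0 := by
  have := FiniteDimensional.complete ℝ F
  induction k using Nat.strong_induction_on with
  | _ k ih =>
  rcases k with _ | k
  · intro p x hx hxO
    have hxx := (s x).source_subset (s x).mem_source
    have h1 : value s 0 0 x = c₀ x := by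
      rw [value, Function.iterate_zero, id, (s x).initial _ (s x).mem_O,
        localRep_apply _ _ _ (s x).mem_source, (s x).v.symm_apply_apply_mk hxx]
    rw [h1, Function.iterate_zero, id, (s p).initial _ hxO, localRep_apply _ _ _ hx]
  -- the Taylor polynomial of order `k`, as a polynomial with values in the smooth sections
  set γ : ℝ → Cₛ^∞⟮𝓘(ℝ, E); F, V⟯ := fun t =>
    ∑ j ∈ Finset.range (k + 1), (t ^ j / (j ! : ℝ)) • globalSection s j 0 with hγ
  have hrep : ∀ (t : ℝ) (p : M), ∀ y ∈ (s p).O,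
      localRep (s p).u (s p).v (fun x => γ t x) y =
        timeTaylor (s p).w (Finset.range (k + 1)) t y := fun t p y hy =>
    localRep_taylor h0 _ (fun j hj => ih j (Finset.mem_range.1 hj)) t p hy
  have hO : ∀ p x, x ∈ (s p).u.source → (s p).u x ∈ (s p).O →
      (fun t => dt (s p).w (t, (s p).u x) - ((s p).v (TotalSpace.mk' F x (X (γ t) x))).2)
        =O[𝓝 0] fun t : ℝ => t ^ (k + 1) := by
    intro p x hx hxO
    have hmem : ((0 : ℝ), (s p).u x) ∈ Ioo (-ε) ε ×ˢ (s p).O := ⟨h0, hxO⟩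
    refine (isBigO_comp_sub_comp_timeTaylor ((s p).analyticOnNhd_w _ hmem)
      ((s p).analyticOnNhd_G _ ((s p).jet_mem _ hmem)) k.succ_ne_zero).congr' ?_ EventuallyEq.rfl
    filter_upwards [isOpen_Ioo.mem_nhds h0] with t ht
    have hev : localRep (s p).u (s p).v (fun x => γ t x) =ᶠ[𝓝 ((s p).u x)]
        timeTaylor (s p).w (Finset.range (k + 1)) t := by
      filter_upwards [(s p).isOpen_O.mem_nhds hxO] with y hy using hrep t p y hy
    rw [(s p).dt_eq (t, (s p).u x) ⟨ht, hxO⟩, ← localRep_apply (s p).u (s p).v _ hx,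
      (s p).operator_eq _ _ hx, hev.fderiv_eq, hev.self_of_nhds]
  intro p x hx hxO
  have hlp := (s p).isAnalytic.linear
  have hlx := (s x).isAnalytic.linear
  have hxb : x ∈ (s x).v.baseSet ∩ (s p).v.baseSet :=
    ⟨(s x).source_subset (s x).mem_source, (s p).source_subset hx⟩
  rw [← coordChangeL_dt_iterate hx]
  set L : F →L[ℝ] F := ((s x).v.coordChangeL ℝ (s p).v x : F →L[ℝ] F) with hL
  have hLv : ∀ a : V x, L ((s x).v (TotalSpace.mk' F x a)).2 =
      ((s p).v (TotalSpace.mk' F x a)).2 := by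
    intro a
    refine ((s x).v.coordChangeL_apply (s p).v hxb _).trans ?_
    rw [(s x).v.symm_apply_apply_mk hxb.1]
  have hwx : AnalyticAt ℝ (s x).w (0, (s x).u x) := (s x).analyticOnNhd_w _ ⟨h0, (s x).mem_O⟩
  have hwp : AnalyticAt ℝ (s p).w (0, (s p).u x) := (s p).analyticOnNhd_w _ ⟨h0, hxO⟩
  have hLw : AnalyticAt ℝ (fun z => L (dt (s x).w z)) (0, (s x).u x) :=
    (L.analyticAt _).fun_comp hwx.dt
  have e1 : (fun t => L (dt (s x).w (t, (s x).u x)) - dt (s p).w (t, (s p).u x))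
      =O[𝓝 0] fun t : ℝ => t ^ (k + 1) := by
    have h1 := ((L.isBigO_comp _ _).trans (hO x x (s x).mem_source (s x).mem_O)).sub (hO p x hx hxO)
    refine h1.congr_left fun t => ?_
    rw [map_sub, hLv]
    abel
  have hline : ∀ {W : ℝ × E → F} {y : E}, AnalyticAt ℝ W (0, y) →
      AnalyticAt ℝ (fun t => W (t, y)) 0 := fun {W y} hW =>
    AnalyticAt.fun_comp (f := fun t : ℝ => (t, y)) hW (analyticAt_id.prod analyticAt_const)
  have e2 := iteratedDeriv_eq_zero_of_isBigO ((hline hLw).sub (hline hwp.dt)) e1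
  rw [iteratedDeriv_sub (hline hLw).contDiffAt (hline hwp.dt).contDiffAt,
    iteratedDeriv_eq_dt_iterate hLw, iteratedDeriv_eq_dt_iterate hwp.dt,
    dt_iterate_clm_comp L hwx.dt] at e2
  exact sub_eq_zero.1 e2

/-- By analyticity in time, the local solutions and their time derivatives are compatible. -/
theorem compatible (s : ∀ x, LocalSolution X c₀ ε x) (k : ℕ) {t : ℝ} (ht : t ∈ Ioo (-ε) ε) :
    Compatible s k t := by
  have := FiniteDimensional.complete ℝ F
  have h0 : (0 : ℝ) ∈ Ioo (-ε) ε := by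
    have : -ε < ε := ht.1.trans ht.2
    constructor <;> linarith
  intro p x hx hxO
  have hlp := (s p).isAnalytic.linear
  have hlx := (s x).isAnalytic.linear
  rw [← coordChangeL_dt_iterate hx]
  set L : F →L[ℝ] F := ((s x).v.coordChangeL ℝ (s p).v x : F →L[ℝ] F) with hL
  have hwx : ∀ t ∈ Ioo (-ε) ε, AnalyticAt ℝ (s x).w (t, (s x).u x) :=
    fun t ht => (s x).analyticOnNhd_w _ ⟨ht, (s x).mem_O⟩
  have hwp : ∀ t ∈ Ioo (-ε) ε, AnalyticAt ℝ (s p).w (t, (s p).u x) :=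
    fun t ht => (s p).analyticOnNhd_w _ ⟨ht, hxO⟩
  have hLw : ∀ t ∈ Ioo (-ε) ε, AnalyticAt ℝ (fun z => L ((s x).w z)) (t, (s x).u x) :=
    fun t ht => (L.analyticAt _).fun_comp (hwx t ht)
  have hline : ∀ {W : ℝ × E → F} {y : E}, (∀ t ∈ Ioo (-ε) ε, AnalyticAt ℝ W (t, y)) →
      AnalyticOnNhd ℝ (fun t => W (t, y)) (Ioo (-ε) ε) := fun {W y} hW t ht =>
    AnalyticAt.fun_comp (f := fun t : ℝ => (t, y)) (hW t ht) (analyticAt_id.prod analyticAt_const)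
  have key : EqOn (fun t => L ((s x).w (t, (s x).u x))) (fun t => (s p).w (t, (s p).u x))
      (Ioo (-ε) ε) := by
    refine eqOn_of_iteratedDeriv_eq (hline hLw) (hline hwp) fun j => ?_
    rw [iteratedDeriv_eq_dt_iterate (hLw 0 h0), iteratedDeriv_eq_dt_iterate (hwp 0 h0),
      dt_iterate_clm_comp L (hwx 0 h0), coordChangeL_dt_iterate hx]
    exact compatible_zero s h0 j p x hx hxO
  have h1 := (key.eventuallyEq_of_mem (isOpen_Ioo.mem_nhds ht)).iteratedDeriv_eq k
  rwa [iteratedDeriv_eq_dt_iterate (hLw t ht), iteratedDeriv_eq_dt_iterate (hwp t ht),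
    dt_iterate_clm_comp L (hwx t ht)] at h1

lemma localRep_globalSection (s : ∀ x, LocalSolution X c₀ ε x) (k : ℕ) {t : ℝ}
    (ht : t ∈ Ioo (-ε) ε) (p : M) {y : E} (hy : y ∈ (s p).O) :
    localRep (s p).u (s p).v (fun x => globalSection s k t x) y = dt^[k] (s p).w (t, y) := by
  have := FiniteDimensional.complete ℝ F
  exact (compatible s k ht).localRep_globalSection ht p hy

/-- A smooth section is determined by its components at the centres of the local solutions. -/
lemma ext_localRep {f g : Cₛ^∞⟮𝓘(ℝ, E); F, V⟯} (s : ∀ x, LocalSolution X c₀ ε x)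
    (h : ∀ p, localRep (s p).u (s p).v (fun x => f x) ((s p).u p) =
      localRep (s p).u (s p).v (fun x => g x) ((s p).u p)) : f = g := by
  refine ContMDiffSection.ext fun x => ?_
  have hb := (s x).source_subset (s x).mem_source
  have h1 := h x
  simp only [localRep_apply _ _ _ (s x).mem_source] at h1
  rw [← (s x).v.symm_apply_apply_mk hb (f x), h1, (s x).v.symm_apply_apply_mk hb]

lemma globalSection_zero_zero (s : ∀ x, LocalSolution X c₀ ε x) (h0 : (0 : ℝ) ∈ Ioo (-ε) ε) :
    globalSection s 0 0 = c₀ :=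
  ext_localRep s fun p => by
    rw [localRep_globalSection s 0 h0 p (s p).mem_O]
    exact (s p).initial _ (s p).mem_O

/-- The equation, in the form `X c = c'`, where `c'` is formed by the time derivatives of the local
solutions. -/
lemma apply_globalSection_zero (s : ∀ x, LocalSolution X c₀ ε x) {t : ℝ}
    (ht : t ∈ Ioo (-ε) ε) : X (globalSection s 0 t) = globalSection s 1 t := by
  have := FiniteDimensional.complete ℝ F
  refine ext_localRep s fun p => ?_
  have hev : localRep (s p).u (s p).v (fun x => globalSection s 0 t x) =ᶠ[𝓝 ((s p).u p)]
      fun y => (s p).w (t, y) := by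
    filter_upwards [(s p).isOpen_O.mem_nhds (s p).mem_O] with y hy
      using localRep_globalSection s 0 ht p hy
  have hmem : (t, (s p).u p) ∈ Ioo (-ε) ε ×ˢ (s p).O := ⟨ht, (s p).mem_O⟩
  rw [(s p).operator_eq _ _ (s p).mem_source, hev.fderiv_eq, hev.self_of_nhds,
    localRep_globalSection s 1 ht p (s p).mem_O,
    (hasFDerivAt_dy ((s p).analyticOnNhd_w _ hmem).differentiableAt).fderiv]
  exact ((s p).dt_eq _ hmem).symm

variable [IsManifold 𝓘(ℝ, E) ω M] [ContMDiffVectorBundle ω F V 𝓘(ℝ, E)]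

lemma hasCurveDerivAt_globalSection (s : ∀ x, LocalSolution X c₀ ε x) (k : ℕ) {t : ℝ}
    (ht : t ∈ Ioo (-ε) ε) :
    HasCurveDerivAt (globalSection s k) (globalSection s (k + 1) t) t := by
  have := FiniteDimensional.complete ℝ F
  refine tendsto_smoothSection_of_local fun p => ?_
  have hlp := (s p).isAnalytic.linear
  obtain ⟨r, hr, hrO⟩ := Metric.nhds_basis_closedBall.mem_iff.1
    ((s p).isOpen_O.mem_nhds (s p).mem_O)
  have hbO : Metric.ball ((s p).u p) r ⊆ (s p).O := Metric.ball_subset_closedBall.trans hrO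
  refine ⟨(s p).u, (s p).v, Metric.ball ((s p).u p) r, (s p).mem_atlas, (s p).isAnalytic,
    Metric.isOpen_ball, (s p).mem_source, Metric.mem_ball_self hr,
    hbO.trans (s p).subset_target, fun y hy => symm_mem_baseSet p (hbO hy), fun m => ?_⟩
  have hs := (tendstoUniformlyOn_iteratedFDeriv_slope isOpen_Ioo (s p).isOpen_O
    (isCompact_closedBall ((s p).u p) r) hrO ht m
    (f := dt^[k] (s p).w) fun z hz => ((s p).analyticOnNhd_w z hz).dt_iterate k).mono
      Metric.ball_subset_closedBall
  have hshift : ∀ᶠ h in 𝓝[≠] (0 : ℝ), t + h ∈ Ioo (-ε) ε := by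
    have : Tendsto (fun h : ℝ => t + h) (𝓝[≠] 0) (𝓝 t) :=
      ((continuous_const.add continuous_id).tendsto' _ _ (by simp)).mono_left nhdsWithin_le_nhds
    exact this.eventually (isOpen_Ioo.mem_nhds ht)
  refine (hs.congr ?_).congr_right ?_
  · filter_upwards [hshift] with h hh y hy
    refine (EventuallyEq.iteratedFDeriv ℝ ?_ m).self_of_nhds
    filter_upwards [(s p).isOpen_O.mem_nhds (hbO hy)] with y' hy'
    rw [← localRep_globalSection s k hh p hy', ← localRep_globalSection s k ht p hy',
      ← localRep_sub _ _ (symm_mem_baseSet p hy'), ← localRep_smul _ _ (symm_mem_baseSet p hy')]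
    rfl
  · intro y hy
    refine (EventuallyEq.iteratedFDeriv ℝ ?_ m).self_of_nhds
    filter_upwards [(s p).isOpen_O.mem_nhds (hbO hy)] with y' hy'
    rw [localRep_globalSection s (k + 1) ht p hy', Function.iterate_succ_apply']

lemma hasSum_globalSection (s : ∀ x, LocalSolution X c₀ ε x) {t : ℝ} (ht : t ∈ Ioo (-ε) ε) :
    HasSum (fun k : ℕ => (t ^ k / (k ! : ℝ)) • globalSection s k 0) (globalSection s 0 t) := by
  have := FiniteDimensional.complete ℝ F
  have h0 : (0 : ℝ) ∈ Ioo (-ε) ε := by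
    have : -ε < ε := ht.1.trans ht.2
    constructor <;> linarith
  refine tendsto_smoothSection_of_local fun p => ?_
  refine ⟨(s p).u, (s p).v, (s p).O, (s p).mem_atlas, (s p).isAnalytic, (s p).isOpen_O,
    (s p).mem_source, (s p).mem_O, (s p).subset_target, fun y hy => symm_mem_baseSet p hy,
    fun m => ?_⟩
  refine (((s p).tendsto_timeTaylor t ht m).congr ?_).congr_right ?_
  · refine Eventually.of_forall fun S y hy => ?_
    refine (EventuallyEq.iteratedFDeriv ℝ ?_ m).self_of_nhds
    filter_upwards [(s p).isOpen_O.mem_nhds hy] with y' hy'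
      using (localRep_taylor h0 S (fun k _ => compatible_zero s h0 k) t p hy').symm
  · intro y hy
    refine (EventuallyEq.iteratedFDeriv ℝ ?_ m).self_of_nhds
    filter_upwards [(s p).isOpen_O.mem_nhds hy] with y' hy'
      using (localRep_globalSection s 0 ht p hy').symm

lemma contMDiffOn_globalSection (s : ∀ x, LocalSolution X c₀ ε x) :
    ContMDiffOn (𝓘(ℝ, ℝ).prod 𝓘(ℝ, E)) (𝓘(ℝ, E).prod 𝓘(ℝ, F)) ω
      (fun q : ℝ × M => TotalSpace.mk' F q.2 (globalSection s 0 q.1 q.2))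
      (Ioo (-ε) ε ×ˢ univ) := by
  have := FiniteDimensional.complete ℝ F
  rintro ⟨t, x⟩ ⟨ht, -⟩
  refine ContMDiffAt.contMDiffWithinAt ?_
  refine (s x).isAnalytic.contMDiffAt_mk (HN := ModelProd ℝ E) contMDiffAt_snd
    ((s x).source_subset (s x).mem_source) ?_
  have h1 : ContMDiffAt (𝓘(ℝ, ℝ).prod 𝓘(ℝ, E)) 𝓘(ℝ, ℝ × E) ω
      (fun q : ℝ × M => (q.1, (s x).u q.2)) (t, x) := by
    have hu : ContMDiffAt 𝓘(ℝ, E) 𝓘(ℝ, E) ω (s x).u x :=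
      (contMDiffOn_of_mem_maximalAtlas (s x).mem_atlas).contMDiffAt
        ((s x).u.open_source.mem_nhds (s x).mem_source)
    exact contMDiffAt_fst.prodMk_space (ContMDiffAt.comp (t, x) hu contMDiffAt_snd)
  have h2 : ContMDiffAt 𝓘(ℝ, ℝ × E) 𝓘(ℝ, F) ω (s x).w (t, (s x).u x) :=
    contMDiffAt_iff_contDiffAt.2 ((s x).analyticOnNhd_w _ ⟨ht, (s x).mem_O⟩).contDiffAt
  refine (ContMDiffAt.comp (t, x) h2 h1).congr_of_eventuallyEq ?_
  have hev : ∀ᶠ q in 𝓝 (t, x), q.1 ∈ Ioo (-ε) ε ∧ q.2 ∈ (s x).u.source ∩ (s x).u ⁻¹' (s x).O :=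
    (continuousAt_fst.eventually (isOpen_Ioo.mem_nhds ht)).and
      (continuousAt_snd.eventually (((s x).u.isOpen_inter_preimage (s x).isOpen_O).mem_nhds
        ⟨(s x).mem_source, (s x).mem_O⟩))
  filter_upwards [hev] with q hq
  have h3 := localRep_globalSection s 0 hq.1 x hq.2.2
  rwa [localRep_apply _ _ _ hq.2.1] at h3

end LocalSolution

/-- Existence of a real analytic solution that is the sum of its Taylor series. -/
theorem exists_isAnalyticSolution [VectorBundle ℝ F V] [FiniteDimensional ℝ E]
    [FiniteDimensional ℝ F] [IsManifold 𝓘(ℝ, E) ω M] [ContMDiffVectorBundle ω F V 𝓘(ℝ, E)]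
    [CompactSpace M] (hX : IsAnalyticFirstOrderDiffOp X) (hc₀ : IsAnalyticSection c₀) :
    ∃ ε > 0, ∃ c : ℝ → Cₛ^∞⟮𝓘(ℝ, E); F, V⟯, IsAnalyticSolution X c₀ ε c ∧
      ∃ d : ℕ → ℝ → Cₛ^∞⟮𝓘(ℝ, E); F, V⟯, IsIteratedCurveDeriv ε c d ∧
        ∀ t ∈ Ioo (-ε) ε, HasSum (fun k : ℕ => (t ^ k / (k ! : ℝ)) • d k 0) (c t) := by
  obtain ⟨ε, hε, h⟩ := LocalSolution.exists_forall_nonempty hX hc₀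
  set s : ∀ x, LocalSolution X c₀ ε x := fun x => (h x).some
  refine ⟨ε, hε, LocalSolution.globalSection s 0, ⟨?_, ?_, ?_⟩, LocalSolution.globalSection s,
    ⟨rfl, fun k t ht => LocalSolution.hasCurveDerivAt_globalSection s k ht⟩,
    fun t ht => LocalSolution.hasSum_globalSection s ht⟩
  · exact LocalSolution.globalSection_zero_zero s ⟨neg_lt_zero.2 hε, hε⟩
  · intro t ht
    rw [LocalSolution.apply_globalSection_zero s ht]
    exact LocalSolution.hasCurveDerivAt_globalSection s 0 ht
  · exact LocalSolution.contMDiffOn_globalSection s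

end GlobalSolution

end

theorem theorem2p12 {n s : ℕ}
    {M : Type*} [TopologicalSpace M] [T2Space M] [CompactSpace M]
    [ChartedSpace (EuclideanSpace ℝ (Fin n)) M] [IsManifold (𝓡 n) ω M]
    {V : M → Type*} [TopologicalSpace (TotalSpace (EuclideanSpace ℝ (Fin s)) V)]
    [∀ x, AddCommGroup (V x)] [∀ x, Module ℝ (V x)] [∀ x, TopologicalSpace (V x)]
    [FiberBundle (EuclideanSpace ℝ (Fin s)) V] [VectorBundle ℝ (EuclideanSpace ℝ (Fin s)) V]
    [ContMDiffVectorBundle ω (EuclideanSpace ℝ (Fin s)) V (𝓡 n)]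
    (X : Cₛ^∞⟮𝓡 n; EuclideanSpace ℝ (Fin s), V⟯ → Cₛ^∞⟮𝓡 n; EuclideanSpace ℝ (Fin s), V⟯)
    (hX : IsAnalyticFirstOrderDiffOp X)
    (c₀ : Cₛ^∞⟮𝓡 n; EuclideanSpace ℝ (Fin s), V⟯) (hc₀ : IsAnalyticSection c₀) :
    (∃ ε > 0, ∃ c : ℝ → Cₛ^∞⟮𝓡 n; EuclideanSpace ℝ (Fin s), V⟯,
      IsAnalyticSolution X c₀ ε c ∧
      ∃ d : ℕ → ℝ → Cₛ^∞⟮𝓡 n; EuclideanSpace ℝ (Fin s), V⟯,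
        IsIteratedCurveDeriv ε c d ∧
        ∀ t ∈ Ioo (-ε) ε, HasSum (fun k : ℕ => (t ^ k / (k ! : ℝ)) • d k 0) (c t)) ∧
    ∀ δ > 0, ∀ c₁ c₂ : ℝ → Cₛ^∞⟮𝓡 n; EuclideanSpace ℝ (Fin s), V⟯,
      IsAnalyticSolution X c₀ δ c₁ → IsAnalyticSolution X c₀ δ c₂ →
        EqOn c₁ c₂ (Ioo (-δ) δ) :=
  ⟨exists_isAnalyticSolution hX hc₀, fun _ _ _ _ h₁ h₂ => h₁.eqOn hX h₂⟩
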